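/- All graphs are finite and simple. For a family $\mathcal H$ of graphs, a graph $G$ is $\mathcal H$-saturated if no subgraph of $G$ is isomorphic to a member of $\mathcal H$, but for every pair $e=uv$ of distinct non-adjacent vertices of $G$ the graph $G+e$ has a subgraph isomorphic to a member of $\mathcal H$. Let $\mathrm{ES}(n,\mathcal H)$ be the set of all numbers $|E(G)|$, where $G$ runs over the $n$-vertex $\mathcal H$-saturated graphs, and let $\mathrm{sat}(n,\mathcal H)=\min \mathrm{ES}(n,\mathcal H)$ and $\mathrm{ex}(n,\mathcal H)=\max \mathrm{ES}(n,\mathcal H)$. Let $2\mathcal C_{\ge 3}$ be the family of all vertex-disjoint unions of two cycles (of any lengths at least $3$, equal or not). For integers $a\le b$ write $[a,b]=\{a,a+1,\dots,b\}$. Theorem. (i) $\mathrm{ES}(6,2\mathcal C_{\ge 3})=[\mathrm{sat}(6,2\mathcal C_{\ge 3}),\mathrm{ex}(6,2\mathcal C_{\ge 3})]=[10,12]$, with $\mathrm{sat}(6,2\mathcal C_{\ge 3})=10$ and $\mathrm{ex}(6,2\mathcal C_{\ge 3})=12$. (ii) Let $n\ge 7$ be an integer. For every integer $m\in[n+5,3n-6]$,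 there is an $n$-vertex $2\mathcal C_{\ge 3}$-saturated graph with $m$ edges if and only if $m\in[n+5,2n-2]$ or $m-n$ is even. Moreover, $$\mathrm{ES}(n,2\mathcal C_{\ge 3})=[n+5,2n-2]\cup\{n+2t : t\in[3,n-3]\}.$$ In particular, for every integer $m\ge 2n-1$, there is an $n$-vertex $2\mathcal C_{\ge 3}$-saturated graph with $m$ edges if and only if $m-n$ is even and $m\le 3n-6$. -/

import Mathlib

/-- A family of graphs. -/
abbrev GraphFamily : Type 1 := Set ((V : Type) × SimpleGraph V)

/-- `G` is `𝓗`-saturated: `G` has no subgraph isomorphic to a member of `𝓗`, but adding any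
non-edge `uv` to `G` creates one (`⊑` means: is isomorphic to a not necessarily induced
subgraph of). -/
def IsSaturated (𝓗 : GraphFamily) {V : Type} (G : SimpleGraph V) : Prop :=
  (∀ H ∈ 𝓗, ¬ SimpleGraph.IsContained H.2 G) ∧
    ∀ u v : V, u ≠ v → ¬ G.Adj u v →
      ∃ H ∈ 𝓗, SimpleGraph.IsContained H.2 (G ⊔ SimpleGraph.edge u v)

/-- The saturation spectrum: the set of all sizes of `𝓗`-saturated graphs on `n` vertices. -/
def satSpectrum (n : ℕ) (𝓗 : GraphFamily) : Set ℕ :=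
  {m | ∃ G : SimpleGraph (Fin n), IsSaturated 𝓗 G ∧ G.edgeSet.ncard = m}

/-- The saturation number: the minimum size of an `𝓗`-saturated graph on `n` vertices. -/
noncomputable def satNumber (n : ℕ) (𝓗 : GraphFamily) : ℕ := sInf (satSpectrum n 𝓗)

/-- The Turán number: the maximum size of an `𝓗`-saturated graph on `n` vertices. -/
noncomputable def turanNumber (n : ℕ) (𝓗 : GraphFamily) : ℕ := sSup (satSpectrum n 𝓗)

/-- The vertex-disjoint union of a family of graphs. -/
def disjointUnion {ι : Type} {V : ι → Type} (G : (i : ι) → SimpleGraph (V i)) :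
    SimpleGraph ((i : ι) × V i) where
  Adj x y := ∃ (i : ι) (a b : V i), (G i).Adj a b ∧ x = ⟨i, a⟩ ∧ y = ⟨i, b⟩
  symm := ⟨by
    rintro x y ⟨i, a, b, h, hx, hy⟩
    exact ⟨i, b, a, h.symm, hy, hx⟩⟩
  loopless := ⟨by
    rintro x ⟨i, a, b, h, rfl, hy⟩
    obtain rfl : a = b := by simpa using hy
    exact h.ne rfl⟩

/-- The family of the vertex-disjoint unions of `k` cycles, of any lengths at least `3`. -/
def disjointCycles (k : ℕ) : GraphFamily :=
  {H | ∃ r : Fin k → ℕ, (∀ i, 3 ≤ r i) ∧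
    H = ⟨(i : Fin k) × Fin (r i), disjointUnion fun i => SimpleGraph.cycleGraph (r i)⟩}

/-! Cycles are handled through cores, vertex sets in which every vertex has two neighbours. In a
finite graph, disjoint cycles exist exactly when disjoint cores do
(`isSaturated_disjointCycles_iff`), so walks are rarely needed. Adding a missing edge `uv` to a
saturated graph gives a core `D` through `u` and `v` and a disjoint core `E` of the old graph
(`CoreSaturated.exists_cores`); most structural facts come from asking which vertices `E` must
contain.

Necessity, for a saturated graph on n ≥ 6 vertices. If no two vertices meet all cycles, deleting
vertices of degree one and suppressing vertices of degree two reduces the graph to K₅. Each step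
loses one vertex and one edge, so there are n + 5 edges (`edgeCount_of_forall_not_isForestOn`). If
two vertices do meet all cycles, a centroid argument gives one of two structures
(`isTwiceCovered_or_isAlmostForest`). (1) Every cycle contains two of three vertices a, b, c.
Saturation makes them a triangle and makes the graph minus any two of them a tree. Hence all three
have the same number k of neighbours outside, and there are n + 2k edges; medians of trees rule out
k < 3. (2) Removing a vertex x and an edge leaves a forest. If G - x is a forest, it is a tree fully
joined to x, with n ≥ 8 and 2n - 3 edges. Otherwise G - x is connected with a single cycle, the rim,
so there are n - 1 + deg x ≤ 2n - 2 edges. If deg x ≤ 5 and some vertex is neither x nor on the rim,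
structure (1) reappears. What remains is deg x ≥ 6, giving at least n + 5 edges, or a wheel with 2n
- 2, which falls below n + 5 only for n = 6.

Sufficiency: `triangleJoin` realises n + 2t and `wheelTail` realises [n + 5, 2n - 2]. For n = 6 the
sizes 10, 11, 12 come from the wheel with five spokes, K₅ with a pendant edge, and `triangleJoin 6
3`. -/

namespace SimpleGraph

/-! ### Cores, forests and connectivity inside a vertex set -/

variable {V : Type*} {G G' : SimpleGraph V} {S T D : Set V} {a b p q u v w x y : V}

/-- The graph on all of `V` that keeps only the edges of `G` inside `S`. -/
def within (G : SimpleGraph V) (S : Set V) : SimpleGraph V where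
  Adj x y := G.Adj x y ∧ x ∈ S ∧ y ∈ S
  symm := ⟨fun _ _ h => ⟨h.1.symm, h.2.2, h.2.1⟩⟩
  loopless := ⟨fun _ h => h.1.ne rfl⟩

/-- A nonempty set of vertices each of which has two neighbours inside the set.
Such a set contains the vertex set of a cycle, and vertex sets of cycles are of this kind. -/
def IsCore (G : SimpleGraph V) (D : Set V) : Prop :=
  D.Nonempty ∧ ∀ x ∈ D, ∃ y ∈ D, ∃ z ∈ D, y ≠ z ∧ G.Adj x y ∧ G.Adj x z

/-- The subgraph induced on `S` contains no cycle. -/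
def IsForestOn (G : SimpleGraph V) (S : Set V) : Prop := ∀ D ⊆ S, ¬ G.IsCore D

/-- The subgraph induced on `S` is (pre)connected. -/
def ConnOn (G : SimpleGraph V) (S : Set V) : Prop :=
  ∀ p ∈ S, ∀ q ∈ S, (G.within S).Reachable p q

/-- The subgraph induced on `S` has no two disjoint cycles. -/
def NoDisjointCores (G : SimpleGraph V) (S : Set V) : Prop :=
  ∀ D ⊆ S, ∀ E ⊆ S, G.IsCore D → G.IsCore E → ¬ Disjoint D E

@[simp] lemma within_adj : (G.within S).Adj x y ↔ G.Adj x y ∧ x ∈ S ∧ y ∈ S := Iff.rfl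

lemma within_mono (hG : G ≤ G') (hS : S ⊆ T) : G.within S ≤ G'.within T :=
  fun _ _ h => ⟨hG h.1, hS h.2.1, hS h.2.2⟩

@[simp] lemma within_univ : G.within Set.univ = G := by ext; simp

lemma within_le : G.within S ≤ G := fun _ _ h => h.1

lemma IsCore.mono (hG : G ≤ G') (h : G.IsCore D) : G'.IsCore D :=
  ⟨h.1, fun x hx => let ⟨y, hy, z, hz, hne, h1, h2⟩ := h.2 x hx
    ⟨y, hy, z, hz, hne, hG h1, hG h2⟩⟩

lemma IsForestOn.anti (hG : G ≤ G') (hS : S ⊆ T) (h : G'.IsForestOn T) : G.IsForestOn S :=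
  fun D hD hc => h D (hD.trans hS) (hc.mono hG)

lemma IsForestOn.subset (h : G.IsForestOn T) (hS : S ⊆ T) : G.IsForestOn S := h.anti le_rfl hS

lemma not_isForestOn : ¬ G.IsForestOn S ↔ ∃ D ⊆ S, G.IsCore D := by
  simp [IsForestOn]

lemma NoDisjointCores.subset (h : G.NoDisjointCores T) (hS : S ⊆ T) : G.NoDisjointCores S :=
  fun D hD E hE => h D (hD.trans hS) E (hE.trans hS)

lemma NoDisjointCores.isForestOn (h : G.NoDisjointCores S) (hD : D ⊆ S) (hc : G.IsCore D)
    (hT : T ⊆ S) (hdis : Disjoint D T) : G.IsForestOn T :=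
  fun E hE hcE => h D hD E (hE.trans hT) hc hcE (hdis.mono_right hE)

lemma IsCore.exists_adj_ne (h : G.IsCore D) (hx : x ∈ D) (w : V) :
    ∃ y ∈ D, y ≠ w ∧ G.Adj x y := by
  obtain ⟨y, hy, z, hz, hne, h1, h2⟩ := h.2 x hx
  by_cases hyw : y = w
  · exact ⟨z, hz, fun hzw => hne (hyw.trans hzw.symm), h2⟩
  · exact ⟨y, hy, hyw, h1⟩

/-- The basic pruning tool: it peels pendant vertices off a hypothetical core. -/
lemma IsCore.notMem_of_unique (h : G.IsCore D) (hx : ∀ y ∈ D, G.Adj x y → y = w) : x ∉ D :=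
  fun hxD => let ⟨y, hy, hne, ha⟩ := h.exists_adj_ne hxD w
    hne (hx y hy ha)

lemma reachable_within_of_walk (c : G.Walk p q) (h : ∀ x ∈ c.support, x ∈ S) :
    (G.within S).Reachable p q := by
  induction c with
  | nil => rfl
  | cons hadj c ih =>
    simp only [Walk.support_cons, List.mem_cons, forall_eq_or_imp] at h
    exact (Adj.reachable (G := G.within S)
      ⟨hadj, h.1, h.2 _ c.start_mem_support⟩).trans (ih h.2)

lemma reachable_of_adj_imp (f : V → V) {H H' : SimpleGraph V}
    (hf : ∀ x y, H.Adj x y → H'.Reachable (f x) (f y)) (h : H.Reachable p q) :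
    H'.Reachable (f p) (f q) := by
  obtain ⟨c⟩ := h
  induction c with
  | nil => rfl
  | cons hadj c ih => exact (hf _ _ hadj).trans ih

lemma mem_of_mem_support_within (c : (G.within S).Walk p q) (hp : p ∈ S) :
    ∀ x ∈ c.support, x ∈ S := by
  induction c with
  | nil => simpa using hp
  | cons hadj c ih =>
    simp only [Walk.support_cons, List.mem_cons, forall_eq_or_imp]
    exact ⟨hp, ih hadj.2.2⟩

lemma Reachable.mem_within (h : (G.within S).Reachable p q) (hp : p ∈ S) : q ∈ S := by
  obtain ⟨c⟩ := h
  exact mem_of_mem_support_within c hp _ c.end_mem_support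

lemma Reachable.left_mem_within (h : (G.within S).Reachable p q) (hne : p ≠ q) : p ∈ S := by
  obtain ⟨c⟩ := h
  cases c with
  | nil => exact absurd rfl hne
  | cons hadj _ => exact hadj.2.1

lemma isCore_support {c : G.Walk v v} (hc : c.IsCycle) : G.IsCore {x | x ∈ c.support} := by
  refine ⟨⟨v, c.start_mem_support⟩, fun x hx => ?_⟩
  classical
  have hc' := hc.rotate hx
  have hsub : ∀ y, y ∈ (c.rotate x hx).support → y ∈ c.support := fun y hy => by simpa using hy
  exact ⟨_, hsub _ (Walk.getVert_mem_support ..), _, hsub _ (Walk.getVert_mem_support ..),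
    hc'.snd_ne_penultimate, (c.rotate x hx).adj_snd hc'.not_nil,
    ((c.rotate x hx).adj_penultimate hc'.not_nil).symm⟩

/-- In an acyclic graph the end of a longest path has no neighbour but the next vertex of the path:
one off the path would lengthen it, another one on it would close a cycle. A core gives that end two
neighbours. -/
lemma IsCore.not_isAcyclic [Finite V] (h : G.IsCore D) : ¬ (G.within D).IsAcyclic := by
  intro hac
  obtain ⟨s, hs⟩ := h.1
  have : Nonempty D := ⟨⟨s, hs⟩⟩
  have hac' : (G.induce D).IsAcyclic :=
    hac.comap (⟨Subtype.val, fun {x y} hxy => ⟨hxy, x.2, y.2⟩⟩ : G.induce D →g G.within D)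
      Subtype.val_injective
  have ⟨u, v, p, hp, hmax⟩ := Walk.exists_isPath_forall_isPath_length_le_length (G.induce D)
  obtain ⟨y, hy, z, hz, hne, h1, h2⟩ := h.2 u.1 u.2
  have key : ∀ w : D, (G.induce D).Adj u w → w = p.snd := by
    intro w hadj
    apply hac'.eq_snd_of_adj_start hp hadj
    have : ¬(p.cons hadj.symm).IsPath := by grind [Walk.length_cons]
    grind [hp.cons]
  exact hne (congrArg Subtype.val ((key ⟨y, hy⟩ h1).trans (key ⟨z, hz⟩ h2).symm))

lemma isForestOn_iff [Finite V] : G.IsForestOn S ↔ (G.within S).IsAcyclic := by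
  constructor
  · intro h v c hc
    refine h {x | x ∈ c.support} ?_ ((isCore_support hc).mono within_le)
    have := c.adj_snd hc.not_nil
    exact mem_of_mem_support_within c this.2.1
  · intro h D hD hc
    exact hc.not_isAcyclic (h.anti (within_mono le_rfl hD))

lemma IsForestOn.sup_edge [Finite V] (h : G.IsForestOn S) (hpq : ¬ (G.within S).Reachable p q) :
    (G ⊔ edge p q).IsForestOn S := by
  rw [isForestOn_iff] at h ⊢
  refine (h.sup_edge_of_not_reachable hpq).anti fun x y hxy => ?_
  obtain ⟨h1 | h1, h2, h3⟩ := hxy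
  · exact Or.inl ⟨h1, h2, h3⟩
  · exact Or.inr h1

lemma not_isForestOn_of_reachable [Finite V] (hadj : G.Adj u w) (hu : u ∈ S) (hw : w ∈ S)
    (h : ((G.deleteEdges {s(u, w)}).within S).Reachable u w) : ¬ G.IsForestOn S := by
  rw [isForestOn_iff, isAcyclic_iff_forall_adj_isBridge]
  intro hb
  refine isBridge_iff.1 (hb (v := u) (w := w) ⟨hadj, hu, hw⟩) (h.mono fun x y hxy => ?_)
  simp only [within_adj, deleteEdges_adj] at hxy ⊢
  tauto

lemma not_isForestOn_insert [Finite V] (hpq : p ≠ q) (hp : G.Adj u p) (hq : G.Adj u q)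
    (h : (G.within S).Reachable p q) (hu : u ∉ S) : ¬ G.IsForestOn (insert u S) := by
  have hpS := h.left_mem_within hpq
  have hqS := h.symm.left_mem_within hpq.symm
  refine not_isForestOn_of_reachable hp (Set.mem_insert _ _) (Set.mem_insert_of_mem _ hpS) ?_
  have h1 : ((G.deleteEdges {s(u, p)}).within (insert u S)).Adj u q := by
    refine ⟨?_, Set.mem_insert _ _, Set.mem_insert_of_mem _ hqS⟩
    simp only [deleteEdges_adj, Set.mem_singleton_iff, Sym2.eq_iff]
    refine ⟨hq, ?_⟩
    rintro (⟨-, h⟩ | ⟨h, -⟩)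
    · exact hpq h.symm
    · exact hp.ne h
  refine h1.reachable.trans (h.symm.mono fun x y hxy => ?_)
  refine ⟨?_, Set.mem_insert_of_mem _ hxy.2.1, Set.mem_insert_of_mem _ hxy.2.2⟩
  simp only [deleteEdges_adj, Set.mem_singleton_iff, Sym2.eq_iff]
  refine ⟨hxy.1, ?_⟩
  rintro (⟨h, -⟩ | ⟨-, h⟩)
  · exact hu (h ▸ hxy.2.1)
  · exact hu (h ▸ hxy.2.2)

/-- The standard way to produce cycles: a connection between two neighbours of `u` closes up through
`u`. -/
lemma exists_core_insert [Finite V] (hpq : p ≠ q) (hp : G.Adj u p) (hq : G.Adj u q)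
    (h : (G.within S).Reachable p q) (hu : u ∉ S) : ∃ D ⊆ insert u S, G.IsCore D :=
  not_isForestOn.1 (not_isForestOn_insert hpq hp hq h hu)

/-- Converse to `exists_core_insert`. A cycle inside `D` must pass through `u`, and its two
neighbours of `u` are joined by the rest of the cycle. -/
lemma IsCore.exists_reachable [Finite V] (hD : G.IsCore D) (hf : G.IsForestOn (D \ {u})) :
    ∃ p ∈ D, ∃ q ∈ D, p ≠ q ∧ G.Adj u p ∧ G.Adj u q ∧
      (G.within (D \ {u})).Reachable p q := by
  have hna := hD.not_isAcyclic
  simp only [IsAcyclic, not_forall, not_not] at hna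
  obtain ⟨v, c, hc⟩ := hna
  have hsub : ∀ x ∈ c.support, x ∈ D := mem_of_mem_support_within c (c.adj_snd hc.not_nil).2.1
  have hu : u ∈ c.support := by
    by_contra hu
    refine hf {x | x ∈ c.support} (fun x hx => ⟨hsub x hx, ?_⟩)
      ((isCore_support hc).mono within_le)
    rintro rfl
    exact hu hx
  classical
  have hc' := hc.rotate hu
  generalize c.rotate u hu = c' at hc'
  cases c' with
  | nil => exact absurd hc' Walk.not_isCycle_nil
  | cons h c1 =>
    rename_i p
    rw [Walk.cons_isCycle_iff] at hc'
    obtain ⟨hpath, hedge⟩ := hc'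
    -- Reversing the path exposes the second cycle neighbour `q` of `u`; it differs from `p` because
    -- a cycle does not repeat the edge `up`.
    have hpath' := hpath.reverse
    rw [← List.mem_reverse, ← Walk.edges_reverse] at hedge
    generalize c1.reverse = c2 at hpath' hedge
    cases c2 with
    | nil => exact absurd rfl h.ne
    | cons h' c3 =>
      rename_i q
      rw [Walk.cons_isPath_iff] at hpath'
      refine ⟨p, h.2.2, q, h'.2.2, ?_, h.1, h'.1, ?_⟩
      · rintro rfl
        exact hedge (by simp)
      · have h3 := mem_of_mem_support_within c3 h'.2.2
        refine ((reachable_within_of_walk (S := D \ {u}) (c3.mapLe within_le) fun x hx => ?_)).symm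
        rw [Walk.support_mapLe_eq_support] at hx
        refine ⟨h3 x hx, ?_⟩
        rintro rfl
        exact hpath'.2 hx

/-- Paths in a forest are unique, so the paths found in `S₁` and in `S₂` are the same path. -/
lemma IsForestOn.reachable_inter [Finite V] {S₁ S₂ : Set V} (h : G.IsForestOn S) (h₁ : S₁ ⊆ S)
    (h₂ : S₂ ⊆ S) (r₁ : (G.within S₁).Reachable p q) (r₂ : (G.within S₂).Reachable p q) :
    (G.within (S₁ ∩ S₂)).Reachable p q := by
  by_cases hpq : p = q
  · rw [hpq]
  have hp₁ := r₁.left_mem_within hpq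
  have hp₂ := r₂.left_mem_within hpq
  obtain ⟨c₁, hc₁⟩ := r₁.exists_isPath
  obtain ⟨c₂, hc₂⟩ := r₂.exists_isPath
  have m₁ := within_mono (le_refl G) h₁
  have m₂ := within_mono (le_refl G) h₂
  have heq := ((isForestOn_iff.1 h).subsingleton_path p q).elim
    ⟨c₁.mapLe m₁, hc₁.mapLe m₁⟩ ⟨c₂.mapLe m₂, hc₂.mapLe m₂⟩
  have hsup : c₁.support = c₂.support := by
    have := congrArg (fun c : (G.within S).Path p q => c.1.support) heq
    simpa using this
  refine reachable_within_of_walk (c₁.mapLe within_le) fun x hx => ?_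
  have hx₁ : x ∈ c₁.support := by simpa using hx
  exact ⟨mem_of_mem_support_within c₁ hp₁ x hx₁,
    mem_of_mem_support_within c₂ hp₂ x (hsup ▸ hx₁)⟩

lemma le_deleteEdges_sup_edge (G : SimpleGraph V) (w p : V) :
    G ≤ G.deleteEdges {s(w, p)} ⊔ edge w p := by
  intro x y hxy
  simp only [sup_adj, deleteEdges_adj, Set.mem_singleton_iff, edge_adj, Sym2.eq_iff]
  have := hxy.ne
  tauto

lemma IsCore.reachable_deleteEdges [Finite V] (hD : G.IsCore D)
    (h : (G.deleteEdges {s(w, p)}).IsForestOn D) :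
    ((G.deleteEdges {s(w, p)}).within D).Reachable w p := by
  by_contra hr
  exact h.sup_edge hr D le_rfl (hD.mono (le_deleteEdges_sup_edge G w p))

/-- If deleting one edge leaves a forest, then any two cores share a core. -/
lemma exists_core_inter [Finite V] {D₁ D₂ : Set V}
    (h : (G.deleteEdges {s(w, p)}).IsForestOn S) (h₁ : D₁ ⊆ S) (h₂ : D₂ ⊆ S)
    (hD₁ : G.IsCore D₁) (hD₂ : G.IsCore D₂) : ∃ D ⊆ D₁ ∩ D₂, G.IsCore D := by
  -- Each core must contain a path from `w` to `p` in the forest. By uniqueness it is the same path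
  -- for both, and the edge `wp` closes it inside the intersection.
  by_cases hadj : G.Adj w p
  · have r₁ := hD₁.reachable_deleteEdges (h.subset h₁)
    have r₂ := hD₂.reachable_deleteEdges (h.subset h₂)
    have r := h.reachable_inter h₁ h₂ r₁ r₂
    exact not_isForestOn.1 (not_isForestOn_of_reachable hadj (r.left_mem_within hadj.ne)
      (r.symm.left_mem_within hadj.ne.symm) r)
  · refine absurd (hD₁.mono fun x y hxy => ?_) (h D₁ h₁)
    simp only [deleteEdges_adj, Set.mem_singleton_iff, Sym2.eq_iff]
    refine ⟨hxy, ?_⟩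
    rintro (⟨rfl, rfl⟩ | ⟨rfl, rfl⟩)
    · exact hadj hxy
    · exact hadj hxy.symm

lemma isCore_of_sup_edge (h : (G ⊔ edge p q).IsCore D) (hpq : p ∉ D ∨ q ∉ D) : G.IsCore D := by
  refine ⟨h.1, fun x hx => ?_⟩
  obtain ⟨y, hy, z, hz, hne, h1, h2⟩ := h.2 x hx
  have key : ∀ y ∈ D, (G ⊔ edge p q).Adj x y → G.Adj x y := by
    intro y hy hxy
    rcases hxy with hxy | hxy
    · exact hxy
    · rw [edge_adj] at hxy
      rcases hxy.1 with ⟨rfl, rfl⟩ | ⟨rfl, rfl⟩ <;> tauto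
  exact ⟨y, hy, z, hz, hne, key y hy h1, key z hz h2⟩

lemma IsForestOn.exists_leaf (h : G.IsForestOn S) (hD : D ⊆ S) (hne : D.Nonempty) :
    ∃ y ∈ D, ∀ p ∈ D, ∀ q ∈ D, G.Adj y p → G.Adj y q → p = q := by
  have := h D hD
  simp only [IsCore, hne, true_and] at this
  push Not at this
  obtain ⟨y, hy, h⟩ := this
  exact ⟨y, hy, fun p hp q hq h1 h2 => by_contra fun hpq => h p hp q hq hpq h1 h2⟩

/-- One exceptional vertex `y` is allowed. With two neighbours it is no exception and `X` is a core;
with none, `X \ {y}` is a core; with exactly one neighbour `s`, delete `y` and let `s` be the new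
exception. This is what yields a second leaf of a tree. -/
lemma exists_core_of_leaf [Finite V] : ∀ (n : ℕ) (X : Set V) (y : V), X.ncard = n → y ∈ X →
    2 ≤ X.ncard →
    (∀ x ∈ X, x ≠ y → ∃ s ∈ X, ∃ t ∈ X, s ≠ t ∧ G.Adj x s ∧ G.Adj x t) → ∃ D ⊆ X, G.IsCore D := by
  intro n
  induction n with
  | zero => intro X y hn hy h2; omega
  | succ n ih =>
    intro X y hn hy h2 hX
    by_cases hy0 : ∃ s ∈ X, G.Adj y s
    · obtain ⟨s, hs, hys⟩ := hy0
      by_cases hy1 : ∃ t ∈ X, s ≠ t ∧ G.Adj y t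
      · obtain ⟨t, ht, hst, hyt⟩ := hy1
        refine ⟨X, le_rfl, ⟨y, hy⟩, fun x hx => ?_⟩
        by_cases hxy : x = y
        · subst hxy
          exact ⟨s, hs, t, ht, hst, hys, hyt⟩
        · exact hX x hx hxy
      · push Not at hy1
        have hcard := Set.ncard_sdiff_singleton_add_one hy
        have hsX : s ∈ X \ {y} := ⟨hs, hys.ne.symm⟩
        obtain ⟨s₁, hs₁, s₂, hs₂, hne, h1, h2'⟩ := hX s hs hys.ne.symm
        have : 2 ≤ (X \ {y}).ncard := by
          have hex : ∃ r ∈ X \ {y}, r ≠ s := by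
            by_cases hs1 : s₁ = y
            · exact ⟨s₂, ⟨hs₂, fun h => hne (hs1.trans h.symm)⟩, h2'.ne.symm⟩
            · exact ⟨s₁, ⟨hs₁, hs1⟩, h1.ne.symm⟩
          obtain ⟨r, hr, hrs⟩ := hex
          have : 1 < (X \ {y}).ncard := (Set.one_lt_ncard (Set.toFinite _)).2 ⟨r, hr, s, hsX, hrs⟩
          omega
        obtain ⟨D, hD, hc⟩ := ih (X \ {y}) s (by omega) hsX this (by
          intro x hx hxs
          obtain ⟨t₁, ht₁, t₂, ht₂, hne, h1, h2⟩ := hX x hx.1 hx.2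
          have hny : ¬ G.Adj x y := fun h => hy1 x hx.1 (Ne.symm hxs) h.symm
          refine ⟨t₁, ⟨ht₁, ?_⟩, t₂, ⟨ht₂, ?_⟩, hne, h1, h2⟩
          · rintro rfl; exact hny h1
          · rintro rfl; exact hny h2)
        exact ⟨D, hD.trans Set.sdiff_subset, hc⟩
    · push Not at hy0
      refine ⟨X \ {y}, Set.sdiff_subset, ?_, fun x hx => ?_⟩
      · obtain ⟨r, hr, hry⟩ := Set.exists_ne_of_one_lt_ncard (by omega : 1 < X.ncard) y
        exact ⟨r, hr, hry⟩
      · obtain ⟨t₁, ht₁, t₂, ht₂, hne, h1, h2⟩ := hX x hx.1 hx.2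
        refine ⟨t₁, ⟨ht₁, ?_⟩, t₂, ⟨ht₂, ?_⟩, hne, h1, h2⟩
        · rintro rfl; exact hy0 x hx.1 h1.symm
        · rintro rfl; exact hy0 x hx.1 h2.symm

lemma IsForestOn.exists_leaf_ne [Finite V] (h : G.IsForestOn S) (hD : D ⊆ S) (hy : y ∈ D)
    (h2 : 2 ≤ D.ncard) : ∃ z ∈ D, z ≠ y ∧ ∀ p ∈ D, ∀ q ∈ D, G.Adj z p → G.Adj z q → p = q := by
  by_contra hcon
  push Not at hcon
  obtain ⟨E, hE, hc⟩ := exists_core_of_leaf (G := G) _ D y rfl hy h2 (by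
    intro x hx hxy
    obtain ⟨s, hs, t, ht, h1, h2, h3⟩ := hcon x hx hxy
    exact ⟨s, hs, t, ht, h3, h1, h2⟩)
  exact h E (hE.trans hD) hc

end SimpleGraph

/-! ### Counting edges, components, small cores -/

namespace SimpleGraph

variable {V : Type*} {G : SimpleGraph V} {S T D : Set V} {p q u v w x y z : V}

/-- The number of edges inside `S`. -/
noncomputable def edgeCount (G : SimpleGraph V) (S : Set V) : ℕ := (G.within S).edgeSet.ncard

lemma edgeCount_univ : G.edgeCount Set.univ = G.edgeSet.ncard := by simp [edgeCount]

lemma edgeCount_insert [Finite V] (hv : v ∉ S) :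
    G.edgeCount (insert v S) = G.edgeCount S + (G.neighborSet v ∩ S).ncard := by
  have hset : (G.within (insert v S)).edgeSet =
      (G.within S).edgeSet ∪ (fun y => s(v, y)) '' (G.neighborSet v ∩ S) := by
    ext e
    induction e with
    | h x y =>
      simp only [mem_edgeSet, within_adj, Set.mem_insert_iff, Set.mem_union, Set.mem_image,
        Set.mem_inter_iff, mem_neighborSet, Sym2.eq_iff]
      constructor
      · rintro ⟨h, rfl | hx, rfl | hy⟩
        · exact absurd rfl h.ne
        · exact Or.inr ⟨y, ⟨h, hy⟩, Or.inl ⟨rfl, rfl⟩⟩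
        · exact Or.inr ⟨x, ⟨h.symm, hx⟩, Or.inr ⟨rfl, rfl⟩⟩
        · exact Or.inl ⟨h, hx, hy⟩
      · rintro (⟨h, hx, hy⟩ | ⟨z, ⟨h, hz⟩, ⟨rfl, rfl⟩ | ⟨rfl, rfl⟩⟩)
        · exact ⟨h, Or.inr hx, Or.inr hy⟩
        · exact ⟨h, Or.inl rfl, Or.inr hz⟩
        · exact ⟨h.symm, Or.inr hz, Or.inl rfl⟩
  rw [edgeCount, hset, Set.ncard_union_eq, Set.ncard_image_of_injective, edgeCount]
  · intro y z h
    rcases Sym2.eq_iff.1 h with h | h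
    · exact h.2
    · exact h.2.trans h.1
  · rw [Set.disjoint_left]
    rintro e he ⟨y, -, rfl⟩
    exact hv he.2.1

lemma edgeCount_sdiff_singleton [Finite V] (hv : v ∈ S) :
    G.edgeCount S = G.edgeCount (S \ {v}) + (G.neighborSet v ∩ S).ncard := by
  have h := edgeCount_insert (G := G) (S := S \ {v}) (v := v) (by simp)
  rw [Set.insert_sdiff_self_of_mem hv] at h
  rw [h]
  congr 2
  ext x
  simp only [Set.mem_inter_iff, mem_neighborSet, Set.mem_sdiff, Set.mem_singleton_iff]
  exact ⟨fun h => ⟨h.1, h.2.1⟩, fun h => ⟨h.1, h.2, h.1.ne.symm⟩⟩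

lemma edgeCount_eq_of_le_one (hS : S.Subsingleton) : G.edgeCount S = 0 := by
  have : (G.within S).edgeSet = ∅ := by
    ext e
    induction e with
    | h x y =>
      simp only [mem_edgeSet, within_adj, Set.mem_empty_iff_false, iff_false]
      rintro ⟨h, hx, hy⟩
      exact h.ne (hS hx hy)
  rw [edgeCount, this, Set.ncard_empty]

lemma edgeCount_sup_edge [Finite V] (hu : u ∈ S) (hw : w ∈ S) (hne : u ≠ w) (h : ¬ G.Adj u w) :
    (G ⊔ edge u w).edgeCount S = G.edgeCount S + 1 := by
  have hset : ((G ⊔ edge u w).within S).edgeSet = insert s(u, w) (G.within S).edgeSet := by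
    ext e
    induction e with
    | h x y =>
      simp only [mem_edgeSet, within_adj, Set.mem_insert_iff, sup_adj, edge_adj, Sym2.eq_iff]
      constructor
      · tauto
      · rintro ((⟨rfl, rfl⟩ | ⟨rfl, rfl⟩) | h)
        · tauto
        · have := hne.symm
          tauto
        · tauto
  rw [edgeCount, hset, Set.ncard_insert_of_notMem, edgeCount]
  intro h'
  exact h h'.1

lemma ncard_neighborSet_le_one [Finite V]
    (h : ∀ p ∈ S, ∀ q ∈ S, G.Adj y p → G.Adj y q → p = q) :
    (G.neighborSet y ∩ S).ncard ≤ 1 :=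
  (Set.ncard_le_one (Set.toFinite _)).2 fun p hp q hq => h p hp.2 q hq.2 hp.1 hq.1

lemma ConnOn.exists_adj (h : G.ConnOn S) (hx : x ∈ S) (hy : y ∈ S) (hne : x ≠ y) :
    ∃ z ∈ S, G.Adj x z := by
  obtain ⟨c⟩ := h x hx y hy
  cases c with
  | nil => exact absurd rfl hne
  | cons hadj _ => exact ⟨_, hadj.2.2, hadj.1⟩

/-- Removing a leaf keeps connectedness. -/
lemma ConnOn.sdiff_leaf (h : G.ConnOn S)
    (hleaf : ∀ p ∈ S, ∀ q ∈ S, G.Adj y p → G.Adj y q → p = q) : G.ConnOn (S \ {y}) := by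
  classical
  intro p hp q hq
  by_cases hy : ∃ z ∈ S, G.Adj y z
  · obtain ⟨z, hz, hyz⟩ := hy
    -- Walks are pushed off the leaf `y` by collapsing it onto its only neighbour `z`.
    have := reachable_of_adj_imp (H := G.within S) (H' := G.within (S \ {y}))
      (p := p) (q := q) (fun x => if x = y then z else x) ?_ (h p hp.1 q hq.1)
    · have h1 : p ≠ y := hp.2
      have h2 : q ≠ y := hq.2
      simpa [h1, h2] using this
    · rintro s t ⟨hadj, hs, ht⟩
      by_cases hsy : s = y
      · subst hsy
        have : t = z := hleaf t ht z hz hadj hyz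
        subst this
        simp [hadj.ne.symm]
      · by_cases hty : t = y
        · subst hty
          have : s = z := hleaf s hs z hz hadj.symm hyz
          subst this
          simp [hsy]
        · simp only [hsy, hty, if_false]
          exact Adj.reachable ⟨hadj, ⟨hs, hsy⟩, ⟨ht, hty⟩⟩
  · push Not at hy
    refine (h p hp.1 q hq.1).mono ?_
    rintro s t ⟨hadj, hs, ht⟩
    refine ⟨hadj, ⟨hs, ?_⟩, ⟨ht, ?_⟩⟩
    · rintro rfl; exact hy t ht hadj
    · rintro rfl; exact hy s hs hadj.symm

lemma IsForestOn.edgeCount_add_one_eq [Finite V] (h : G.IsForestOn S) (hS : S.Nonempty)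
    (hc : G.ConnOn S) : G.edgeCount S + 1 = S.ncard := by
  induction hn : S.ncard generalizing S with
  | zero => exact absurd ((Set.ncard_eq_zero (Set.toFinite _)).1 hn) hS.ne_empty
  | succ n ih =>
    obtain ⟨y, hy, hleaf⟩ := h.exists_leaf le_rfl hS
    have hcard := Set.ncard_sdiff_singleton_add_one hy (Set.toFinite S)
    by_cases hne : (S \ {y}).Nonempty
    · have := ih (h.subset Set.sdiff_subset) hne (hc.sdiff_leaf hleaf) (by omega)
      have h1 := ncard_neighborSet_le_one hleaf
      obtain ⟨r, hr⟩ := hne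
      obtain ⟨z, hz, hyz⟩ := hc.exists_adj hy hr.1 (Ne.symm hr.2)
      have h2 : 0 < (G.neighborSet y ∩ S).ncard := (Set.ncard_pos (Set.toFinite _)).2 ⟨z, hyz, hz⟩
      rw [edgeCount_sdiff_singleton hy]
      omega
    · rw [Set.not_nonempty_iff_eq_empty, Set.sdiff_eq_empty] at hne
      have := Set.subsingleton_of_subset_singleton hne
      have h1 : S.ncard ≤ 1 := (Set.ncard_le_one (Set.toFinite _)).2 fun a ha b hb => this ha hb
      rw [edgeCount_eq_of_le_one this]
      omega

/-! ### The set of vertices reachable inside `S` -/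

/-- The component of `p` in the subgraph induced on `S`. -/
def comp (G : SimpleGraph V) (S : Set V) (p : V) : Set V := {q | (G.within S).Reachable p q}

lemma self_mem_comp : p ∈ G.comp S p := Reachable.refl _

lemma comp_subset (hp : p ∈ S) : G.comp S p ⊆ S := fun _ hq => hq.mem_within hp

lemma mem_comp_of_adj (hq : q ∈ G.comp S p) (hp : p ∈ S) (hx : x ∈ S) (h : G.Adj q x) :
    x ∈ G.comp S p :=
  Reachable.trans hq (Adj.reachable ⟨h, comp_subset hp hq, hx⟩)

lemma reachable_within_comp (h : (G.within S).Reachable p q) :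
    (G.within (G.comp S p)).Reachable p q := by
  obtain ⟨c⟩ := h
  refine reachable_within_of_walk (c.mapLe within_le) fun x hx => ?_
  rw [Walk.support_mapLe_eq_support] at hx
  classical
  exact (c.takeUntil x hx).reachable

lemma connOn_comp : G.ConnOn (G.comp S p) := fun _ hx _ hy =>
  (reachable_within_comp hx).symm.trans (reachable_within_comp hy)

lemma ConnOn.subset_comp (h : G.ConnOn T) (hT : T ⊆ S) (hp : p ∈ T) : T ⊆ G.comp S p :=
  fun q hq => (h p hp q hq).mono (within_mono le_rfl hT)

lemma exists_core_insert_of_connOn [Finite V] (hK : G.ConnOn T) (hpq : p ≠ q) (hp : G.Adj u p)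
    (hq : G.Adj u q) (hpT : p ∈ T) (hqT : q ∈ T) (hu : u ∉ T) : ∃ D ⊆ insert u T, G.IsCore D :=
  exists_core_insert hpq hp hq (hK p hpT q hqT) hu

lemma isCore_triple (hxy : G.Adj x y) (hyz : G.Adj y z) (hxz : G.Adj x z) :
    G.IsCore {x, y, z} := by
  refine ⟨⟨x, by simp⟩, ?_⟩
  rintro t (rfl | rfl | rfl)
  · exact ⟨y, by simp, z, by simp, hyz.ne, hxy, hxz⟩
  · exact ⟨x, by simp, z, by simp, hxz.ne, hxy.symm, hyz⟩
  · exact ⟨x, by simp, y, by simp, hxy.ne, hxz.symm, hyz.symm⟩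

lemma isCore_quadruple {t : V} (hxy : G.Adj x y) (hyz : G.Adj y z) (hzt : G.Adj z t)
    (htx : G.Adj t x) (hxz : x ≠ z) (hyt : y ≠ t) : G.IsCore {x, y, z, t} := by
  refine ⟨⟨x, by simp⟩, ?_⟩
  rintro s (rfl | rfl | rfl | rfl)
  · exact ⟨y, by simp, t, by simp, hyt, hxy, htx.symm⟩
  · exact ⟨x, by simp, z, by simp, hxz, hxy.symm, hyz⟩
  · exact ⟨y, by simp, t, by simp, hyt, hyz.symm, hzt⟩
  · exact ⟨x, by simp, z, by simp, hxz, htx, hzt.symm⟩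

end SimpleGraph

/-! ### Cores and copies of cycles -/

namespace SimpleGraph

variable {V : Type*} {G : SimpleGraph V} {D : Set V}

lemma isCore_image_cycleGraph {n : ℕ} (hn : 3 ≤ n) (f : Fin n → V)
    (hf : Function.Injective f) (hadj : ∀ i j, (cycleGraph n).Adj i j → G.Adj (f i) (f j)) :
    G.IsCore (Set.range f) := by
  obtain ⟨m, rfl⟩ : ∃ m, n = m + 3 := ⟨n - 3, by omega⟩
  refine ⟨⟨f 0, 0, rfl⟩, ?_⟩
  rintro _ ⟨i, rfl⟩
  refine ⟨f (i + 1), ⟨_, rfl⟩, f (i - 1), ⟨_, rfl⟩, ?_, hadj _ _ ?_, hadj _ _ ?_⟩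
  · intro h
    have h1 := hf h
    -- Successor and predecessor on the cycle could agree only if 2 = 0 modulo the length, which
    -- length at least 3 excludes.
    have h2 : (1 : Fin (m + 3)) + 1 = 0 := by
      have := congrArg (fun t => t - i + 1) h1
      simpa [add_sub_cancel_left, add_sub_right_comm, sub_self] using this
    have h3 := congrArg Fin.val h2
    simp only [Fin.val_add, Fin.val_one, Fin.val_zero] at h3
    rw [Nat.mod_eq_of_lt (by omega)] at h3
    omega
  · rw [cycleGraph_adj]; simp
  · rw [cycleGraph_adj]; simp

lemma IsCore.exists_cycleGraph [Finite V] (h : G.IsCore D) :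
    ∃ n, 3 ≤ n ∧ ∃ f : Fin n → V, Function.Injective f ∧ (∀ i, f i ∈ D) ∧
      ∀ i j, (cycleGraph n).Adj i j → G.Adj (f i) (f j) := by
  have := h.not_isAcyclic
  rw [isAcyclic_iff_free_cycleGraph] at this
  simp only [Free, not_forall, not_not] at this
  obtain ⟨n, hn, ⟨c⟩⟩ := this
  refine ⟨n, hn, c, c.injective, fun i => ?_, fun i j hij => (c.toHom.map_adj hij).1⟩
  obtain ⟨m, rfl⟩ : ∃ m, n = m + 3 := ⟨n - 3, by omega⟩
  exact (c.toHom.map_adj (cycleGraph_adj.2 (by simp) : (cycleGraph (m + 3)).Adj i (i + 1))).2.1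

/-- The two cycles of a copy have cores as images, disjoint by injectivity; conversely each of two
disjoint cores contains a cycle. -/
lemma exists_isContained_disjointCycles_iff {V : Type} [Finite V] {G : SimpleGraph V} :
    (∃ H ∈ disjointCycles 2, H.2 ⊑ G) ↔ ¬ G.NoDisjointCores Set.univ := by
  constructor
  · rintro ⟨H, ⟨r, hr, rfl⟩, ⟨c⟩⟩ hno
    have hcore : ∀ i, G.IsCore (Set.range fun j => c (⟨i, j⟩ : (i : Fin 2) × Fin (r i))) := by
      intro i
      refine isCore_image_cycleGraph (hr i) _ (fun j k hjk => ?_) fun j k hjk => ?_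
      · have := c.injective hjk
        simpa using this
      · exact c.toHom.map_adj ⟨i, j, k, hjk, rfl, rfl⟩
    refine hno _ (Set.subset_univ _) _ (Set.subset_univ _) (hcore 0) (hcore 1) ?_
    rw [Set.disjoint_left]
    rintro _ ⟨j, rfl⟩ ⟨k, hk⟩
    have := congrArg Sigma.fst (c.injective hk)
    simp at this
  · intro h
    simp only [NoDisjointCores, not_forall, not_not] at h
    obtain ⟨D, -, E, -, hD, hE, hdis⟩ := h
    obtain ⟨n, hn, f, hf, hfD, hfa⟩ := hD.exists_cycleGraph
    obtain ⟨m, hm, g, hg, hgE, hga⟩ := hE.exists_cycleGraph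
    have main : ∀ i : Fin 2, ∃ n, 3 ≤ n ∧ ∃ f : Fin n → V, Function.Injective f ∧
        (∀ j, f j ∈ if i = 0 then D else E) ∧
        ∀ j k, (cycleGraph n).Adj j k → G.Adj (f j) (f k) := by
      intro i
      by_cases hi : i = 0
      · exact ⟨n, hn, f, hf, by simpa [hi] using hfD, hfa⟩
      · exact ⟨m, hm, g, hg, by simpa [hi] using hgE, hga⟩
    choose r hr F hF hFm hFa using main
    refine ⟨_, ⟨r, hr, rfl⟩, ⟨⟨⟨fun x => F x.1 x.2, ?_⟩, ?_⟩⟩⟩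
    · rintro x y ⟨i, j, k, hjk, rfl, rfl⟩
      exact hFa i j k hjk
    · have hne : ∀ (j : Fin (r 0)) (k : Fin (r 1)), F 0 j ≠ F 1 k := by
        intro j k hjk
        have h0 := hFm 0 j
        have h1 := hFm 1 k
        simp only [if_true, one_ne_zero, if_false] at h0 h1
        rw [hjk] at h0
        exact Set.disjoint_left.1 hdis h0 h1
      rintro ⟨i, j⟩ ⟨i', k⟩ hjk
      change F i j = F i' k at hjk
      obtain rfl | hii := eq_or_ne i i'
      · rw [hF i hjk]
      · exfalso
        fin_cases i <;> fin_cases i'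
        · exact hii rfl
        · exact hne _ _ hjk
        · exact hne _ _ hjk.symm
        · exact hii rfl

/-- Saturation for pairs of disjoint cycles, in terms of cores. -/
def CoreSaturated (G : SimpleGraph V) : Prop :=
  G.NoDisjointCores Set.univ ∧
    ∀ u v, u ≠ v → ¬ G.Adj u v → ¬ (G ⊔ edge u v).NoDisjointCores Set.univ

lemma isSaturated_disjointCycles_iff {V : Type} [Finite V] {G : SimpleGraph V} :
    IsSaturated (disjointCycles 2) G ↔ G.CoreSaturated := by
  unfold IsSaturated CoreSaturated
  simp only [exists_isContained_disjointCycles_iff]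
  refine and_congr_left fun _ => ?_
  rw [← not_not (a := G.NoDisjointCores Set.univ), ← exists_isContained_disjointCycles_iff]
  exact ⟨fun h ⟨H, h1, h2⟩ => h H h1 h2, fun h H h1 h2 => h ⟨H, h1, h2⟩⟩

end SimpleGraph

/-! ### Minimum degree three: only K₅ survives -/

namespace SimpleGraph

variable {V : Type*} {G : SimpleGraph V} {S T F D : Set V} {a b c d p q u v w x y z : V}

lemma NoDisjointCores.false_of_disjoint (h : G.NoDisjointCores S) {E : Set V} (hD : G.IsCore D)
    (hE : G.IsCore E) (hDS : D ⊆ S) (hES : E ⊆ S) (hdis : ∀ x ∈ D, x ∉ E) : False :=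
  h D hDS E hES hD hE (Set.disjoint_left.2 hdis)

lemma edgeCount_insert_of_forall_adj [Finite V] (hv : v ∉ S) (h : ∀ x ∈ S, G.Adj v x) :
    G.edgeCount (insert v S) = G.edgeCount S + S.ncard := by
  rw [edgeCount_insert hv]
  congr 2
  ext x
  exact ⟨fun hx => hx.2, fun hx => ⟨h x hx, hx⟩⟩

lemma comp_disjoint_of_notMem (h : q ∉ G.comp S p) : Disjoint (G.comp S p) (G.comp S q) := by
  rw [Set.disjoint_left]
  intro x hx hx'
  exact h (Reachable.trans hx (Reachable.symm hx'))

/-- A component that carries cycles through `c` loses them when a leaf adjacent to `a` and `b`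
is removed. -/
lemma eq_of_leaf_of_triangle [Finite V] (hno : G.NoDisjointCores S)
    (haS : a ∈ S) (hbS : b ∈ S) (hcS : c ∈ S)
    (hab : G.Adj a b) (hac : a ≠ c) (hbc : b ≠ c)
    (hTS : T ⊆ S) (haT : a ∉ T) (hbT : b ∉ T) (hcT : c ∉ T) (hT : G.ConnOn T) (hyT : y ∈ T)
    (hy : ∀ p ∈ T, ∀ q ∈ T, G.Adj y p → G.Adj y q → p = q)
    (hya : G.Adj y a) (hyb : G.Adj y b) :
    ∀ s ∈ T \ {y}, ∀ t ∈ T \ {y}, G.Adj c s → G.Adj c t → s = t := by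
  intro s hs t ht hcs hct
  by_contra hst
  obtain ⟨D, hD, hcore⟩ := exists_core_insert_of_connOn (hT.sdiff_leaf hy) hst hcs hct hs ht
    (fun h => hcT h.1)
  refine hno.false_of_disjoint hcore (isCore_triple hya hab hyb) ?_ ?_ ?_
  · intro x hx
    rcases hD hx with rfl | hx
    · exact hcS
    · exact hTS hx.1
  · rintro x (rfl | rfl | rfl)
    exacts [hTS hyT, haS, hbS]
  · intro x hx
    rcases hD hx with rfl | hx
    · rintro (rfl | rfl | rfl)
      exacts [hcT hyT, hac rfl, hbc rfl]
    · rintro (rfl | rfl | rfl)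
      exacts [hx.2 rfl, haT hx.1, hbT hx.1]

/-- Outside the triangle there is a forest `F`. A cycle avoiding two corners must use the third, so
each corner has two neighbours in one component of `F`; two different components would give disjoint
cycles, so it is one component `T` for all corners. A leaf of `T` sees two corners, and then also
the third, since `T` minus the leaf can close no cycle with that corner. It follows that `T` is a
single edge and is all of `F`, which makes K₅. -/
lemma card_eq_of_triangle [Finite V] (hno : G.NoDisjointCores S)
    (hdeg : ∀ v ∈ S, ∀ s t, ∃ x ∈ S, G.Adj v x ∧ x ≠ s ∧ x ≠ t)
    (hcov : ∀ u w, ∃ D ⊆ S, G.IsCore D ∧ u ∉ D ∧ w ∉ D)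
    (haS : a ∈ S) (hbS : b ∈ S) (hcS : c ∈ S)
    (hab : G.Adj a b) (hbc : G.Adj b c) (hac : G.Adj a c) :
    S.ncard = 5 ∧ G.edgeCount S = 10 := by
  set F : Set V := S \ {a, b, c} with hFdef
  have hFS : F ⊆ S := Set.sdiff_subset
  have hmem : ∀ x ∈ S, x = a ∨ x = b ∨ x = c ∨ x ∈ F := by
    intro x hx
    by_cases h : x ∈ ({a, b, c} : Set V)
    · rcases h with h | h | h
      exacts [Or.inl h, Or.inr (Or.inl h), Or.inr (Or.inr (Or.inl h))]
    · exact Or.inr (Or.inr (Or.inr ⟨hx, h⟩))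
  have haF : a ∉ F := fun h => h.2 (by simp)
  have hbF : b ∉ F := fun h => h.2 (by simp)
  have hcF : c ∉ F := fun h => h.2 (by simp)
  have hF : G.IsForestOn F := hno.isForestOn (D := {a, b, c})
    (by rintro x (rfl | rfl | rfl) <;> assumption) (isCore_triple hab hbc hac) hFS
    (Set.disjoint_left.2 fun x hx hx' => hx'.2 hx)
  have hrich : ∀ r, (r = a ∨ r = b ∨ r = c) → ∃ s t, s ≠ t ∧ G.Adj r s ∧ G.Adj r t ∧
      s ∈ F ∧ t ∈ F ∧ (G.within F).Reachable s t := by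
    have key : ∀ r u w, (∀ x ∈ S, x = r ∨ x = u ∨ x = w ∨ x ∈ F) → ∃ s t, s ≠ t ∧ G.Adj r s ∧
        G.Adj r t ∧ s ∈ F ∧ t ∈ F ∧ (G.within F).Reachable s t := by
      intro r u w hm
      obtain ⟨D, hD, hc, hu, hw⟩ := hcov u w
      have hsub : D \ {r} ⊆ F := by
        rintro x ⟨hx, hxr⟩
        rcases hm x (hD hx) with rfl | rfl | rfl | h
        exacts [absurd rfl hxr, absurd hx hu, absurd hx hw, h]
      obtain ⟨s, hs, t, ht, hst, h1, h2, h3⟩ := hc.exists_reachable (hF.subset hsub)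
      exact ⟨s, t, hst, h1, h2, hsub ⟨hs, h1.ne.symm⟩, hsub ⟨ht, h2.ne.symm⟩,
        h3.mono (within_mono le_rfl hsub)⟩
    rintro r (rfl | rfl | rfl)
    · exact key _ _ _ hmem
    · exact key _ a c fun x hx => by have := hmem x hx; tauto
    · exact key _ a b fun x hx => by have := hmem x hx; tauto
  obtain ⟨s₀, t₀, hne₀, has₀, hat₀, hs₀F, ht₀F, hr₀⟩ := hrich a (Or.inl rfl)
  set T := G.comp F s₀ with hTdef
  have hTF : T ⊆ F := comp_subset hs₀F
  have hTc : G.ConnOn T := connOn_comp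
  have hrichT : ∀ r, (r = a ∨ r = b ∨ r = c) → ∃ s ∈ T, ∃ t ∈ T, s ≠ t ∧ G.Adj r s ∧
      G.Adj r t := by
    intro r hr
    by_cases hra : r = a
    · subst hra
      exact ⟨s₀, self_mem_comp, t₀, hr₀, hne₀, has₀, hat₀⟩
    obtain ⟨s, t, hst, h1, h2, hsF, htF, h3⟩ := hrich r hr
    have hrF : r ∉ F := by rcases hr with rfl | rfl | rfl <;> assumption
    have hrS : r ∈ S := by rcases hr with rfl | rfl | rfl <;> assumption
    by_cases hsT : s ∈ T
    · exact ⟨s, hsT, t, Reachable.trans hsT h3, hst, h1, h2⟩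
    exfalso
    have hdis := comp_disjoint_of_notMem hsT
    obtain ⟨D, hD, hDc⟩ := exists_core_insert_of_connOn hTc hne₀ has₀ hat₀ self_mem_comp hr₀
      (fun h => haF (hTF h))
    obtain ⟨E, hE, hEc⟩ := exists_core_insert_of_connOn (G := G) (T := G.comp F s)
      connOn_comp hst h1 h2 self_mem_comp h3 (fun h => hrF (comp_subset hsF h))
    refine hno.false_of_disjoint hDc hEc (hD.trans ?_) (hE.trans ?_) fun x hx hx' => ?_
    · exact Set.insert_subset haS (hTF.trans hFS)
    · exact Set.insert_subset hrS ((comp_subset hsF).trans hFS)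
    · rcases hD hx with rfl | hx <;> rcases hE hx' with rfl | hx'
      · exact hra rfl
      · exact haF (comp_subset hsF hx')
      · exact hrF (hTF hx)
      · exact Set.disjoint_left.1 hdis hx hx'
  -- leaves of the forest have two neighbours in the triangle
  have hleaf2 : ∀ y ∈ F, (∀ p ∈ F, ∀ q ∈ F, G.Adj y p → G.Adj y q → p = q) →
      (G.Adj y a ∧ G.Adj y b) ∨ (G.Adj y a ∧ G.Adj y c) ∨ (G.Adj y b ∧ G.Adj y c) := by
    intro y hy hl
    have hz : ∃ z, ∀ p ∈ F, G.Adj y p → p = z := by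
      by_cases h : ∃ z ∈ F, G.Adj y z
      · obtain ⟨z, hz, hyz⟩ := h
        exact ⟨z, fun p hp hyp => hl p hp z hz hyp hyz⟩
      · exact ⟨y, fun p hp hyp => absurd ⟨p, hp, hyp⟩ h⟩
    obtain ⟨z, hz⟩ := hz
    obtain ⟨x₁, hx₁, hy₁, hn₁, -⟩ := hdeg y (hFS hy) z z
    obtain ⟨x₂, hx₂, hy₂, hn₂, hn₃⟩ := hdeg y (hFS hy) z x₁
    have h₁ := hmem x₁ hx₁
    have h₂ := hmem x₂ hx₂
    have e₁ : x₁ ∉ F := fun h => hn₁ (hz _ h hy₁)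
    have e₂ : x₂ ∉ F := fun h => hn₂ (hz _ h hy₂)
    rcases h₁ with rfl | rfl | rfl | h <;> rcases h₂ with rfl | rfl | rfl | h' <;> tauto
  have hTleaf : ∀ y ∈ T, (∀ p ∈ T, ∀ q ∈ T, G.Adj y p → G.Adj y q → p = q) →
      ∀ p ∈ F, ∀ q ∈ F, G.Adj y p → G.Adj y q → p = q := fun y hy hl p hp q hq h1 h2 =>
    hl p (mem_comp_of_adj hy hs₀F hp h1) q (mem_comp_of_adj hy hs₀F hq h2) h1 h2
  have hstep : ∀ y ∈ T, (∀ p ∈ T, ∀ q ∈ T, G.Adj y p → G.Adj y q → p = q) →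
      ∀ a' b' c', G.Adj y a' → G.Adj y b' → G.Adj a' b' → a' ≠ c' → b' ≠ c' →
      (a' = a ∨ a' = b ∨ a' = c) → (b' = a ∨ b' = b ∨ b' = c) → (c' = a ∨ c' = b ∨ c' = c) →
      G.Adj y c' := by
    intro y hy hl a' b' c' h1 h2 h3 h4 h5 ha' hb' hc'
    obtain ⟨s, hs, t, ht, hst, hcs, hct⟩ := hrichT c' hc'
    have hIn : ∀ r, (r = a ∨ r = b ∨ r = c) → r ∈ S ∧ r ∉ T := by
      rintro r (rfl | rfl | rfl)
      exacts [⟨haS, fun h => haF (hTF h)⟩, ⟨hbS, fun h => hbF (hTF h)⟩,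
        ⟨hcS, fun h => hcF (hTF h)⟩]
    have := eq_of_leaf_of_triangle hno (hIn _ ha').1 (hIn _ hb').1 (hIn _ hc').1 h3 h4 h5
      (hTF.trans hFS) (hIn _ ha').2 (hIn _ hb').2 (hIn _ hc').2 hTc hy hl h1 h2
    by_cases hsy : s = y
    · exact hsy ▸ hcs.symm
    by_cases hty : t = y
    · exact hty ▸ hct.symm
    exact absurd (this s ⟨hs, hsy⟩ t ⟨ht, hty⟩ hcs hct) hst
  have hall : ∀ y ∈ T, (∀ p ∈ T, ∀ q ∈ T, G.Adj y p → G.Adj y q → p = q) →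
      G.Adj y a ∧ G.Adj y b ∧ G.Adj y c := by
    intro y hy hl
    rcases hleaf2 y (hTF hy) (hTleaf y hy hl) with ⟨h1, h2⟩ | ⟨h1, h2⟩ | ⟨h1, h2⟩
    · exact ⟨h1, h2, hstep y hy hl a b c h1 h2 hab hac.ne hbc.ne (by simp) (by simp) (by simp)⟩
    · exact ⟨h1, hstep y hy hl a c b h1 h2 hac hab.ne hbc.ne.symm (by simp) (by simp) (by simp), h2⟩
    · exact ⟨hstep y hy hl b c a h1 h2 hbc hab.ne.symm hac.ne.symm (by simp) (by simp) (by simp),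
        h1, h2⟩
  have hTcard : 2 ≤ T.ncard := by
    have : 1 < T.ncard := (Set.one_lt_ncard (Set.toFinite _)).2 ⟨s₀, self_mem_comp, t₀, hr₀, hne₀⟩
    omega
  obtain ⟨y, hyT, hyl⟩ := hF.exists_leaf hTF ⟨s₀, self_mem_comp⟩
  obtain ⟨z, hzT, hzy, hzl⟩ := hF.exists_leaf_ne hTF hyT hTcard
  obtain ⟨hya, hyb, hyc⟩ := hall y hyT hyl
  obtain ⟨hza, hzb, hzc⟩ := hall z hzT hzl
  have hSF : ∀ {x}, x ∈ T → x ∈ S := fun h => hFS (hTF h)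
  have haT : a ∉ T := fun h => haF (hTF h)
  have hbT : b ∉ T := fun h => hbF (hTF h)
  have hcT : c ∉ T := fun h => hcF (hTF h)
  have hTyz : ∀ t ∈ T, t = y ∨ t = z := by
    intro t ht
    by_contra hcon
    push Not at hcon
    have hX : 2 ≤ (T \ {y}).ncard := by
      have : 1 < (T \ {y}).ncard := (Set.one_lt_ncard (Set.toFinite _)).2
        ⟨t, ⟨ht, hcon.1⟩, z, ⟨hzT, hzy⟩, hcon.2⟩
      omega
    -- Each corner has at most one neighbour in `T \ {y}`, namely `z`. So a further leaf `t'` of `T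
    -- \ {y}` sees no corner and has degree at most two: besides `y`, at most one neighbour.
    obtain ⟨t', ht', htz, htl⟩ := hF.exists_leaf_ne (Set.sdiff_subset.trans hTF)
      (⟨hzT, hzy⟩ : z ∈ T \ {y}) hX
    have n1 : ¬ G.Adj t' c := fun h => htz (eq_of_leaf_of_triangle hno haS hbS hcS hab hac.ne
      hbc.ne (hTF.trans hFS) haT hbT hcT hTc hyT hyl hya hyb t' ht' z ⟨hzT, hzy⟩ h.symm hzc.symm)
    have n2 : ¬ G.Adj t' b := fun h => htz (eq_of_leaf_of_triangle hno haS hcS hbS hac hab.ne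
      hbc.ne.symm (hTF.trans hFS) haT hcT hbT hTc hyT hyl hya hyc t' ht' z ⟨hzT, hzy⟩ h.symm
      hzb.symm)
    have n3 : ¬ G.Adj t' a := fun h => htz (eq_of_leaf_of_triangle hno hbS hcS haS hbc hab.ne.symm
      hac.ne.symm (hTF.trans hFS) hbT hcT haT hTc hyT hyl hyb hyc t' ht' z ⟨hzT, hzy⟩ h.symm
      hza.symm)
    have hF' : ∀ x ∈ S, G.Adj t' x → x ∈ T := by
      intro x hx hadj
      rcases hmem x hx with rfl | rfl | rfl | h
      exacts [absurd hadj n3, absurd hadj n2, absurd hadj n1, mem_comp_of_adj ht'.1 hs₀F h hadj]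
    obtain ⟨x₁, hx₁, hy₁, hn₁, -⟩ := hdeg t' (hSF ht'.1) y y
    obtain ⟨x₂, hx₂, hy₂, hn₂, hn₃⟩ := hdeg t' (hSF ht'.1) y x₁
    exact hn₃ (htl x₂ ⟨hF' _ hx₂ hy₂, hn₂⟩ x₁ ⟨hF' _ hx₁ hy₁, hn₁⟩ hy₂ hy₁)
  have hyz : G.Adj y z := by
    obtain ⟨r, hr, hyr⟩ := hTc.exists_adj hyT hzT hzy.symm
    rcases hTyz r hr with rfl | rfl
    · exact absurd rfl hyr.ne
    · exact hyr
  have hFT : ∀ s ∈ F, s ∈ T := by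
    by_contra hcon
    push Not at hcon
    obtain ⟨s, hsF, hsT⟩ := hcon
    -- A leaf `r` in another component forms a triangle with two corners, disjoint from the triangle
    -- on `y`, `z` and the third corner.
    obtain ⟨r, ⟨hrF, hrT⟩, hrl⟩ := hF.exists_leaf (D := F \ T) Set.sdiff_subset ⟨s, hsF, hsT⟩
    have hout : ∀ p ∈ F, G.Adj r p → p ∉ T := fun p hp hadj hpT =>
      hrT (mem_comp_of_adj hpT hs₀F hrF hadj.symm)
    have hl' : ∀ p ∈ F, ∀ q ∈ F, G.Adj r p → G.Adj r q → p = q := fun p hp q hq h1 h2 =>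
      hrl p ⟨hp, hout p hp h1⟩ q ⟨hq, hout q hq h2⟩ h1 h2
    have hry : r ≠ y := fun h => hrT (h ▸ hyT)
    have hrz : r ≠ z := fun h => hrT (h ▸ hzT)
    have fin : ∀ a' b' c', a' ∈ S → b' ∈ S → c' ∈ S → a' ∉ T → b' ∉ T → a' ≠ c' → b' ≠ c' →
        c' ∉ F → G.Adj a' b' → G.Adj r a' → G.Adj r b' → G.Adj y c' → G.Adj z c' → False := by
      intro a' b' c' ha hb hc haT hbT h1 h2 hcF h3 h4 h5 h6 h7
      refine hno.false_of_disjoint (isCore_triple h4 h3 h5) (isCore_triple hyz h7 h6) ?_ ?_ ?_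
      · rintro x (rfl | rfl | rfl)
        exacts [hFS hrF, ha, hb]
      · rintro x (rfl | rfl | rfl)
        exacts [hSF hyT, hSF hzT, hc]
      · rintro x (rfl | rfl | rfl) (h | h | h)
        · exact hry h
        · exact hrz h
        · exact hcF (h ▸ hrF)
        · exact haT (h ▸ hyT)
        · exact haT (h ▸ hzT)
        · exact h1 h
        · exact hbT (h ▸ hyT)
        · exact hbT (h ▸ hzT)
        · exact h2 h
    rcases hleaf2 r hrF hl' with ⟨h1, h2⟩ | ⟨h1, h2⟩ | ⟨h1, h2⟩
    · exact fin a b c haS hbS hcS haT hbT hac.ne hbc.ne hcF hab h1 h2 hyc hzc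
    · exact fin a c b haS hcS hbS haT hcT hab.ne hbc.ne.symm hbF hac h1 h2 hyb hzb
    · exact fin b c a hbS hcS haS hbT hcT hab.ne.symm hac.ne.symm haF hbc h1 h2 hya hza
  have hS : S = {a, b, c, y, z} := by
    ext x
    constructor
    · intro hx
      rcases hmem x hx with rfl | rfl | rfl | h
      · simp
      · simp
      · simp
      · rcases hTyz x (hFT x h) with rfl | rfl <;> simp
    · rintro (rfl | rfl | rfl | rfl | rfl)
      exacts [haS, hbS, hcS, hSF hyT, hSF hzT]
  have m4 : y ∉ ({z} : Set V) := by simpa using hzy.symm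
  have m3 : c ∉ ({y, z} : Set V) := by simp [hyc.ne.symm, hzc.ne.symm]
  have m2 : b ∉ ({c, y, z} : Set V) := by simp [hyb.ne.symm, hzb.ne.symm, hbc.ne]
  have m1 : a ∉ ({b, c, y, z} : Set V) := by simp [hya.ne.symm, hza.ne.symm, hab.ne, hac.ne]
  rw [hS]
  constructor
  · rw [Set.ncard_insert_of_notMem m1, Set.ncard_insert_of_notMem m2,
      Set.ncard_insert_of_notMem m3, Set.ncard_insert_of_notMem m4, Set.ncard_singleton]
  · rw [edgeCount_insert_of_forall_adj m1 (by simp [hab, hac, hya.symm, hza.symm]),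
      edgeCount_insert_of_forall_adj m2 (by simp [hbc, hyb.symm, hzb.symm]),
      edgeCount_insert_of_forall_adj m3 (by simp [hyc.symm, hzc.symm]),
      edgeCount_insert_of_forall_adj m4 (by simp [hyz]),
      edgeCount_eq_of_le_one Set.subsingleton_singleton,
      Set.ncard_insert_of_notMem m2,
      Set.ncard_insert_of_notMem m3, Set.ncard_insert_of_notMem m4, Set.ncard_singleton]

lemma reachable_of_chain {H : SimpleGraph V} (g : ℕ → V) {i j : ℕ} (hij : i ≤ j)
    (h : ∀ k, i ≤ k → k < j → H.Adj (g k) (g (k + 1))) : H.Reachable (g i) (g j) := by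
  induction j, hij using Nat.le_induction with
  | base => rfl
  | succ j hij ih =>
    exact (ih fun k h1 h2 => h k h1 (by omega)).trans (h j hij (by omega)).reachable

lemma reachable_image_Icc (g : ℕ → V) (hg : ∀ k, G.Adj (g k) (g (k + 1))) {i j : ℕ}
    (hij : i ≤ j) : (G.within (g '' Set.Icc i j)).Reachable (g i) (g j) :=
  reachable_of_chain g hij fun k h1 h2 =>
    ⟨hg k, ⟨k, ⟨h1, h2.le⟩, rfl⟩, ⟨k + 1, ⟨by omega, by omega⟩, rfl⟩⟩

/-- In a graph of minimum degree three without triangles or disjoint cycles there is a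
cycle of length four. -/
lemma exists_four_cycle [Finite V] (hno : G.NoDisjointCores S)
    (hdeg : ∀ v ∈ S, ∀ s t, ∃ x ∈ S, G.Adj v x ∧ x ≠ s ∧ x ≠ t)
    (hcore : ∃ D ⊆ S, G.IsCore D)
    (htf : ∀ x ∈ S, ∀ y ∈ S, ∀ z ∈ S, G.Adj x y → G.Adj y z → ¬ G.Adj x z) :
    ∃ a ∈ S, ∃ b ∈ S, ∃ c ∈ S, ∃ d ∈ S, a ≠ c ∧ b ≠ d ∧ G.Adj a b ∧ G.Adj b c ∧ G.Adj c d ∧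
      G.Adj d a := by
  -- A smallest core is a shortest cycle. The map `g` below winds around it periodically, so that
  -- both arcs between two of its vertices become images of intervals.
  obtain ⟨D, ⟨hDS, hDc⟩, hmin⟩ := Set.exists_min_image {D : Set V | D ⊆ S ∧ G.IsCore D} Set.ncard
    (Set.toFinite _) hcore
  obtain ⟨n, hn, f, hf, hfD, hfa⟩ := hDc.exists_cycleGraph
  have hrc := isCore_image_cycleGraph hn f hf hfa
  have hrange : Set.range f = D := by
    refine Set.eq_of_subset_of_ncard_le (Set.range_subset_iff.2 hfD) ?_ (Set.toFinite _)
    exact hmin _ ⟨(Set.range_subset_iff.2 hfD).trans hDS, hrc⟩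
  have hcard : D.ncard = n := by
    rw [← hrange, ← Set.image_univ, Set.ncard_image_of_injective _ hf, Set.ncard_univ, Nat.card_fin]
  obtain ⟨m, rfl⟩ : ∃ m, n = m + 3 := ⟨n - 3, by omega⟩
  set g : ℕ → V := fun k => f (Fin.ofNat (m + 3) k) with hg
  have hgadj : ∀ k, G.Adj (g k) (g (k + 1)) := by
    intro k
    refine hfa _ _ ?_
    rw [cycleGraph_adj]
    right
    have : Fin.ofNat (m + 3) (k + 1) = Fin.ofNat (m + 3) k + 1 := by
      ext
      simp [Fin.val_add]
    rw [this, add_sub_cancel_left]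
  have hgD : ∀ k, g k ∈ D := fun k => hfD _
  have hgper : ∀ k, g (k + (m + 3)) = g k := by
    intro k
    simp only [hg]
    congr 1
    ext
    simp
  have hgval : ∀ x ∈ D, ∃ k < m + 3, g k = x := by
    intro x hx
    rw [← hrange] at hx
    obtain ⟨i, rfl⟩ := hx
    exact ⟨i.val, i.2, by simp only [hg, Fin.ofNat_val_eq_self]⟩
  have hm : 1 ≤ m := by
    by_contra hm0
    obtain rfl : m = 0 := by omega
    exact htf _ (hDS (hgD 0)) _ (hDS (hgD 1)) _ (hDS (hgD 2)) (hgadj 0) (hgadj 1)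
      (by simpa [hgper 0] using (hgadj 2).symm)
  -- a vertex outside of the cycle
  have hout : (S \ D).Nonempty := by
    by_contra hcon
    rw [Set.not_nonempty_iff_eq_empty, Set.sdiff_eq_empty] at hcon
    have hDS' : D = S := Set.Subset.antisymm hDS hcon
    obtain ⟨x, hx⟩ := hDc.1
    -- If `D` were all of `S`, minimum degree three would leave a smaller core after deleting a
    -- vertex.
    have := hmin (D \ {x}) ⟨Set.sdiff_subset.trans hDS, ?_, fun y hy => ?_⟩
    · have := Set.ncard_sdiff_singleton_add_one hx (Set.toFinite _)
      omega
    · obtain ⟨y, hy, hne, -⟩ := hDc.exists_adj_ne hx x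
      exact ⟨y, hy, hne⟩
    · obtain ⟨s, hs, h1, h2, -⟩ := hdeg y (hDS hy.1) x x
      obtain ⟨t, ht, h3, h4, h5⟩ := hdeg y (hDS hy.1) x s
      exact ⟨s, ⟨hcon hs, h2⟩, t, ⟨hcon ht, h4⟩, h5.symm, h1, h3⟩
  have hF : G.IsForestOn (S \ D) := hno.isForestOn hDS hDc Set.sdiff_subset Set.disjoint_sdiff_right
  obtain ⟨y, hy, hl⟩ := hF.exists_leaf le_rfl hout
  have hz : ∃ z, ∀ p ∈ S \ D, G.Adj y p → p = z := by
    by_cases h : ∃ z ∈ S \ D, G.Adj y z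
    · obtain ⟨z, hz, hyz⟩ := h
      exact ⟨z, fun p hp hyp => hl p hp z hz hyp hyz⟩
    · exact ⟨y, fun p hp hyp => absurd ⟨p, hp, hyp⟩ h⟩
  obtain ⟨z, hz⟩ := hz
  obtain ⟨x₁, hx₁, hy₁, hn₁, -⟩ := hdeg y hy.1 z z
  obtain ⟨x₂, hx₂, hy₂, hn₂, hn₃⟩ := hdeg y hy.1 z x₁
  have e₁ : x₁ ∈ D := by_contra fun h => hn₁ (hz _ ⟨hx₁, h⟩ hy₁)
  have e₂ : x₂ ∈ D := by_contra fun h => hn₂ (hz _ ⟨hx₂, h⟩ hy₂)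
  obtain ⟨i, hi, rfl⟩ := hgval x₁ e₁
  obtain ⟨j, hj, rfl⟩ := hgval x₂ e₂
  have main : ∀ i j, i < j → j < m + 3 → g j ≠ g i → G.Adj y (g i) → G.Adj y (g j) →
      ∃ a ∈ S, ∃ b ∈ S, ∃ c ∈ S, ∃ d ∈ S, a ≠ c ∧ b ≠ d ∧ G.Adj a b ∧ G.Adj b c ∧ G.Adj c d ∧
      G.Adj d a := by
    intro i j hij hj hne h1 h2
    have hsize : ∀ i j, i ≤ j → g i ≠ g j → G.Adj y (g i) → G.Adj y (g j) →
        m + 3 ≤ j - i + 2 := by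
      intro i j hij hne h1 h2
      have hsub : g '' Set.Icc i j ⊆ D := by
        rintro _ ⟨k, -, rfl⟩
        exact hgD k
      obtain ⟨E, hE, hEc⟩ := exists_core_insert hne h1 h2 (reachable_image_Icc g hgadj hij)
        (fun h => hy.2 (hsub h))
      have h3 := hmin E ⟨hE.trans (Set.insert_subset hy.1 (hsub.trans hDS)), hEc⟩
      have h4 := Set.ncard_le_ncard hE (Set.toFinite _)
      have h5 := Set.ncard_insert_le y (g '' Set.Icc i j)
      have h6 := Set.ncard_image_le (f := g) (Set.finite_Icc i j)
      rw [← Finset.coe_Icc, Set.ncard_coe_finset, Nat.card_Icc, Finset.coe_Icc] at h6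
      omega
    have l1 := hsize i j hij.le hne.symm h1 h2
    have l2 := hsize j (i + (m + 3)) (by omega) (by rw [hgper]; exact hne) h2
      (by rw [hgper]; exact h1)
    -- Closing either arc through `y` gives a core of at least `m + 3` vertices, hence `m + 1 ≤ j -
    -- i ≤ 2`, and `1 ≤ m` forces equality.
    obtain rfl : j = i + 2 := by omega
    refine ⟨y, hy.1, g i, hDS (hgD _), g (i + 1), hDS (hgD _), g (i + 2), hDS (hgD _), ?_,
      hne.symm, h1, hgadj i, hgadj (i + 1), h2.symm⟩
    intro h
    exact hy.2 (h ▸ hgD _)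
  rcases lt_trichotomy i j with h | h | h
  · exact main i j h hj hn₃ hy₁ hy₂
  · exact absurd (by rw [h]) hn₃
  · exact main j i h hi hn₃.symm hy₂ hy₁

lemma or_resolve_five {A B C D E : Prop} (h : A ∨ B ∨ C ∨ D ∨ E) (hE : ¬ E) : A ∨ B ∨ C ∨ D := by
  tauto

lemma or_rotate_four {A B C D E : Prop} (h : A ∨ B ∨ C ∨ D ∨ E) : B ∨ C ∨ D ∨ A ∨ E := by
  tauto

lemma or_swap_first_third {A B C D E : Prop} (h : A ∨ B ∨ C ∨ D ∨ E) : C ∨ B ∨ A ∨ D ∨ E := by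
  tauto

lemma or_swap_second_fourth {A B C D E : Prop} (h : A ∨ B ∨ C ∨ D ∨ E) :
    A ∨ D ∨ C ∨ B ∨ E := by
  tauto

/-- Two neighbours on a four-cycle are opposite when there are no triangles. -/
lemma opposite_of_two (h₁ : p = a ∨ p = b ∨ p = c ∨ p = d) (h₂ : q = a ∨ q = b ∨ q = c ∨ q = d)
    (hne : q ≠ p) (hp : G.Adj y p) (hq : G.Adj y q)
    (hab : G.Adj y a → ¬ G.Adj y b) (hbc : G.Adj y b → ¬ G.Adj y c)
    (hcd : G.Adj y c → ¬ G.Adj y d) (hda : G.Adj y d → ¬ G.Adj y a) :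
    (G.Adj y a ∧ G.Adj y c ∧ ¬ G.Adj y b ∧ ¬ G.Adj y d) ∨
      (G.Adj y b ∧ G.Adj y d ∧ ¬ G.Adj y a ∧ ¬ G.Adj y c) := by
  rcases h₁ with rfl | rfl | rfl | rfl <;> rcases h₂ with rfl | rfl | rfl | rfl <;> tauto

/-- The structure around a cycle `a b c d` used in the triangle-free case. -/
lemma false_of_four_cycle [Finite V] (hno : G.NoDisjointCores S)
    (hdeg : ∀ v ∈ S, ∀ s t, ∃ x ∈ S, G.Adj v x ∧ x ≠ s ∧ x ≠ t)
    (hcov : ∀ u w, ∃ D ⊆ S, G.IsCore D ∧ u ∉ D ∧ w ∉ D)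
    (htf : ∀ x ∈ S, ∀ y ∈ S, ∀ z ∈ S, G.Adj x y → G.Adj y z → ¬ G.Adj x z)
    (ha : a ∈ S) (hb : b ∈ S) (hc : c ∈ S) (hd : d ∈ S) (hac : a ≠ c) (hbd : b ≠ d)
    (hab : G.Adj a b) (hbc : G.Adj b c) (hcd : G.Adj c d) (hda : G.Adj d a) : False := by
  -- Plan: outside the 4-cycle is a forest `F`. Without triangles, each vertex with at most one
  -- neighbour in `F` sees exactly one opposite pair of the 4-cycle. Two of them seeing the same
  -- pair form a 4-cycle with it, disjoint from a core avoiding the pair. So `F` has exactly two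
  -- leaves, one of each type, and their neighbours in `F` complete two disjoint 4-cycles.
  set F : Set V := S \ {a, b, c, d} with hFdef
  have hFS : F ⊆ S := Set.sdiff_subset
  have hmem : ∀ x ∈ S, x = a ∨ x = b ∨ x = c ∨ x = d ∨ x ∈ F := by
    intro x hx
    by_cases h : x ∈ ({a, b, c, d} : Set V)
    · rcases h with h | h | h | h
      exacts [Or.inl h, Or.inr (Or.inl h), Or.inr (Or.inr (Or.inl h)),
        Or.inr (Or.inr (Or.inr (Or.inl h)))]
    · exact Or.inr (Or.inr (Or.inr (Or.inr ⟨hx, h⟩)))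
  have haF : a ∉ F := fun h => h.2 (by simp)
  have hbF : b ∉ F := fun h => h.2 (by simp)
  have hcF : c ∉ F := fun h => h.2 (by simp)
  have hdF : d ∉ F := fun h => h.2 (by simp)
  have hnac : ¬ G.Adj a c := htf a ha b hb c hc hab hbc
  have hnbd : ¬ G.Adj b d := htf b hb c hc d hd hbc hcd
  have hF : G.IsForestOn F := hno.isForestOn (D := {a, b, c, d})
    (by rintro x (rfl | rfl | rfl | rfl) <;> assumption)
    (isCore_quadruple hab hbc hcd hda hac hbd) hFS
    (Set.disjoint_left.2 fun x hx hx' => hx'.2 hx)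
  -- vertices with at most one neighbour in the forest
  have hleaf : ∀ y ∈ F, (∀ p ∈ F, ∀ q ∈ F, G.Adj y p → G.Adj y q → p = q) →
      (G.Adj y a ∧ G.Adj y c ∧ ¬ G.Adj y b ∧ ¬ G.Adj y d) ∨
        (G.Adj y b ∧ G.Adj y d ∧ ¬ G.Adj y a ∧ ¬ G.Adj y c) := by
    intro y hy hl
    have hz : ∃ z, ∀ p ∈ F, G.Adj y p → p = z := by
      by_cases h : ∃ z ∈ F, G.Adj y z
      · obtain ⟨z, hz, hyz⟩ := h
        exact ⟨z, fun p hp hyp => hl p hp z hz hyp hyz⟩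
      · exact ⟨y, fun p hp hyp => absurd ⟨p, hp, hyp⟩ h⟩
    obtain ⟨z, hz⟩ := hz
    obtain ⟨x₁, hx₁, hy₁, hn₁, -⟩ := hdeg y (hFS hy) z z
    obtain ⟨x₂, hx₂, hy₂, hn₂, hn₃⟩ := hdeg y (hFS hy) z x₁
    have h₁ := hmem x₁ hx₁
    have h₂ := hmem x₂ hx₂
    have e₁ : x₁ ∉ F := fun h => hn₁ (hz _ h hy₁)
    have e₂ : x₂ ∉ F := fun h => hn₂ (hz _ h hy₂)
    exact opposite_of_two (or_resolve_five h₁ e₁) (or_resolve_five h₂ e₂) hn₃ hy₁ hy₂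
      (fun h => htf y (hFS hy) a ha b hb h hab) (fun h => htf y (hFS hy) b hb c hc h hbc)
      (fun h => htf y (hFS hy) c hc d hd h hcd) (fun h => htf y (hFS hy) d hd a ha h hda)
  -- at most one leaf of each type
  have huniq : ∀ a' b' c' d', a' ∈ S → c' ∈ S → a' ∉ F → c' ∉ F →
      (∀ x ∈ S, x = a' ∨ x = b' ∨ x = c' ∨ x = d' ∨ x ∈ F) → a' ≠ c' →
      ∀ y ∈ F, ∀ z ∈ F, (∀ p ∈ F, ∀ q ∈ F, G.Adj y p → G.Adj y q → p = q) →
      (∀ p ∈ F, ∀ q ∈ F, G.Adj z p → G.Adj z q → p = q) →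
      (G.Adj y a' ∧ G.Adj y c' ∧ ¬ G.Adj y b' ∧ ¬ G.Adj y d') →
      (G.Adj z a' ∧ G.Adj z c' ∧ ¬ G.Adj z b' ∧ ¬ G.Adj z d') → y = z := by
    intro a' b' c' d' ha' hc' haF' hcF' hm hac' y hy z hz hly hlz h1 h2
    by_contra hyz
    obtain ⟨D, hD, hDc, haD, hcD⟩ := hcov a' c'
    have hnot : ∀ y ∈ F, (∀ p ∈ F, ∀ q ∈ F, G.Adj y p → G.Adj y q → p = q) →
        (G.Adj y a' ∧ G.Adj y c' ∧ ¬ G.Adj y b' ∧ ¬ G.Adj y d') → y ∉ D := by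
      intro y hy hl h hyD
      obtain ⟨s, hs, t, ht, hst, hys, hyt⟩ := hDc.2 y hyD
      have hin : ∀ s ∈ D, G.Adj y s → s ∈ F := by
        intro s hs hys
        rcases hm s (hD hs) with rfl | rfl | rfl | rfl | h'
        exacts [absurd hs haD, absurd hys h.2.2.1, absurd hs hcD, absurd hys h.2.2.2, h']
      exact hst (hl s (hin s hs hys) t (hin t ht hyt) hys hyt)
    refine hno.false_of_disjoint hDc (isCore_quadruple h1.1 h2.1.symm h2.2.1 h1.2.1.symm hyz hac')
      hD ?_ ?_
    · rintro x (rfl | rfl | rfl | rfl)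
      exacts [hFS hy, ha', hFS hz, hc']
    · rintro x hx (rfl | rfl | rfl | rfl)
      exacts [hnot _ hy hly h1 hx, haD hx, hnot _ hz hlz h2 hx, hcD hx]
  have hFnbr : ∀ a' b' c' d', (∀ x ∈ S, x = a' ∨ x = b' ∨ x = c' ∨ x = d' ∨ x ∈ F) →
      ∀ y ∈ F, (G.Adj y a' ∧ G.Adj y c' ∧ ¬ G.Adj y b' ∧ ¬ G.Adj y d') → ∃ p ∈ F, G.Adj y p := by
    intro a' b' c' d' hm y hy h
    obtain ⟨p, hp, hyp, h1, h2⟩ := hdeg y (hFS hy) a' c'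
    refine ⟨p, ?_, hyp⟩
    rcases hm p hp with rfl | rfl | rfl | rfl | h'
    exacts [absurd rfl h1, absurd hyp h.2.2.1, absurd rfl h2, absurd hyp h.2.2.2, h']
  -- the main argument, with the two leaves given
  have hfin : ∀ a' b' c' d', a' ∈ S → b' ∈ S → c' ∈ S → d' ∈ S → a' ∉ F → b' ∉ F → c' ∉ F →
      d' ∉ F → a' ≠ c' → b' ≠ d' → G.Adj a' b' → G.Adj b' c' → G.Adj c' d' → G.Adj d' a' →
      (∀ x ∈ S, x = a' ∨ x = b' ∨ x = c' ∨ x = d' ∨ x ∈ F) →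
      ¬ G.Adj b' d' →
      ∀ y ∈ F, ∀ z ∈ F, (∀ p ∈ F, ∀ q ∈ F, G.Adj y p → G.Adj y q → p = q) →
      (∀ p ∈ F, ∀ q ∈ F, G.Adj z p → G.Adj z q → p = q) →
      (∀ s ∈ F, (∀ p ∈ F, ∀ q ∈ F, G.Adj s p → G.Adj s q → p = q) → s = y ∨ s = z) →
      (G.Adj y a' ∧ G.Adj y c' ∧ ¬ G.Adj y b' ∧ ¬ G.Adj y d') →
      (G.Adj z b' ∧ G.Adj z d' ∧ ¬ G.Adj z a' ∧ ¬ G.Adj z c') → y ≠ z →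
      ∃ p ∈ F, G.Adj y p ∧ p ≠ z ∧ p ≠ y ∧ (G.Adj p b' ∨ G.Adj p d') ∧ ¬ G.Adj p a' ∧
        ¬ G.Adj p c' := by
    intro a' b' c' d' ha hb hc hd haF hbF hcF hdF hac hbd hab hbc hcd hda hm hnbd y hy z hz
      hly hlz hall h1 h2 hyz
    obtain ⟨p, hpF, hyp⟩ := hFnbr a' b' c' d' hm y hy h1
    have hpa : ¬ G.Adj p a' := fun h => htf y (hFS hy) p (hFS hpF) a' ha hyp h h1.1
    have hpc : ¬ G.Adj p c' := fun h => htf y (hFS hy) p (hFS hpF) c' hc hyp h h1.2.1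
    -- If the two leaves were adjacent, they would be all of `F`. A core avoiding `a'` and `c'`
    -- would then lie in `{b', d', y, z}`, where `b'` and `d'` have `z` as their only neighbour.
    have hpz : p ≠ z := by
      rintro rfl
      have hFyz : ∀ x ∈ F, x = y ∨ x = p := by
        by_contra hcon
        push Not at hcon
        obtain ⟨x, hx, hxy, hxp⟩ := hcon
        obtain ⟨s, hs, hsl⟩ := hF.exists_leaf (D := F \ {y, p}) Set.sdiff_subset
          ⟨x, hx, by simp [hxy, hxp]⟩
        have hs2 : s ≠ y ∧ s ≠ p := by simpa using hs.2
        have hout : ∀ q ∈ F, G.Adj s q → q ∈ F \ {y, p} := by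
          intro q hq hsq
          refine ⟨hq, ?_⟩
          rintro (rfl | rfl)
          · exact hs2.2 (hly s hs.1 p hpF hsq.symm hyp)
          · exact hs2.1 (hlz s hs.1 y hy hsq.symm hyp.symm)
        rcases hall s hs.1 (fun p' hp' q' hq' e1 e2 =>
          hsl p' (hout p' hp' e1) q' (hout q' hq' e2) e1 e2) with h | h
        · exact hs2.1 h
        · exact hs2.2 h
      obtain ⟨D, hD, hDc, haD, hcD⟩ := hcov a' c'
      have hmD : ∀ x ∈ D, x = b' ∨ x = d' ∨ x = y ∨ x = p := by
        intro x hx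
        rcases hm x (hD hx) with rfl | rfl | rfl | rfl | h
        · exact absurd hx haD
        · exact Or.inl rfl
        · exact absurd hx hcD
        · exact Or.inr (Or.inl rfl)
        · exact Or.inr (Or.inr (hFyz x h))
      have hbD : b' ∉ D := hDc.notMem_of_unique (w := p) fun x hx hbx => by
        rcases hmD x hx with rfl | rfl | rfl | rfl
        · exact absurd rfl hbx.ne
        · exact absurd hbx hnbd
        · exact absurd hbx.symm h1.2.2.1
        · rfl
      have hdD : d' ∉ D := hDc.notMem_of_unique (w := p) fun x hx hbx => by
        rcases hmD x hx with rfl | rfl | rfl | rfl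
        · exact absurd hbx.symm hnbd
        · exact absurd rfl hbx.ne
        · exact absurd hbx.symm h1.2.2.2
        · rfl
      refine hF D (fun x hx => ?_) hDc
      rcases hmD x hx with rfl | rfl | rfl | rfl
      exacts [absurd hx hbD, absurd hx hdD, hy, hpF]
    refine ⟨p, hpF, hyp, hpz, hyp.ne.symm, ?_, hpa, hpc⟩
    have hzy : z ∈ F \ {y} := ⟨hz, hyz.symm⟩
    have hcard : 2 ≤ (F \ {y}).ncard := by
      have : 1 < (F \ {y}).ncard := (Set.one_lt_ncard (Set.toFinite _)).2
        ⟨z, hzy, p, ⟨hpF, hyp.ne.symm⟩, hpz.symm⟩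
      omega
    -- After `y` is removed, the only possible leaf besides `z` is `p`. So `p` has at most two
    -- neighbours in `F`, and its third neighbour is `b'` or `d'`.
    obtain ⟨s, hs, hsz, hsl⟩ := hF.exists_leaf_ne Set.sdiff_subset hzy hcard
    have hsp : s = p := by
      by_contra hsp
      have hsy : ¬ G.Adj s y := fun h => hsp (hly s hs.1 p hpF h.symm hyp)
      have hout : ∀ q ∈ F, G.Adj s q → q ∈ F \ {y} := by
        intro q hq hsq
        refine ⟨hq, ?_⟩
        rintro rfl
        exact hsy hsq
      rcases hall s hs.1 (fun p' hp' q' hq' e1 e2 =>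
          hsl p' (hout p' hp' e1) q' (hout q' hq' e2) e1 e2) with h | h
      · exact hs.2 h
      · exact hsz h
    subst hsp
    obtain ⟨x₁, hx₁, hp₁, hn₁, -⟩ := hdeg s (hFS hpF) y y
    obtain ⟨x₂, hx₂, hp₂, hn₂, hn₃⟩ := hdeg s (hFS hpF) y x₁
    by_contra hcon
    push Not at hcon
    have hin : ∀ x ∈ S, G.Adj s x → x ∈ F := by
      intro x hx hsx
      rcases hm x hx with rfl | rfl | rfl | rfl | h
      exacts [absurd hsx hpa, absurd hsx hcon.1, absurd hsx hpc, absurd hsx hcon.2, h]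
    exact hn₃ (hsl x₂ ⟨hin x₂ hx₂ hp₂, hn₂⟩ x₁ ⟨hin x₁ hx₁ hp₁, hn₁⟩ hp₂ hp₁)
  have hfin2 : ∀ a' b' c' d', a' ∈ S → b' ∈ S → c' ∈ S → d' ∈ S → a' ∉ F → b' ∉ F → c' ∉ F →
      d' ∉ F → a' ≠ c' → b' ≠ d' → G.Adj a' b' → G.Adj b' c' → G.Adj c' d' → G.Adj d' a' →
      (∀ x ∈ S, x = a' ∨ x = b' ∨ x = c' ∨ x = d' ∨ x ∈ F) →
      ∀ y ∈ F, ∀ z ∈ F, ∀ p ∈ F, ∀ q ∈ F, G.Adj y a' → G.Adj z d' → y ≠ z → p ≠ z →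
      q ≠ y → p ≠ q → G.Adj y p → G.Adj z q → G.Adj p b' → G.Adj q c' → False := by
    intro a' b' c' d' ha hb hc hd haF hbF hcF hdF hac hbd hab hbc hcd hda hm y hy z hz p hp q hq
      hya hzd hyz hpz hqy hpq hyp hzq hpb hqc
    refine hno.false_of_disjoint (isCore_quadruple hyp hpb hab.symm hya.symm ?_ ?_)
      (isCore_quadruple hzq hqc hcd hzd.symm ?_ ?_) ?_ ?_ ?_
    · rintro rfl; exact hbF hy
    · rintro rfl; exact haF hp
    · rintro rfl; exact hcF hz
    · rintro rfl; exact hdF hq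
    · rintro x (rfl | rfl | rfl | rfl)
      exacts [hFS hy, hFS hp, hb, ha]
    · rintro x (rfl | rfl | rfl | rfl)
      exacts [hFS hz, hFS hq, hc, hd]
    · rintro x (rfl | rfl | rfl | rfl) (h | h | h | h)
      · exact hyz h
      · exact hqy h.symm
      · exact hcF (h ▸ hy)
      · exact hdF (h ▸ hy)
      · exact hpz h
      · exact hpq h
      · exact hcF (h ▸ hp)
      · exact hdF (h ▸ hp)
      · exact hbF (h ▸ hz)
      · exact hbF (h ▸ hq)
      · exact hbc.ne h
      · exact hbd h
      · exact haF (h ▸ hz)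
      · exact haF (h ▸ hq)
      · exact hac h
      · exact hda.ne h.symm
  have hm2 : ∀ x ∈ S, x = b ∨ x = c ∨ x = d ∨ x = a ∨ x ∈ F := fun x hx =>
    or_rotate_four (hmem x hx)
  have hm3 : ∀ x ∈ S, x = c ∨ x = b ∨ x = a ∨ x = d ∨ x ∈ F := fun x hx =>
    or_swap_first_third (hmem x hx)
  have hm4 : ∀ x ∈ S, x = a ∨ x = d ∨ x = c ∨ x = b ∨ x ∈ F := fun x hx =>
    or_swap_second_fourth (hmem x hx)
  have hm5 : ∀ x ∈ S, x = c ∨ x = d ∨ x = a ∨ x = b ∨ x ∈ F := fun x hx =>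
    or_rotate_four (hm2 x hx)
  have hswap : ∀ {y}, (G.Adj y b ∧ G.Adj y d ∧ ¬ G.Adj y a ∧ ¬ G.Adj y c) →
      (G.Adj y b ∧ G.Adj y d ∧ ¬ G.Adj y c ∧ ¬ G.Adj y a) := fun h =>
    ⟨h.1, h.2.1, h.2.2.2, h.2.2.1⟩
  have hend : ∀ y ∈ F, ∀ z ∈ F, (∀ p ∈ F, ∀ q ∈ F, G.Adj y p → G.Adj y q → p = q) →
      (∀ p ∈ F, ∀ q ∈ F, G.Adj z p → G.Adj z q → p = q) →
      (G.Adj y a ∧ G.Adj y c ∧ ¬ G.Adj y b ∧ ¬ G.Adj y d) →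
      (G.Adj z b ∧ G.Adj z d ∧ ¬ G.Adj z a ∧ ¬ G.Adj z c) → False := by
    intro y hy z hz hly hlz h1 h2
    have hyz : y ≠ z := by rintro rfl; exact h2.2.2.1 h1.1
    have hall : ∀ s ∈ F, (∀ p ∈ F, ∀ q ∈ F, G.Adj s p → G.Adj s q → p = q) → s = y ∨ s = z := by
      intro s hs hls
      rcases hleaf s hs hls with h | h
      · exact Or.inl (huniq a b c d ha hc haF hcF hmem hac s hs y hy hls hly h h1)
      · exact Or.inr (huniq b c d a hb hd hbF hdF hm2 hbd s hs z hz hls hlz (hswap h)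
          (hswap h2))
    obtain ⟨p, hpF, hyp, hpz, -, hp1, hpa, hpc⟩ := hfin a b c d ha hb hc hd haF hbF hcF hdF hac hbd
      hab hbc hcd hda hmem hnbd y hy z hz hly hlz hall h1 h2 hyz
    obtain ⟨q, hqF, hzq, hqy, -, hq1, -, -⟩ := hfin b c d a hb hc hd ha hbF hcF hdF haF hbd hac.symm
      hbc hcd hda hab hm2 (fun h => hnac h.symm) z hz y hy hlz hly (fun s hs hl =>
        (hall s hs hl).symm) (hswap h2) ⟨h1.2.1, h1.1, h1.2.2.1, h1.2.2.2⟩ hyz.symm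
    have hpq : p ≠ q := by
      rintro rfl
      exact hq1.elim hpc hpa
    -- The four cases differ by a symmetry of the 4-cycle; in each, one 4-cycle passes through `y`
    -- and `p`, the other through `z` and `q`.
    rcases hp1 with hp1 | hp1 <;> rcases hq1 with hq1 | hq1
    · exact hfin2 a b c d ha hb hc hd haF hbF hcF hdF hac hbd hab hbc hcd hda hmem y hy z hz p hpF
        q hqF h1.1 h2.2.1 hyz hpz hqy hpq hyp hzq hp1 hq1
    · exact hfin2 c b a d hc hb ha hd hcF hbF haF hdF hac.symm hbd hbc.symm hab.symm hda.symm
        hcd.symm hm3 y hy z hz p hpF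
        q hqF h1.2.1 h2.2.1 hyz hpz hqy hpq hyp hzq hp1 hq1
    · exact hfin2 a d c b ha hd hc hb haF hdF hcF hbF hac hbd.symm hda.symm hcd.symm hbc.symm
        hab.symm hm4 y hy z hz p hpF
        q hqF h1.1 h2.1 hyz hpz hqy hpq hyp hzq hp1 hq1
    · exact hfin2 c d a b hc hd ha hb hcF hdF haF hbF hac.symm hbd.symm hcd hda hab hbc hm5
        y hy z hz p hpF q hqF h1.2.1 h2.1 hyz hpz hqy hpq hyp hzq hp1 hq1
  have hFne : F.Nonempty := by
    obtain ⟨x, hx, hax, h1, h2⟩ := hdeg a ha b d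
    rcases hmem x hx with rfl | rfl | rfl | rfl | h
    · exact absurd rfl hax.ne
    · exact absurd rfl h1
    · exact absurd hax hnac
    · exact absurd rfl h2
    · exact ⟨x, h⟩
  obtain ⟨y, hy, hly⟩ := hF.exists_leaf le_rfl hFne
  have hty := hleaf y hy hly
  obtain ⟨p, hpF, hyp⟩ : ∃ p ∈ F, G.Adj y p := by
    rcases hty with h | h
    · exact hFnbr a b c d hmem y hy h
    · exact hFnbr b c d a hm2 y hy (hswap h)
  obtain ⟨z, hz, hzy, hlz⟩ := hF.exists_leaf_ne le_rfl hy (by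
    have : 1 < F.ncard := (Set.one_lt_ncard (Set.toFinite _)).2 ⟨y, hy, p, hpF, hyp.ne⟩
    omega)
  rcases hty with h1 | h1 <;> rcases hleaf z hz hlz with h2 | h2
  · exact hzy (huniq a b c d ha hc haF hcF hmem hac z hz y hy hlz hly h2 h1)
  · exact hend y hy z hz hly hlz h1 h2
  · exact hend z hz y hy hlz hly h2 h1
  · exact hzy (huniq b c d a hb hd hbF hdF hm2 hbd z hz y hy hlz hly (hswap h2)
      (hswap h1))

end SimpleGraph

/-! ### No two vertices meet all cycles: reduction to minimum degree three -/

namespace SimpleGraph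

variable {V : Type*} {G : SimpleGraph V} {S T F D : Set V} {a b c d p q s t u v w x y z : V}

lemma exists_core_avoiding (h : ∀ u w, ¬ G.IsForestOn (S \ {u, w})) (u w : V) :
    ∃ D ⊆ S, G.IsCore D ∧ u ∉ D ∧ w ∉ D := by
  obtain ⟨D, hD, hc⟩ := not_isForestOn.1 (h u w)
  exact ⟨D, fun x hx => (hD hx).1, hc, fun hu => (hD hu).2 (by simp),
    fun hw => (hD hw).2 (by simp)⟩

lemma not_isForestOn_of_avoiding (hD : D ⊆ S) (hc : G.IsCore D) (hu : u ∉ D) (hw : w ∉ D) :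
    ¬ G.IsForestOn (S \ {u, w}) := by
  refine fun h => h D (fun x hx => ⟨hD hx, ?_⟩) hc
  rintro (rfl | rfl)
  exacts [hu hx, hw hx]

lemma adj_of_sup_edge_left (h : (G ⊔ edge s t).Adj s x) (hx : x ≠ t) : G.Adj s x := by
  rcases h with h | h
  · exact h
  · rw [edge_adj] at h
    rcases h.1 with ⟨-, h'⟩ | ⟨-, h'⟩
    · exact absurd h' hx
    · exact absurd h'.symm h.2

lemma adj_of_sup_edge_of_ne (h : (G ⊔ edge s t).Adj x y) (hs : x ≠ s) (ht : x ≠ t) :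
    G.Adj x y := by
  rcases h with h | h
  · exact h
  · rw [edge_adj] at h
    rcases h.1 with ⟨h', -⟩ | ⟨h', -⟩
    · exact absurd h' hs
    · exact absurd h' ht

/-- A core using an edge `s t` can be rerouted through a common neighbour of `s` and `t`. -/
lemma IsCore.insert_of_sup_edge (hD : (G ⊔ edge s t).IsCore D) (hvs : G.Adj v s)
    (hvt : G.Adj v t) (hst : s ≠ t) (hs : s ∈ D) (ht : t ∈ D) (hv : v ∉ D) :
    G.IsCore (insert v D) := by
  refine ⟨⟨v, by simp⟩, fun x hx => ?_⟩
  rcases hx with rfl | hx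
  · exact ⟨s, by simp [hs], t, by simp [ht], hst, hvs, hvt⟩
  by_cases hxs : x = s
  · subst hxs
    obtain ⟨w, hw, hwt, hadj⟩ := hD.exists_adj_ne hx t
    exact ⟨w, by simp [hw], v, by simp, fun h => hv (h ▸ hw), adj_of_sup_edge_left hadj hwt,
      hvs.symm⟩
  by_cases hxt : x = t
  · subst hxt
    obtain ⟨w, hw, hws, hadj⟩ := hD.exists_adj_ne hx s
    rw [edge_comm] at hadj
    exact ⟨w, by simp [hw], v, by simp, fun h => hv (h ▸ hw), adj_of_sup_edge_left hadj hws,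
      hvt.symm⟩
  obtain ⟨y, hy, z, hz, hyz, h1, h2⟩ := hD.2 x hx
  exact ⟨y, by simp [hy], z, by simp [hz], hyz, adj_of_sup_edge_of_ne h1 hxs hxt,
    adj_of_sup_edge_of_ne h2 hxs hxt⟩

/-- Suppressing a vertex of degree two turns cores into cores. -/
lemma IsCore.sdiff_of_degree_two (hD : G.IsCore D) (hst : s ≠ t) (hnst : ¬ G.Adj s t)
    (hv : v ∈ D) (h2 : ∀ x ∈ D, G.Adj v x → x = s ∨ x = t) :
    (G ⊔ edge s t).IsCore (D \ {v}) := by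
  have hmem : s ∈ D ∧ t ∈ D ∧ G.Adj v s ∧ G.Adj v t := by
    obtain ⟨y, hy, z, hz, hyz, h3, h4⟩ := hD.2 v hv
    rcases h2 y hy h3 with rfl | rfl <;> rcases h2 z hz h4 with rfl | rfl
    · exact absurd rfl hyz
    · exact ⟨hy, hz, h3, h4⟩
    · exact ⟨hz, hy, h4, h3⟩
    · exact absurd rfl hyz
  obtain ⟨hs, ht, hvs, hvt⟩ := hmem
  have hedge : (G ⊔ edge s t).Adj s t := Or.inr ((edge_adj ..).2 ⟨Or.inl ⟨rfl, rfl⟩, hst⟩)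
  refine ⟨⟨s, hs, hvs.ne.symm⟩, fun x hx => ?_⟩
  by_cases hxs : x = s
  · subst hxs
    obtain ⟨w, hw, hwv, hadj⟩ := hD.exists_adj_ne hx.1 v
    exact ⟨w, ⟨hw, hwv⟩, t, ⟨ht, hvt.ne.symm⟩, fun h => hnst (h ▸ hadj), Or.inl hadj, hedge⟩
  by_cases hxt : x = t
  · subst hxt
    obtain ⟨w, hw, hwv, hadj⟩ := hD.exists_adj_ne hx.1 v
    exact ⟨w, ⟨hw, hwv⟩, s, ⟨hs, hvs.ne.symm⟩, fun h => hnst (h ▸ hadj.symm), Or.inl hadj,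
      hedge.symm⟩
  obtain ⟨y, hy, z, hz, hyz, h3, h4⟩ := hD.2 x hx.1
  have hnv : ¬ G.Adj x v := fun h => (h2 x hx.1 h.symm).elim hxs hxt
  exact ⟨y, ⟨hy, fun h => hnv (h ▸ h3)⟩, z, ⟨hz, fun h => hnv (h ▸ h4)⟩, hyz, Or.inl h3, Or.inl h4⟩

lemma ConnOn.suppress (h : G.ConnOn S) (hst : s ≠ t) (hs : s ∈ S) (ht : t ∈ S) (hsv : s ≠ v)
    (htv : t ≠ v) (h2 : ∀ x ∈ S, G.Adj v x → x = s ∨ x = t) :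
    (G ⊔ edge s t).ConnOn (S \ {v}) := by
  classical
  intro p hp q hq
  have hedge : ((G ⊔ edge s t).within (S \ {v})).Adj s t :=
    ⟨Or.inr ((edge_adj ..).2 ⟨Or.inl ⟨rfl, rfl⟩, hst⟩), ⟨hs, hsv⟩, ⟨ht, htv⟩⟩
  have := reachable_of_adj_imp (H := G.within S) (H' := (G ⊔ edge s t).within (S \ {v}))
      (p := p) (q := q) (fun x => if x = v then s else x) ?_ (h p hp.1 q hq.1)
  · have h1 : p ≠ v := hp.2
    have h2 : q ≠ v := hq.2
    simpa [h1, h2] using this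
  · have key : ∀ y ∈ S, G.Adj v y →
        ((G ⊔ edge s t).within (S \ {v})).Reachable s y := by
      intro y hy hadj
      rcases h2 y hy hadj with rfl | rfl
      · rfl
      · exact hedge.reachable
    rintro x y ⟨hadj, hx, hy⟩
    by_cases hxv : x = v
    · subst hxv
      simpa [hadj.ne.symm] using key y hy hadj
    · by_cases hyv : y = v
      · subst hyv
        simpa [hxv] using (key x hx hadj.symm).symm
      · simp only [hxv, hyv, if_false]
        exact Adj.reachable ⟨Or.inl hadj, ⟨hx, hxv⟩, ⟨hy, hyv⟩⟩

/-- A connected graph without disjoint cycles in which no two vertices meet all cycles has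
exactly five more edges than vertices. -/
theorem edgeCount_of_forall_not_isForestOn [Finite V] (hS : S.Nonempty) (hc : G.ConnOn S)
    (hno : G.NoDisjointCores S) (hcov : ∀ u w, ¬ G.IsForestOn (S \ {u, w})) :
    G.edgeCount S = S.ncard + 5 := by
  induction hn : S.ncard generalizing G S with
  | zero =>
    exact absurd ((Set.ncard_eq_zero (Set.toFinite _)).1 hn) hS.ne_empty
  | succ n ih =>
    have hav := exists_core_avoiding hcov
    by_cases hA : ∃ v ∈ S, ∀ p ∈ S, ∀ q ∈ S, G.Adj v p → G.Adj v q → p = q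
    · obtain ⟨v, hv, hl⟩ := hA
      have hcard := Set.ncard_sdiff_singleton_add_one hv (Set.toFinite S)
      have hnot : ∀ D ⊆ S, G.IsCore D → v ∉ D := fun D hD hDc hvD => by
        obtain ⟨y, hy, z, hz, hne, h1, h2⟩ := hDc.2 v hvD
        exact hne (hl y (hD hy) z (hD hz) h1 h2)
      obtain ⟨D, hD, hDc, -⟩ := hav v v
      obtain ⟨r, hr⟩ := hDc.1
      have hrv : r ∈ S \ {v} := ⟨hD hr, fun h => hnot D hD hDc (h ▸ hr)⟩
      have := ih ⟨r, hrv⟩ (hc.sdiff_leaf hl) (hno.subset Set.sdiff_subset) (fun u w => by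
        obtain ⟨D, hD, hDc, hu, hw⟩ := hav u w
        refine not_isForestOn_of_avoiding (fun x hx => ⟨hD hx, ?_⟩) hDc hu hw
        rintro rfl
        exact hnot D hD hDc hx) (by omega)
      have h1 := ncard_neighborSet_le_one hl
      obtain ⟨z, hz, hyz⟩ := hc.exists_adj hv (hD hr) (fun h => hnot D hD hDc (h ▸ hr))
      have h2 : 0 < (G.neighborSet v ∩ S).ncard := (Set.ncard_pos (Set.toFinite _)).2 ⟨z, hyz, hz⟩
      rw [edgeCount_sdiff_singleton hv]
      omega
    by_cases hB : ∃ v ∈ S, ∃ s ∈ S, ∃ t ∈ S, s ≠ t ∧ G.Adj v s ∧ G.Adj v t ∧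
        ∀ x ∈ S, G.Adj v x → x = s ∨ x = t
    · obtain ⟨v, hv, s, hs, t, ht, hst, hvs, hvt, h2⟩ := hB
      -- If `s` and `t` are adjacent, a core avoiding both also avoids `v`, hence the triangle `v s
      -- t`. Otherwise `v` is replaced by the edge `st`, which loses one vertex and one edge.
      by_cases hadj : G.Adj s t
      · exfalso
        obtain ⟨D, hD, hDc, hsD, htD⟩ := hav s t
        have hvD : v ∉ D := hDc.notMem_of_unique (w := s) fun x hx hvx =>
          (h2 x (hD hx) hvx).resolve_right fun h => htD (h ▸ hx)
        refine hno.false_of_disjoint hDc (isCore_triple hvs hadj hvt) hD ?_ ?_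
        · rintro x (rfl | rfl | rfl)
          exacts [hv, hs, ht]
        · rintro x hx (rfl | rfl | rfl)
          exacts [hvD hx, hsD hx, htD hx]
      · have hcard := Set.ncard_sdiff_singleton_add_one hv (Set.toFinite S)
        have hS' : S \ {v} ⊆ S := Set.sdiff_subset
        -- Only one of two disjoint cores can contain `s`, so at most one of them has to be rerouted
        -- through `v`.
        have hex : ∀ D ⊆ S \ {v}, (G ⊔ edge s t).IsCore D → (G.IsCore D) ∨
            (s ∈ D ∧ t ∈ D ∧ G.IsCore (insert v D)) := by
          intro D hD hDc
          by_cases h : s ∈ D ∧ t ∈ D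
          · exact Or.inr ⟨h.1, h.2, hDc.insert_of_sup_edge hvs hvt hst h.1 h.2
              fun h' => (hD h').2 rfl⟩
          · exact Or.inl (isCore_of_sup_edge hDc (not_and_or.1 h))
        have := ih (G := G ⊔ edge s t) (S := S \ {v}) ⟨s, hs, hvs.ne.symm⟩
          (hc.suppress hst hs ht hvs.ne.symm hvt.ne.symm h2) ?_ ?_ (by omega)
        · have hn2 : (G.neighborSet v ∩ S).ncard = 2 := by
            rw [← Set.ncard_pair hst]
            congr 1
            ext x
            constructor
            · intro hx
              exact h2 x hx.2 hx.1
            · rintro (rfl | rfl)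
              exacts [⟨hvs, hs⟩, ⟨hvt, ht⟩]
          have hs' : s ∈ S \ {v} := ⟨hs, hvs.ne.symm⟩
          have ht' : t ∈ S \ {v} := ⟨ht, hvt.ne.symm⟩
          rw [edgeCount_sup_edge hs' ht' hst hadj] at this
          rw [edgeCount_sdiff_singleton hv]
          omega
        · intro D hD E hE hDc hEc hdis
          have hd := Set.disjoint_left.1 hdis
          rcases hex D hD hDc with h1 | ⟨h1, h1', h1''⟩ <;>
            rcases hex E hE hEc with h3 | ⟨h3, h3', h3''⟩
          · exact hno.false_of_disjoint h1 h3 (hD.trans hS') (hE.trans hS') fun x => @hd x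
          · refine hno.false_of_disjoint h1 h3'' (hD.trans hS')
              (Set.insert_subset hv (hE.trans hS')) fun x hx => ?_
            rintro (rfl | h)
            exacts [(hD hx).2 rfl, hd hx h]
          · refine hno.false_of_disjoint h1'' h3 (Set.insert_subset hv (hD.trans hS'))
              (hE.trans hS') ?_
            rintro x (rfl | h) hx
            exacts [(hE hx).2 rfl, hd h hx]
          · exact hd h1 h3
        · intro u w
          obtain ⟨D, hD, hDc, hu, hw⟩ := hav u w
          by_cases hvD : v ∈ D
          · exact not_isForestOn_of_avoiding
              (fun x hx => ⟨hD hx.1, hx.2⟩)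
              (hDc.sdiff_of_degree_two hst hadj hvD fun x hx => h2 x (hD hx))
              (fun h => hu h.1) (fun h => hw h.1)
          · refine not_isForestOn_of_avoiding (D := D) (fun x hx => ⟨hD hx, ?_⟩)
              (hDc.mono le_sup_left) hu hw
            rintro rfl
            exact hvD hx
    have hdeg : ∀ v ∈ S, ∀ s t, ∃ x ∈ S, G.Adj v x ∧ x ≠ s ∧ x ≠ t := by
      intro v hv s t
      push Not at hA hB
      obtain ⟨p, hp, q, hq, hvp, hvq, hpq⟩ := hA v hv
      obtain ⟨r, hr, hvr, hrp, hrq⟩ := hB v hv p hp q hq hpq hvp hvq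
      by_cases h1 : p ≠ s ∧ p ≠ t
      · exact ⟨p, hp, hvp, h1⟩
      by_cases h2 : q ≠ s ∧ q ≠ t
      · exact ⟨q, hq, hvq, h2⟩
      refine ⟨r, hr, hvr, ?_, ?_⟩
      · rintro rfl
        grind
      · rintro rfl
        grind
    by_cases htri : ∃ x ∈ S, ∃ y ∈ S, ∃ z ∈ S, G.Adj x y ∧ G.Adj y z ∧ G.Adj x z
    · obtain ⟨x, hx, y, hy, z, hz, h1, h2, h3⟩ := htri
      have := card_eq_of_triangle hno hdeg hav hx hy hz h1 h2 h3
      omega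
    · push Not at htri
      have hcore : ∃ D ⊆ S, G.IsCore D := by
        obtain ⟨r, -⟩ := hS
        obtain ⟨D, hD, hDc, -⟩ := hav r r
        exact ⟨D, hD, hDc⟩
      obtain ⟨a, ha, b, hb, c, hc', d, hd, hac, hbd, hab, hbc, hcd, hda⟩ :=
        exists_four_cycle hno hdeg hcore htri
      exact (false_of_four_cycle hno hdeg hav htri ha hb hc' hd hac hbd hab hbc hcd hda).elim

end SimpleGraph

/-! ### Two vertices meet all cycles: the dichotomy -/

namespace SimpleGraph

variable {V : Type*} {G : SimpleGraph V} {S T F D K L : Set V} {a b c d p q s t u v w x y z : V}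

/-- A branch at `a` can be entered only through `a`, so a walk towards `a` that starts off the
branch stays off it. -/
lemma ConnOn.sdiff_comp (hT : G.ConnOn T) (ha : a ∈ T) (hb : b ∈ T \ {a}) :
    G.ConnOn (T \ G.comp (T \ {a}) b) := by
  set K := G.comp (T \ {a}) b with hK
  have haK : a ∉ K := fun h => (comp_subset hb h).2 rfl
  have key : ∀ p q, (G.within T).Walk p q → q = a → p ∈ T → p ∉ K →
      (G.within (T \ K)).Reachable p q := by
    intro p q c hq hp hpK
    induction c with
    | nil => rfl
    | @cons p p' q hadj c ih =>
      by_cases hpa : p = a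
      · rw [hpa, hq]
      have hp' : p' ∉ K := by
        intro h
        exact hpK (mem_comp_of_adj h hb ⟨hp, hpa⟩ hadj.1.symm)
      exact (Adj.reachable (G := G.within (T \ K)) ⟨hadj.1, ⟨hp, hpK⟩, ⟨hadj.2.2, hp'⟩⟩).trans
        (ih hq hadj.2.2 hp')
  intro p hp q hq
  obtain ⟨c⟩ := hT p hp.1 a ha
  obtain ⟨c'⟩ := hT q hq.1 a ha
  exact (key p a c rfl hp.1 hp.2).trans (key q a c' rfl hq.1 hq.2).symm

lemma ConnOn.exists_adj_comp (hT : G.ConnOn T) (ha : a ∈ T) (hb : b ∈ T \ {a}) :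
    ∃ b' ∈ G.comp (T \ {a}) b, G.Adj a b' := by
  have key : ∀ p q, (G.within T).Walk p q → q = a → p ∈ G.comp (T \ {a}) b →
      ∃ b' ∈ G.comp (T \ {a}) b, G.Adj a b' := by
    intro p q c hq hp
    induction c with
    | nil => exact absurd hq (comp_subset hb hp).2
    | @cons p p' q hadj c ih =>
      by_cases hpa : p' = a
      · exact ⟨p, hp, hpa ▸ hadj.1.symm⟩
      · exact ih hq (mem_comp_of_adj hp hb ⟨hadj.2.2, hpa⟩ hadj.1)
  obtain ⟨c⟩ := hT b hb.1 a ha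
  exact key b a c rfl self_mem_comp

/-- A tree in which no two complementary subtrees are both rich has a vertex whose removal
leaves no rich component. -/
theorem exists_centroid [Finite V] (hF : G.IsForestOn T) (hT : G.ConnOn T) (hne : T.Nonempty)
    (Rich : Set V → Prop) (hmono : ∀ K L, K ⊆ L → Rich K → Rich L)
    (hrich : ∀ K ⊆ T, G.ConnOn K → G.ConnOn (T \ K) → Rich K → ¬ Rich (T \ K)) :
    ∃ a ∈ T, ∀ b ∈ T \ {a}, ¬ Rich (G.comp (T \ {a}) b) := by
  by_contra! hcon
  -- Descent on the size of a rich branch `K` at `a`. Move to the neighbour `b` of `a` in `K` and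
  -- take a rich branch `K'` at `b`. It is not disjoint from `K`, since `K` and its complement are
  -- not both rich. It does not contain `a`, since that would close a cycle through `ab`. So it is
  -- strictly inside `K`.
  have key : ∀ n, ∀ a ∈ T, ∀ b ∈ T \ {a}, (G.comp (T \ {a}) b).ncard = n →
      ¬ Rich (G.comp (T \ {a}) b) := by
    intro n
    induction n using Nat.strong_induction_on with
    | _ n ih =>
      intro a ha b₀ hb₀ hcard hR
      set K := G.comp (T \ {a}) b₀ with hKdef
      have hKT : K ⊆ T \ {a} := comp_subset hb₀
      obtain ⟨b, hbK, hab⟩ := hT.exists_adj_comp ha hb₀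
      have hbT : b ∈ T := (hKT hbK).1
      obtain ⟨c, hc, hR'⟩ := hcon b hbT
      set K' := G.comp (T \ {b}) c with hK'def
      have hK'T : K' ⊆ T \ {b} := comp_subset hc
      by_cases hdis : Disjoint K' K
      · refine hrich K (hKT.trans Set.sdiff_subset) connOn_comp (hT.sdiff_comp ha hb₀) hR
          (hmono K' _ (fun x hx => ⟨(hK'T hx).1, fun h => Set.disjoint_left.1 hdis hx h⟩) hR')
      rw [Set.not_disjoint_iff] at hdis
      obtain ⟨k, hkK', hkK⟩ := hdis
      by_cases haK' : a ∈ K'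
      · refine not_isForestOn_of_reachable hab ha hbT ?_ hF
        have h1 : (G.within (T \ {b})).Reachable a k := Reachable.trans (Reachable.symm haK') hkK'
        have h2 : (G.within (T \ {a})).Reachable k b := Reachable.trans (Reachable.symm hkK) hbK
        refine (h1.mono ?_).trans (h2.mono ?_)
        · rintro x y ⟨hxy, hx, hy⟩
          refine ⟨?_, hx.1, hy.1⟩
          simp only [deleteEdges_adj, Set.mem_singleton_iff, Sym2.eq_iff]
          refine ⟨hxy, ?_⟩
          rintro (⟨-, h⟩ | ⟨h, -⟩)
          exacts [hy.2 h, hx.2 h]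
        · rintro x y ⟨hxy, hx, hy⟩
          refine ⟨?_, hx.1, hy.1⟩
          simp only [deleteEdges_adj, Set.mem_singleton_iff, Sym2.eq_iff]
          refine ⟨hxy, ?_⟩
          rintro (⟨h, -⟩ | ⟨-, h⟩)
          exacts [hx.2 h, hy.2 h]
      · have hsub : K' ⊆ K := by
          have h1 : K' ⊆ G.comp (T \ {a}) k := connOn_comp.subset_comp
            (fun x hx => ⟨(hK'T hx).1, fun h => haK' (h ▸ hx)⟩) hkK'
          exact fun x hx => Reachable.trans hkK (h1 hx)
        have hlt : K'.ncard < K.ncard := Set.ncard_lt_ncard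
          ⟨hsub, fun h => (hK'T (h hbK)).2 rfl⟩ (Set.toFinite _)
        exact ih _ (hcard ▸ hlt) b hbT c hc rfl hR'
  obtain ⟨a, ha⟩ := hne
  obtain ⟨b, hb, hR⟩ := hcon a ha
  exact key _ a ha b hb rfl hR

/-- `u` has two neighbours in `K`. -/
def HasTwo (G : SimpleGraph V) (u : V) (K : Set V) : Prop :=
  ∃ s ∈ K, ∃ t ∈ K, s ≠ t ∧ G.Adj u s ∧ G.Adj u t

lemma HasTwo.mono (h : G.HasTwo u K) (hKL : K ⊆ L) : G.HasTwo u L := by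
  obtain ⟨s, hs, t, ht, h⟩ := h
  exact ⟨s, hKL hs, t, hKL ht, h⟩

lemma hasTwo_or_hasTwo_sdiff [Finite V] (h : 3 ≤ (G.neighborSet u ∩ T).ncard) :
    G.HasTwo u K ∨ G.HasTwo u (T \ K) := by
  obtain ⟨p, hp, q, hq, r, hr, h1, h2, h3⟩ := (Set.two_lt_ncard (Set.toFinite _)).1 h
  by_cases hpK : p ∈ K <;> by_cases hqK : q ∈ K <;> by_cases hrK : r ∈ K
  · exact Or.inl ⟨p, hpK, q, hqK, h1, hp.1, hq.1⟩
  · exact Or.inl ⟨p, hpK, q, hqK, h1, hp.1, hq.1⟩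
  · exact Or.inl ⟨p, hpK, r, hrK, h2, hp.1, hr.1⟩
  · exact Or.inr ⟨q, ⟨hq.2, hqK⟩, r, ⟨hr.2, hrK⟩, h3, hq.1, hr.1⟩
  · exact Or.inl ⟨q, hqK, r, hrK, h3, hq.1, hr.1⟩
  · exact Or.inr ⟨p, ⟨hp.2, hpK⟩, r, ⟨hr.2, hrK⟩, h2, hp.1, hr.1⟩
  · exact Or.inr ⟨p, ⟨hp.2, hpK⟩, q, ⟨hq.2, hqK⟩, h1, hp.1, hq.1⟩
  · exact Or.inr ⟨p, ⟨hp.2, hpK⟩, q, ⟨hq.2, hqK⟩, h1, hp.1, hq.1⟩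

lemma NoDisjointCores.not_hasTwo [Finite V] (hno : G.NoDisjointCores Set.univ) (huw : u ≠ w)
    (hK : G.ConnOn K) (hL : G.ConnOn L) (hKL : Disjoint K L) (huK : u ∉ K) (huL : u ∉ L)
    (hwK : w ∉ K) (hwL : w ∉ L) (h : G.HasTwo u K) : ¬ G.HasTwo w L := by
  rintro ⟨s', hs', t', ht', hne', h1', h2'⟩
  obtain ⟨s, hs, t, ht, hne, h1, h2⟩ := h
  obtain ⟨D, hD, hDc⟩ := exists_core_insert_of_connOn hK hne h1 h2 hs ht huK
  obtain ⟨E, hE, hEc⟩ := exists_core_insert_of_connOn hL hne' h1' h2' hs' ht' hwL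
  refine hno.false_of_disjoint hDc hEc (Set.subset_univ _) (Set.subset_univ _) fun x hx hx' => ?_
  rcases hD hx with rfl | hx <;> rcases hE hx' with rfl | hx'
  · exact huw rfl
  · exact huL hx'
  · exact hwK hx
  · exact Set.disjoint_left.1 hKL hx hx'

/-- Every cycle meets `{a, b, c}` in at least two vertices. -/
def IsTwiceCovered (G : SimpleGraph V) (a b c : V) : Prop :=
  a ≠ b ∧ a ≠ c ∧ b ≠ c ∧ G.IsForestOn {a, b}ᶜ ∧ G.IsForestOn {a, c}ᶜ ∧ G.IsForestOn {b, c}ᶜ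

/-- Removing one vertex and one edge leaves a forest. -/
def IsAlmostForest (G : SimpleGraph V) (x w p : V) : Prop :=
  (G.deleteEdges {s(w, p)}).IsForestOn {x}ᶜ

lemma IsForestOn.isAlmostForest (h : G.IsForestOn {x}ᶜ) (w p : V) : G.IsAlmostForest x w p :=
  h.anti (deleteEdges_le _) le_rfl

lemma exists_hasTwo_of_not_isForestOn [Finite V] (hF : G.IsForestOn (S \ {u}))
    (h : ¬ G.IsForestOn S) : ∃ s ∈ S \ {u}, G.HasTwo u (G.comp (S \ {u}) s) := by
  obtain ⟨D, hD, hDc⟩ := not_isForestOn.1 h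
  have hsub : D \ {u} ⊆ S \ {u} := Set.sdiff_subset_sdiff_left hD
  obtain ⟨s, hs, t, ht, hst, h1, h2, h3⟩ := hDc.exists_reachable (hF.subset hsub)
  exact ⟨s, ⟨hD hs, h1.ne.symm⟩, s, self_mem_comp, t, h3.mono (within_mono le_rfl hsub), hst, h1,
    h2⟩

/-- A cycle avoiding `u` passes through `w` and uses two edges from `w` into one component of the
forest. Only one component offers two, and it offers exactly two, so deleting one of these edges
destroys all such cycles. -/
lemma isAlmostForest_of_card_eq_two [Finite V] (hF : G.IsForestOn {u, w}ᶜ)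
    (hcard : (G.neighborSet w ∩ G.comp {u, w}ᶜ s).ncard = 2)
    (hw : ∀ r ∈ ({u, w}ᶜ : Set V), G.HasTwo w (G.comp {u, w}ᶜ r) → r ∈ G.comp {u, w}ᶜ s) :
    ∃ p, G.IsAlmostForest u w p := by
  obtain ⟨p, q, hpq, hset⟩ := Set.ncard_eq_two.1 hcard
  refine ⟨p, ?_⟩
  by_contra hcon
  have hsub : ({u}ᶜ \ {w} : Set V) = {u, w}ᶜ := by
    ext x
    simp
  have hle : G.deleteEdges {s(w, p)} ≤ G := deleteEdges_le _
  obtain ⟨r, hr, s', hs', t', ht', hne, h1, h2⟩ := exists_hasTwo_of_not_isForestOn (u := w)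
    (by rw [hsub]; exact hF.anti hle le_rfl) hcon
  rw [hsub] at hr hs' ht'
  have hs'' : s' ∈ G.comp {u, w}ᶜ r := Reachable.mono (within_mono hle le_rfl) hs'
  have ht'' : t' ∈ G.comp {u, w}ᶜ r := Reachable.mono (within_mono hle le_rfl) ht'
  have hrT := hw r hr ⟨s', hs'', t', ht'', hne, hle h1, hle h2⟩
  have key : ∀ x, (G.deleteEdges {s(w, p)}).Adj w x → x ∈ G.comp {u, w}ᶜ r → x = q := by
    intro x hx hxr
    have : x ∈ G.neighborSet w ∩ G.comp {u, w}ᶜ s := ⟨hle hx, Reachable.trans hrT hxr⟩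
    rw [hset] at this
    rcases this with rfl | h
    · simp at hx
    · exact h
  exact hne ((key s' h1 hs'').trans (key t' h2 ht'').symm)

/-- A cycle avoiding `w` comes from a component of the forest holding two neighbours of `u`, and
symmetrically. Absence of disjoint cycles forces all these components to be one tree `T`. If `u` or
`w` has just two neighbours in `T`, an edge and a vertex suffice. If both have at least three, a
centroid of `T` is the third vertex of the triple. -/
theorem isTwiceCovered_or_isAlmostForest [Finite V] (hno : G.NoDisjointCores Set.univ)
    (huw : u ≠ w) (hF : G.IsForestOn {u, w}ᶜ) :
    (∃ a b c, G.IsTwiceCovered a b c) ∨ ∃ x w p, G.IsAlmostForest x w p := by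
  by_cases hu : G.IsForestOn {u}ᶜ
  · exact Or.inr ⟨u, u, u, hu.isAlmostForest u u⟩
  by_cases hw : G.IsForestOn {w}ᶜ
  · exact Or.inr ⟨w, u, u, hw.isAlmostForest u u⟩
  have hsubw : ({u}ᶜ \ {w} : Set V) = {u, w}ᶜ := by
    ext x
    simp
  have hsubu : ({w}ᶜ \ {u} : Set V) = {u, w}ᶜ := by
    ext x
    simp [and_comm]
  obtain ⟨s, hs, hs2⟩ := exists_hasTwo_of_not_isForestOn (u := u) (by rw [hsubu]; exact hF) hw
  obtain ⟨r, hr, hr2⟩ := exists_hasTwo_of_not_isForestOn (u := w) (by rw [hsubw]; exact hF) hu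
  rw [hsubu] at hs hs2
  rw [hsubw] at hr hr2
  set F : Set V := {u, w}ᶜ with hFdef
  have huF : u ∉ F := by simp [hFdef]
  have hwF : w ∉ F := by simp [hFdef]
  have hnot : ∀ K L, K ⊆ F → L ⊆ F → G.ConnOn K → G.ConnOn L → Disjoint K L →
      G.HasTwo u K → ¬ G.HasTwo w L := fun K L hK hL hKc hLc hdis =>
    hno.not_hasTwo huw hKc hLc hdis (fun h => huF (hK h)) (fun h => huF (hL h))
      (fun h => hwF (hK h)) (fun h => hwF (hL h))
  set T := G.comp F s with hTdef
  have hTF : T ⊆ F := comp_subset hs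
  have hwT : ∀ r ∈ F, G.HasTwo w (G.comp F r) → r ∈ T := fun r hr h => by_contra fun hrT =>
    hnot _ _ hTF (comp_subset hr) connOn_comp connOn_comp (comp_disjoint_of_notMem hrT) hs2 h
  have hcompeq : ∀ r ∈ T, G.comp F r = T := fun r hr => Set.Subset.antisymm
    (fun x hx => Reachable.trans hr hx) (fun x hx => Reachable.trans (Reachable.symm hr) hx)
  have hw2 : G.HasTwo w T := hcompeq r (hwT r hr hr2) ▸ hr2
  have huT : ∀ r ∈ F, G.HasTwo u (G.comp F r) → r ∈ T := fun r hr h => by_contra fun hrT =>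
    hnot _ _ (comp_subset hr) hTF connOn_comp connOn_comp (comp_disjoint_of_notMem hrT).symm h hw2
  have hcard : ∀ v, G.HasTwo v T → (G.neighborSet v ∩ T).ncard ≠ 2 →
      3 ≤ (G.neighborSet v ∩ T).ncard := by
    rintro v ⟨s, hs, t, ht, hst, h1, h2⟩ hne
    have : 1 < (G.neighborSet v ∩ T).ncard :=
      (Set.one_lt_ncard (Set.toFinite _)).2 ⟨s, ⟨h1, hs⟩, t, ⟨h2, ht⟩, hst⟩
    omega
  by_cases hw3 : (G.neighborSet w ∩ T).ncard = 2
  · obtain ⟨p, hp⟩ := isAlmostForest_of_card_eq_two hF hw3 hwT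
    exact Or.inr ⟨u, w, p, hp⟩
  by_cases hu3 : (G.neighborSet u ∩ T).ncard = 2
  · have hpair : F = {w, u}ᶜ := by rw [hFdef, Set.pair_comm]
    have hpair' : T = G.comp {w, u}ᶜ s := by rw [hTdef, hpair]
    obtain ⟨p, hp⟩ := isAlmostForest_of_card_eq_two (u := w) (w := u) (s := s) (hpair ▸ hF)
      (hpair' ▸ hu3) (by
        rw [← hpair]
        exact huT)
    exact Or.inr ⟨w, u, p, hp⟩
  have hw3' := hcard w hw2 hw3
  have hu3' := hcard u hs2 hu3
  have hTc : G.ConnOn T := connOn_comp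
  -- Rich means holding two neighbours of `u` or two of `w`. When `T` is split in two, each of `u`
  -- and `w` has two neighbours on some side, necessarily the same side for both; the other side is
  -- then not rich.
  obtain ⟨a, haT, ha⟩ := exists_centroid (hF.subset hTF) hTc ⟨s, self_mem_comp⟩
    (fun K => G.HasTwo u K ∨ G.HasTwo w K)
    (fun K L hKL h => h.imp (fun h => h.mono hKL) (fun h => h.mono hKL)) (by
      intro K hK hKc hLc h1 h2
      have hKF := hK.trans hTF
      have hLF : T \ K ⊆ F := Set.sdiff_subset.trans hTF
      have n1 := hnot K (T \ K) hKF hLF hKc hLc Set.disjoint_sdiff_right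
      have n2 := hnot (T \ K) K hLF hKF hLc hKc Set.disjoint_sdiff_left
      have p1 := hasTwo_or_hasTwo_sdiff (K := K) hw3'
      have p2 := hasTwo_or_hasTwo_sdiff (K := K) hu3'
      tauto)
  have haF := hTF haT
  have hua : u ≠ a := fun h => huF (h ▸ haF)
  have hwa : w ≠ a := fun h => hwF (h ▸ haF)
  have key : ∀ v, (∀ b ∈ T \ {a}, ¬ G.HasTwo v (G.comp (T \ {a}) b)) →
      (∀ r ∈ F, G.HasTwo v (G.comp F r) → r ∈ T) → ∀ S : Set V, S \ {v} = F \ {a} →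
      G.IsForestOn S := by
    intro v hv hvT S hS
    by_contra hcon
    obtain ⟨r, hr, hr2⟩ := exists_hasTwo_of_not_isForestOn (u := v)
      (by rw [hS]; exact hF.subset Set.sdiff_subset) hcon
    rw [hS] at hr hr2
    have hsub : G.comp (F \ {a}) r ⊆ G.comp F r := fun x hx =>
      Reachable.mono (within_mono le_rfl Set.sdiff_subset) hx
    have hrT := hvT r hr.1 (hr2.mono hsub)
    refine hv r ⟨hrT, hr.2⟩ (hr2.mono ?_)
    refine connOn_comp.subset_comp (fun x hx => ?_) self_mem_comp
    exact ⟨hcompeq r hrT ▸ hsub hx, (comp_subset hr hx).2⟩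
  refine Or.inl ⟨u, w, a, huw, hua, hwa, hF, key w (fun b hb h => ha b hb (Or.inr h)) hwT _ ?_,
    key u (fun b hb h => ha b hb (Or.inl h)) huT _ ?_⟩
  · ext x
    simp only [hFdef, Set.mem_sdiff, Set.mem_compl_iff, Set.mem_insert_iff, Set.mem_singleton_iff]
    tauto
  · ext x
    simp only [hFdef, Set.mem_sdiff, Set.mem_compl_iff, Set.mem_insert_iff, Set.mem_singleton_iff]
    tauto

end SimpleGraph

/-! ### Saturated graphs whose cycles all contain two of three vertices -/

namespace SimpleGraph

variable {V : Type*} {G : SimpleGraph V} {S T F D E K L : Set V} {a b c p q s t u v w x y z : V}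

/-- The old graph has no disjoint cores, so one of the new ones contains both ends of the new edge;
the other misses them and is a core of the old graph. -/
lemma CoreSaturated.exists_cores (h : G.CoreSaturated) (huv : u ≠ v) (hadj : ¬ G.Adj u v) :
    ∃ D E, (G ⊔ edge u v).IsCore D ∧ u ∈ D ∧ v ∈ D ∧ G.IsCore E ∧ ∀ x ∈ D, x ∉ E := by
  have := h.2 u v huv hadj
  simp only [NoDisjointCores, not_forall, not_not] at this
  obtain ⟨D, -, E, -, hD, hE, hdis⟩ := this
  have hd : ∀ x ∈ D, x ∉ E := fun x hx => Set.disjoint_left.1 hdis hx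
  by_cases h1 : u ∈ D ∧ v ∈ D
  · exact ⟨D, E, hD, h1.1, h1.2, isCore_of_sup_edge hE (Or.inl (hd u h1.1)), hd⟩
  by_cases h2 : u ∈ E ∧ v ∈ E
  · exact ⟨E, D, hE, h2.1, h2.2, isCore_of_sup_edge hD (not_and_or.1 h1), fun x hx hx' =>
      hd x hx' hx⟩
  exact (h.1.false_of_disjoint (isCore_of_sup_edge hD (not_and_or.1 h1))
    (isCore_of_sup_edge hE (not_and_or.1 h2)) (Set.subset_univ _) (Set.subset_univ _) hd).elim

lemma CoreSaturated.connOn_univ [Finite V] (h : G.CoreSaturated) : G.ConnOn Set.univ := by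
  intro p _ q _
  rw [within_univ]
  by_contra hr
  have hpq : p ≠ q := fun h => hr (h ▸ Reachable.refl _)
  obtain ⟨D, E, hD, -, -, hE, hd⟩ := h.exists_cores hpq fun h => hr h.reachable
  have : ¬ G.IsForestOn D := fun hf =>
    hf.sup_edge (fun h' => hr (h'.mono within_le)) D le_rfl hD
  obtain ⟨D', hD', hc⟩ := not_isForestOn.1 this
  exact h.1.false_of_disjoint hc hE (Set.subset_univ _) (Set.subset_univ _) fun x hx =>
    hd x (hD' hx)

lemma IsTwiceCovered.rotate (h : G.IsTwiceCovered a b c) : G.IsTwiceCovered b c a :=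
  ⟨h.2.2.1, h.1.symm, h.2.1.symm, h.2.2.2.2.2, Set.pair_comm a b ▸ h.2.2.2.1,
    Set.pair_comm a c ▸ h.2.2.2.2.1⟩

lemma IsTwiceCovered.mem_left (h : G.IsTwiceCovered a b c) (hE : G.IsCore E) (hb : b ∉ E) :
    a ∈ E := by
  by_contra ha
  refine h.2.2.2.1 E (fun x hx => ?_) hE
  rintro (rfl | rfl)
  exacts [ha hx, hb hx]

lemma IsTwiceCovered.mem_both (h : G.IsTwiceCovered a b c) (hE : G.IsCore E) (hb : c ∉ E) :
    a ∈ E ∧ b ∈ E :=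
  ⟨by
    by_contra ha
    exact hb (h.rotate.rotate.mem_left hE ha), h.rotate.mem_left hE hb⟩

lemma IsTwiceCovered.adj (h : G.IsTwiceCovered a b c) (hs : G.CoreSaturated) : G.Adj a b := by
  by_contra hadj
  obtain ⟨D, E, hD, ha, hb, hE, hd⟩ := hs.exists_cores h.1 hadj
  exact hd a ha (h.mem_left hE (hd b hb))

/-- Join `c` to another component. The core missing `c` contains `a` and `b`, so the core through
the new edge lies in a forest plus an edge between two of its components. -/
lemma IsTwiceCovered.connOn [Finite V] (h : G.IsTwiceCovered a b c) (hs : G.CoreSaturated) :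
    G.ConnOn {a, b}ᶜ := by
  have hc : c ∈ ({a, b}ᶜ : Set V) := by simp [h.2.1.symm, h.2.2.1.symm]
  have key : ∀ q ∈ ({a, b}ᶜ : Set V), (G.within {a, b}ᶜ).Reachable c q := by
    intro q hq
    by_contra hr
    have hcq : c ≠ q := fun h => hr (h ▸ Reachable.refl _)
    obtain ⟨D, E, hD, hcD, -, hE, hd⟩ := hs.exists_cores hcq fun h =>
      hr (Adj.reachable ⟨h, hc, hq⟩)
    have hab := h.mem_both hE (hd c hcD)
    refine h.2.2.2.1.sup_edge hr D (fun x hx => ?_) hD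
    rintro (rfl | rfl)
    exacts [hd _ hx hab.1, hd _ hx hab.2]
  exact fun p hp q hq => (key p hp).symm.trans (key q hq)

lemma insert_compl_triple (h1 : a ≠ c) (h2 : b ≠ c) :
    insert c ({a, b, c}ᶜ : Set V) = {a, b}ᶜ := by
  ext x
  simp only [Set.mem_insert_iff, Set.mem_compl_iff, Set.mem_singleton_iff]
  by_cases hx : x = c
  · subst hx
    simp [h1.symm, h2.symm]
  · tauto

lemma triple_rotate : ({b, c, a} : Set V) = {a, b, c} := by
  ext x
  simp only [Set.mem_insert_iff, Set.mem_singleton_iff]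
  tauto

/-- The graph minus `a` and `b` is a tree on `Nat.card V - 2` vertices. Rotating the triple shows
that its three members have equally many neighbours outside. -/
lemma IsTwiceCovered.edgeCount_compl [Finite V] (h : G.IsTwiceCovered a b c)
    (hs : G.CoreSaturated) :
    G.edgeCount {a, b, c}ᶜ + (G.neighborSet c ∩ {a, b, c}ᶜ).ncard + 3 = Nat.card V := by
  have hc : c ∉ ({a, b, c}ᶜ : Set V) := by simp
  have h1 := edgeCount_insert (G := G) hc
  rw [insert_compl_triple h.2.1 h.2.2.1] at h1
  have h2 := h.2.2.2.1.edgeCount_add_one_eq ⟨c, by simp [h.2.1.symm, h.2.2.1.symm]⟩ (h.connOn hs)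
  have h3 := Set.ncard_add_ncard_compl ({a, b} : Set V)
  rw [Set.ncard_pair h.1] at h3
  omega

lemma ncard_neighborSet_inter_insert [Finite V] (h : G.Adj u w) (hw : w ∉ S) :
    (G.neighborSet u ∩ insert w S).ncard = (G.neighborSet u ∩ S).ncard + 1 := by
  rw [← Set.ncard_insert_of_notMem (fun h' : w ∈ G.neighborSet u ∩ S => hw h'.2) (Set.toFinite _)]
  congr 1
  ext x
  simp only [Set.mem_inter_iff, mem_neighborSet, Set.mem_insert_iff]
  constructor
  · rintro ⟨h1, rfl | h2⟩
    exacts [Or.inl rfl, Or.inr ⟨h1, h2⟩]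
  · rintro (rfl | h1)
    exacts [⟨h, Or.inl rfl⟩, ⟨h1.1, Or.inr h1.2⟩]

/-- The edge count of a saturated graph all of whose cycles meet a triple twice. -/
lemma IsTwiceCovered.ncard_edgeSet [Finite V] (h : G.IsTwiceCovered a b c)
    (hs : G.CoreSaturated) :
    G.edgeSet.ncard = Nat.card V + 2 * (G.neighborSet a ∩ {a, b, c}ᶜ).ncard ∧
      (G.neighborSet a ∩ {a, b, c}ᶜ).ncard + 3 ≤ Nat.card V ∧
      (G.neighborSet b ∩ {a, b, c}ᶜ).ncard = (G.neighborSet a ∩ {a, b, c}ᶜ).ncard ∧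
      (G.neighborSet c ∩ {a, b, c}ᶜ).ncard = (G.neighborSet a ∩ {a, b, c}ᶜ).ncard := by
  have hc := h.edgeCount_compl hs
  have ha := h.rotate.edgeCount_compl hs
  have hb := h.rotate.rotate.edgeCount_compl hs
  rw [triple_rotate] at ha hb
  rw [triple_rotate] at hb
  have hab := h.adj hs
  have hbc := h.rotate.adj hs
  have hca := h.rotate.rotate.adj hs
  set F : Set V := {a, b, c}ᶜ with hF
  have hcF : c ∉ F := by simp [hF]
  have hbF : b ∉ insert c F := by simp [hF, hbc.ne]
  have haF : a ∉ insert b (insert c F) := by simp [hF, hab.ne, hca.ne.symm]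
  have huniv : insert a (insert b (insert c F)) = Set.univ := by
    ext x
    simp only [hF, Set.mem_insert_iff, Set.mem_compl_iff, Set.mem_singleton_iff, Set.mem_univ,
      iff_true]
    tauto
  have e1 := edgeCount_insert (G := G) hcF
  have e2 := edgeCount_insert (G := G) hbF
  have e3 := edgeCount_insert (G := G) haF
  rw [ncard_neighborSet_inter_insert hbc hcF] at e2
  rw [ncard_neighborSet_inter_insert hab hbF, ncard_neighborSet_inter_insert hca.symm hcF] at e3
  rw [huniv, edgeCount_univ] at e3
  have h3 := Set.ncard_add_ncard_compl ({a, b, c} : Set V)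
  have h4 : ({a, b, c} : Set V).ncard = 3 := by
    rw [Set.ncard_insert_of_notMem (by simp [hab.ne, hca.ne.symm]), Set.ncard_pair hbc.ne]
  have h5 : (G.neighborSet a ∩ F).ncard ≤ F.ncard := Set.ncard_le_ncard Set.inter_subset_right
  refine ⟨?_, ?_, ?_, ?_⟩ <;> omega

/-- A core meeting `F` only in small pieces with at most one edge to `{b, c}` cannot exist. -/
lemma not_isCore_of_forall_connOn [Finite V] (hf : G.IsForestOn (E \ {b, c}))
    (hb : ∀ K ⊆ E \ {b, c}, G.ConnOn K → ¬ G.HasTwo b K)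
    (hc : ∀ K ⊆ E \ {b, c}, G.ConnOn K → ¬ G.HasTwo c K)
    (hbc : ∀ K ⊆ E \ {b, c}, G.ConnOn K → ∀ s ∈ K, ∀ t ∈ K, G.Adj b s → ¬ G.Adj c t) :
    ¬ G.IsCore E := by
  intro hE
  obtain ⟨x, hx⟩ : (E \ {b, c}).Nonempty := by
    obtain ⟨e, he⟩ := hE.1
    by_cases heb : e = b
    · obtain ⟨y, hy, hyc, h1⟩ := hE.exists_adj_ne he c
      refine ⟨y, hy, ?_⟩
      rintro (h | h)
      exacts [h1.ne (heb.trans h.symm), hyc h]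
    by_cases hec : e = c
    · obtain ⟨y, hy, hyc, h1⟩ := hE.exists_adj_ne he b
      refine ⟨y, hy, ?_⟩
      rintro (h | h)
      exacts [hyc h, h1.ne (hec.trans h.symm)]
    · exact ⟨e, he, by simp [heb, hec]⟩
  set K := G.comp (E \ {b, c}) x with hKdef
  have hKE : K ⊆ E \ {b, c} := comp_subset hx
  have hKc : G.ConnOn K := connOn_comp
  -- A leaf of the piece `K` needs `b` or `c` as a core neighbour and cannot have both. Two leaves
  -- then give a second edge from `K` to `{b, c}`, which the hypotheses forbid.
  have hout : ∀ y ∈ K, (∀ p ∈ K, ∀ q ∈ K, G.Adj y p → G.Adj y q → p = q) →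
      (∃ p ∈ K, G.Adj y p) ∧ (G.Adj b y ∨ G.Adj c y) := by
    intro y hy hl
    obtain ⟨s, hs, t, ht, hst, h1, h2⟩ := hE.2 y (hKE hy).1
    have hin : ∀ s ∈ E, G.Adj y s → s ∈ K ∨ s = b ∨ s = c := by
      intro s hs hys
      by_cases h : s ∈ ({b, c} : Set V)
      · exact Or.inr h
      · exact Or.inl (mem_comp_of_adj hy hx ⟨hs, h⟩ hys)
    have hn := hbc K hKE hKc y hy y hy
    rcases hin s hs h1 with h3 | rfl | rfl <;> rcases hin t ht h2 with h4 | rfl | rfl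
    · exact absurd (hl s h3 t h4 h1 h2) hst
    · exact ⟨⟨s, h3, h1⟩, Or.inl h2.symm⟩
    · exact ⟨⟨s, h3, h1⟩, Or.inr h2.symm⟩
    · exact ⟨⟨t, h4, h2⟩, Or.inl h1.symm⟩
    · exact absurd rfl hst
    · exact absurd h2.symm (hn h1.symm)
    · exact ⟨⟨t, h4, h2⟩, Or.inr h1.symm⟩
    · exact absurd h1.symm (hn h2.symm)
    · exact absurd rfl hst
  obtain ⟨y, hy, hly⟩ := hf.exists_leaf hKE ⟨x, self_mem_comp⟩
  obtain ⟨⟨p, hp, hyp⟩, hy1⟩ := hout y hy hly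
  obtain ⟨z, hz, hzy, hlz⟩ := hf.exists_leaf_ne hKE hy (by
    have : 1 < K.ncard := (Set.one_lt_ncard (Set.toFinite _)).2 ⟨y, hy, p, hp, hyp.ne⟩
    omega)
  obtain ⟨-, hz1⟩ := hout z hz hlz
  rcases hy1 with h1 | h1 <;> rcases hz1 with h2 | h2
  · exact hb K hKE hKc ⟨z, hz, y, hy, hzy, h2, h1⟩
  · exact hbc K hKE hKc y hy z hz h1 h2
  · exact hbc K hKE hKc z hz y hy h2 h1
  · exact hc K hKE hKc ⟨z, hz, y, hy, hzy, h2, h1⟩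

lemma IsTwiceCovered.not_hasTwo [Finite V] (h : G.IsTwiceCovered a b c) (hK : K ⊆ {a, b, c}ᶜ)
    (hKc : G.ConnOn K) : ¬ G.HasTwo c K := by
  rintro ⟨s, hs, t, ht, hst, h1, h2⟩
  obtain ⟨D, hD, hDc⟩ := exists_core_insert_of_connOn hKc hst h1 h2 hs ht
    (fun h => hK h (by simp))
  refine h.2.2.2.1 D (hD.trans ?_) hDc
  rw [← insert_compl_triple h.2.1 h.2.2.1]
  exact Set.insert_subset_insert hK

lemma IsTwiceCovered.exists_adj_comp [Finite V] (h : G.IsTwiceCovered a b c)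
    (hs : G.CoreSaturated) (hx : x ∈ ({a, b, c}ᶜ : Set V)) :
    ∃ y ∈ G.comp {a, b, c}ᶜ x, G.Adj c y := by
  have h1 := h.connOn hs
  have hsub : ({a, b}ᶜ \ {c} : Set V) = {a, b, c}ᶜ := by
    ext x
    simp only [Set.mem_sdiff, Set.mem_compl_iff, Set.mem_insert_iff, Set.mem_singleton_iff]
    tauto
  have h2 := h1.exists_adj_comp (a := c) (b := x) (by simp [h.2.1.symm, h.2.2.1.symm])
    (by rw [hsub]; exact hx)
  rwa [hsub] at h2

lemma mem_of_hasOne (hb : G.neighborSet b ∩ {a, b, c}ᶜ = {q}) (hE : G.IsCore E) (hbE : b ∈ E)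
    (ha : a ∉ E) : q ∈ E := by
  obtain ⟨y, hy, hyc, h1⟩ := hE.exists_adj_ne hbE c
  have : y ∈ G.neighborSet b ∩ {a, b, c}ᶜ := by
    refine ⟨h1, ?_⟩
    rintro (rfl | rfl | rfl)
    exacts [ha hy, h1.ne rfl, hyc rfl]
  rw [hb] at this
  exact (show y = q from this) ▸ hy

/-- Let `p`, `q`, `r` be the only outside neighbours of `a`, `b`, `c`. Adding `av` with `v ≠ p`
outside gives a core through `a`, `v` and `p`, and a disjoint one through `b` and `c`, hence through
`q` and `r`. So `p ≠ q` and `v ≠ q`, which fails for `v = q`. -/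
lemma IsTwiceCovered.ncard_ne_one [Finite V] (h : G.IsTwiceCovered a b c)
    (hs : G.CoreSaturated) (hV : 5 ≤ Nat.card V) :
    (G.neighborSet a ∩ {a, b, c}ᶜ).ncard ≠ 1 := by
  intro h1
  obtain ⟨-, -, h2, h3⟩ := h.ncard_edgeSet hs
  obtain ⟨p, hp⟩ := Set.ncard_eq_one.1 h1
  obtain ⟨q, hq⟩ := Set.ncard_eq_one.1 (h2.trans h1)
  obtain ⟨r, hr⟩ := Set.ncard_eq_one.1 (h3.trans h1)
  have key : ∀ v ∈ ({a, b, c}ᶜ : Set V), v ≠ p → v ≠ q ∧ v ≠ r ∧ p ≠ q := by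
    intro v hv hvp
    have hva : ¬ G.Adj a v := fun h' => hvp (by
      have : v ∈ G.neighborSet a ∩ {a, b, c}ᶜ := ⟨h', hv⟩
      rwa [hp] at this)
    have hav : a ≠ v := fun h' => hv (by simp [h'])
    obtain ⟨D, E, hD, haD, hvD, hE, hd⟩ := hs.exists_cores hav hva
    have haE := hd a haD
    obtain ⟨hbE, hcE⟩ := h.rotate.mem_both hE haE
    have hqE := mem_of_hasOne hq hE hbE haE
    have hrE : r ∈ E := by
      refine mem_of_hasOne (a := a) (b := c) (c := b) ?_ hE hcE haE
      rw [← hr]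
      congr 2
      rw [Set.pair_comm]
    have hpD : p ∈ D := by
      obtain ⟨y, hy, hyv, h1⟩ := hD.exists_adj_ne haD v
      have h1' := adj_of_sup_edge_left h1 hyv
      have : y ∈ G.neighborSet a ∩ {a, b, c}ᶜ := by
        refine ⟨h1', ?_⟩
        rintro (rfl | rfl | rfl)
        exacts [h1'.ne rfl, hd _ hy hbE, hd _ hy hcE]
      rw [hp] at this
      exact (show y = p from this) ▸ hy
    exact ⟨fun h => hd v hvD (h ▸ hqE), fun h => hd v hvD (h ▸ hrE), fun h => hd p hpD (h ▸ hqE)⟩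
  have hqF : q ∈ ({a, b, c}ᶜ : Set V) := by
    have : q ∈ G.neighborSet b ∩ {a, b, c}ᶜ := by rw [hq]; rfl
    exact this.2
  obtain ⟨v, hv, hvp⟩ : ∃ v ∈ ({a, b, c}ᶜ : Set V), v ≠ p := by
    refine Set.exists_ne_of_one_lt_ncard ?_ p
    have h3 := Set.ncard_add_ncard_compl ({a, b, c} : Set V)
    have h4 : ({a, b, c} : Set V).ncard ≤ 3 := by
      have h5 := Set.ncard_insert_le a ({b, c} : Set V)
      have h6 := Set.ncard_insert_le b ({c} : Set V)
      rw [Set.ncard_singleton] at h6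
      omega
    omega
  have h5 := (key v hv hvp).2.2
  exact (key q hqF h5.symm).1 rfl

/-- `x` has a neighbour in `K`. -/
def HasOne (G : SimpleGraph V) (x : V) (K : Set V) : Prop := ∃ s ∈ K, G.Adj x s

/-- The tree with its three attachments has a median. -/
lemma IsTwiceCovered.exists_median [Finite V] (h : G.IsTwiceCovered a b c)
    (hx : x ∈ ({a, b, c}ᶜ : Set V)) :
    ∃ t ∈ G.comp {a, b, c}ᶜ x, ∀ K ⊆ G.comp {a, b, c}ᶜ x, t ∉ K → G.ConnOn K →
      ¬ (G.HasOne a K ∧ G.HasOne b K) ∧ ¬ (G.HasOne a K ∧ G.HasOne c K) ∧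
        ¬ (G.HasOne b K ∧ G.HasOne c K) := by
  set F : Set V := {a, b, c}ᶜ with hFdef
  set T := G.comp F x with hTdef
  have hTF : T ⊆ F := comp_subset hx
  have hTc : G.ConnOn T := connOn_comp
  have hF : G.IsForestOn F := h.2.2.2.1.subset (by
    rw [hFdef, ← insert_compl_triple h.2.1 h.2.2.1]
    exact Set.subset_insert _ _)
  set Rich : Set V → Prop := fun K => (G.HasOne a K ∧ G.HasOne b K) ∨
    (G.HasOne a K ∧ G.HasOne c K) ∨ (G.HasOne b K ∧ G.HasOne c K) with hRich
  have hone : ∀ v K L, K ⊆ L → G.HasOne v K → G.HasOne v L := fun v K L hKL ⟨s, hs, h⟩ =>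
    ⟨s, hKL hs, h⟩
  have hmono : ∀ K L, K ⊆ L → Rich K → Rich L := fun K L hKL hR =>
    hR.imp (fun h => ⟨hone _ _ _ hKL h.1, hone _ _ _ hKL h.2⟩) fun h =>
      h.imp (fun h => ⟨hone _ _ _ hKL h.1, hone _ _ _ hKL h.2⟩)
      fun h => ⟨hone _ _ _ hKL h.1, hone _ _ _ hKL h.2⟩
  have hpair : ∀ v, ¬ G.HasTwo v T → ∀ K ⊆ T, G.HasOne v K → ¬ G.HasOne v (T \ K) := by
    rintro v hv K hK ⟨s, hs, h1⟩ ⟨t, ht, h2⟩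
    exact hv ⟨s, hK hs, t, ht.1, fun h => ht.2 (h ▸ hs), h1, h2⟩
  have nc : ¬ G.HasTwo c T := h.not_hasTwo hTF hTc
  have na : ¬ G.HasTwo a T := h.rotate.not_hasTwo (by rw [triple_rotate]; exact hTF) hTc
  have nb : ¬ G.HasTwo b T := h.rotate.rotate.not_hasTwo
    (by rw [triple_rotate, triple_rotate]; exact hTF) hTc
  -- Each of `a`, `b`, `c` attaches to the tree at most once, so complementary parts cannot both
  -- meet two of the three attachments.
  obtain ⟨t, ht, htR⟩ := exists_centroid (hF.subset hTF) hTc ⟨x, self_mem_comp⟩ Rich hmono (by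
    intro K hK _ _ h1 h2
    have p1 := hpair a na K hK
    have p2 := hpair b nb K hK
    have p3 := hpair c nc K hK
    simp only [hRich] at h1 h2
    tauto)
  refine ⟨t, ht, fun K hK htK hKc => ?_⟩
  have hnR : ¬ Rich K := by
    intro hR
    have hne : ∃ y, y ∈ K := by
      rcases hR with ⟨⟨s, hs, -⟩, -⟩ | ⟨⟨s, hs, -⟩, -⟩ | ⟨⟨s, hs, -⟩, -⟩
      all_goals exact ⟨s, hs⟩
    obtain ⟨y, hy⟩ := hne
    have hsub : K ⊆ T \ {t} := fun z hz => ⟨hK hz, fun h => htK (h ▸ hz)⟩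
    exact htR y (hsub hy) (hmono _ _ (hKc.subset_comp hsub hy) hR)
  simp only [hRich] at hnR
  tauto

/-- Join the medians of the two outside trees. The core `E` avoids both medians, so each of its
outside pieces attaches to at most one of `a`, `b`, `c`; hence `E` must contain all three. Then `D`
lies in the outside forest plus an edge between two components, where there is no cycle. -/
lemma IsTwiceCovered.ncard_ne_two [Finite V] (h : G.IsTwiceCovered a b c)
    (hs : G.CoreSaturated) : (G.neighborSet a ∩ {a, b, c}ᶜ).ncard ≠ 2 := by
  intro h2
  obtain ⟨p₁, p₂, hne, hset⟩ := Set.ncard_eq_two.1 h2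
  have hm₁ : p₁ ∈ G.neighborSet a ∩ {a, b, c}ᶜ := by rw [hset]; simp
  have hm₂ : p₂ ∈ G.neighborSet a ∩ {a, b, c}ᶜ := by rw [hset]; simp
  set F : Set V := {a, b, c}ᶜ with hFdef
  have hF : G.IsForestOn F := h.2.2.2.1.subset (by
    rw [hFdef, ← insert_compl_triple h.2.1 h.2.2.1]
    exact Set.subset_insert _ _)
  have hcomp : p₂ ∉ G.comp F p₁ := fun hmem =>
    h.rotate.not_hasTwo (by rw [triple_rotate]; exact comp_subset hm₁.2) connOn_comp
      ⟨p₁, self_mem_comp, p₂, hmem, hne, hm₁.1, hm₂.1⟩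
  obtain ⟨t₁, ht₁, hmed₁⟩ := h.exists_median hm₁.2
  obtain ⟨t₂, ht₂, hmed₂⟩ := h.exists_median hm₂.2
  have hdis := Set.disjoint_left.1 (comp_disjoint_of_notMem hcomp)
  have ht₁F : t₁ ∈ F := comp_subset hm₁.2 ht₁
  have ht₂F : t₂ ∈ F := comp_subset hm₂.2 ht₂
  have htne : t₁ ≠ t₂ := fun h => hdis ht₁ (h ▸ ht₂)
  have hnr : ¬ (G.within F).Reachable t₁ t₂ := fun h => hdis (Reachable.trans ht₁ h) ht₂
  obtain ⟨D, E, hD, ht₁D, ht₂D, hE, hd⟩ := hs.exists_cores htne fun h =>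
    hnr (Adj.reachable ⟨h, ht₁F, ht₂F⟩)
  have hmed : ∀ K ⊆ E, K ⊆ F → G.ConnOn K →
      ¬ (G.HasOne a K ∧ G.HasOne b K) ∧ ¬ (G.HasOne a K ∧ G.HasOne c K) ∧
        ¬ (G.HasOne b K ∧ G.HasOne c K) := by
    intro K hKE hKF hKc
    by_cases hne : K.Nonempty
    · obtain ⟨y, hy⟩ := hne
      have hKy : K ⊆ G.comp F y := hKc.subset_comp hKF hy
      -- Every outside component contains a neighbour of `a`, so there are only the components of
      -- `p₁` and `p₂`.
      obtain ⟨p, hp, hap⟩ := h.rotate.exists_adj_comp hs (x := y)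
        (by rw [triple_rotate]; exact hKF hy)
      rw [triple_rotate] at hp
      have hpm : p ∈ G.neighborSet a ∩ F := ⟨hap, comp_subset (hKF hy) hp⟩
      have hKp : ∀ z ∈ K, z ∈ G.comp F p := fun z hz =>
        Reachable.trans (Reachable.symm hp) (hKy hz)
      rw [hset] at hpm
      rcases hpm with rfl | rfl
      · exact hmed₁ K hKp (fun h => hd _ ht₁D (hKE h)) hKc
      · exact hmed₂ K hKp (fun h => hd _ ht₂D (hKE h)) hKc
    · have : ∀ v, ¬ G.HasOne v K := fun v ⟨s, hs, _⟩ => hne ⟨s, hs⟩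
      exact ⟨fun h => this _ h.1, fun h => this _ h.1, fun h => this _ h.1⟩
  have n1 : ∀ K ⊆ F, G.ConnOn K → ¬ G.HasTwo c K := fun K hK hKc => h.not_hasTwo hK hKc
  have n2 : ∀ K ⊆ F, G.ConnOn K → ¬ G.HasTwo a K := fun K hK hKc =>
    h.rotate.not_hasTwo (by rw [triple_rotate]; exact hK) hKc
  have n3 : ∀ K ⊆ F, G.ConnOn K → ¬ G.HasTwo b K := fun K hK hKc =>
    h.rotate.rotate.not_hasTwo (by rw [triple_rotate, triple_rotate]; exact hK) hKc
  by_cases haE : a ∈ E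
  · by_cases hbE : b ∈ E
    · by_cases hcE : c ∈ E
      · refine hF.sup_edge hnr D (fun x hx => ?_) hD
        rintro (rfl | rfl | rfl)
        exacts [hd _ hx haE, hd _ hx hbE, hd _ hx hcE]
      · have hsub : E \ {a, b} ⊆ F := by
          rintro x ⟨hx, hx'⟩ (rfl | rfl | rfl)
          exacts [hx' (by simp), hx' (by simp), hcE hx]
        refine not_isCore_of_forall_connOn (b := a) (c := b) (hF.subset hsub)
          (fun K hK hKc => n2 K (hK.trans hsub) hKc) (fun K hK hKc => n3 K (hK.trans hsub) hKc)
          (fun K hK hKc s hs' t ht h1 h2 => ?_) hE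
        exact (hmed K (hK.trans Set.sdiff_subset) (hK.trans hsub) hKc).1 ⟨⟨s, hs', h1⟩, ⟨t, ht, h2⟩⟩
    · have hsub : E \ {a, c} ⊆ F := by
        rintro x ⟨hx, hx'⟩ (rfl | rfl | rfl)
        exacts [hx' (by simp), hbE hx, hx' (by simp)]
      refine not_isCore_of_forall_connOn (b := a) (c := c) (hF.subset hsub)
        (fun K hK hKc => n2 K (hK.trans hsub) hKc) (fun K hK hKc => n1 K (hK.trans hsub) hKc)
        (fun K hK hKc s hs' t ht h1 h2 => ?_) hE
      exact (hmed K (hK.trans Set.sdiff_subset) (hK.trans hsub) hKc).2.1 ⟨⟨s, hs', h1⟩, ⟨t, ht, h2⟩⟩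
  · have hsub : E \ {b, c} ⊆ F := by
      rintro x ⟨hx, hx'⟩ (rfl | rfl | rfl)
      exacts [haE hx, hx' (by simp), hx' (by simp)]
    refine not_isCore_of_forall_connOn (b := b) (c := c) (hF.subset hsub)
      (fun K hK hKc => n3 K (hK.trans hsub) hKc) (fun K hK hKc => n1 K (hK.trans hsub) hKc)
      (fun K hK hKc s hs' t ht h1 h2 => ?_) hE
    exact (hmed K (hK.trans Set.sdiff_subset) (hK.trans hsub) hKc).2.2 ⟨⟨s, hs', h1⟩, ⟨t, ht, h2⟩⟩

theorem IsTwiceCovered.exists_ncard_edgeSet [Finite V] (h : G.IsTwiceCovered a b c)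
    (hs : G.CoreSaturated) (hV : 5 ≤ Nat.card V) :
    ∃ k, 3 ≤ k ∧ k + 3 ≤ Nat.card V ∧ G.edgeSet.ncard = Nat.card V + 2 * k := by
  obtain ⟨h1, h2, -, h4⟩ := h.ncard_edgeSet hs
  refine ⟨_, ?_, h2, h1⟩
  have n1 := h.ncard_ne_one hs hV
  have n2 := h.ncard_ne_two hs
  have n0 : (G.neighborSet a ∩ {a, b, c}ᶜ).ncard ≠ 0 := by
    intro h0
    have h3 := Set.ncard_add_ncard_compl ({a, b, c} : Set V)
    have h4' : ({a, b, c} : Set V).ncard ≤ 3 := by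
      have h5 := Set.ncard_insert_le a ({b, c} : Set V)
      have h6 := Set.ncard_insert_le b ({c} : Set V)
      rw [Set.ncard_singleton] at h6
      omega
    obtain ⟨x, hx⟩ : ({a, b, c}ᶜ : Set V).Nonempty := by
      rw [← Set.ncard_pos (Set.toFinite _)]
      omega
    obtain ⟨y, hy, hcy⟩ := h.exists_adj_comp hs hx
    have : 0 < (G.neighborSet c ∩ {a, b, c}ᶜ).ncard :=
      (Set.ncard_pos (Set.toFinite _)).2 ⟨y, hcy, comp_subset hx hy⟩
    omega
  omega

end SimpleGraph

/-! ### Saturated graphs that lose all cycles with one vertex and one edge -/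

namespace SimpleGraph

variable {V : Type*} {G : SimpleGraph V} {S T F D E K L C : Set V}
  {a b c p q s t u v w x y z : V}

lemma ConnOn.exists_adj_of_subset (hT : G.ConnOn T) (hK : K ⊆ T) (ha : a ∈ K) (hb : b ∈ T)
    (hbK : b ∉ K) : ∃ y ∈ K, ∃ z ∈ T \ K, G.Adj y z := by
  by_contra! hcon
  have key : ∀ p q, (G.within T).Walk p q → p ∈ K → q ∈ K := by
    intro p q c hp
    induction c with
    | nil => exact hp
    | @cons p p' q hadj c ih =>
      refine ih ?_
      by_contra hp'
      exact hcon p hp p' ⟨hadj.2.2, hp'⟩ hadj.1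
  obtain ⟨c⟩ := hT a (hK ha) b hb
  exact hbK (key a b c ha)

lemma IsCore.two_lt_ncard [Finite V] (h : G.IsCore D) : 2 < D.ncard := by
  obtain ⟨x, hx⟩ := h.1
  obtain ⟨y, hy, z, hz, hyz, h1, h2⟩ := h.2 x hx
  exact (Set.two_lt_ncard (Set.toFinite _)).2 ⟨x, hx, y, hy, z, hz, h1.ne, h2.ne, hyz⟩

lemma IsForestOn.adj_of_coreSaturated (hs : G.CoreSaturated) (hf : G.IsForestOn {x}ᶜ)
    (hv : v ≠ x) : G.Adj x v := by
  by_contra hadj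
  obtain ⟨D, E, hD, hx, -, hE, hd⟩ := hs.exists_cores hv.symm hadj
  exact hf E (fun y hy h => hd x hx (h ▸ hy)) hE

lemma ncard_edgeSet_eq_compl_singleton [Finite V] (x : V) :
    G.edgeSet.ncard = G.edgeCount {x}ᶜ + (G.neighborSet x).ncard := by
  have := edgeCount_sdiff_singleton (G := G) (Set.mem_univ x)
  rwa [edgeCount_univ, Set.inter_univ, ← Set.compl_eq_univ_sdiff] at this

/-- Every cycle of the graph passes through `x`, so the core closed by a new edge between components
avoids `x`. But that edge creates no cycle off `x`. -/
lemma IsForestOn.connOn_of_coreSaturated [Finite V] (hs : G.CoreSaturated)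
    (hf : G.IsForestOn {x}ᶜ) : G.ConnOn {x}ᶜ := by
  intro p hp q hq
  by_contra hr
  have hpq : p ≠ q := fun h => hr (h ▸ Reachable.refl _)
  obtain ⟨D, E, hD, -, -, hE, hd⟩ := hs.exists_cores hpq fun h =>
    hr (Adj.reachable ⟨h, hp, hq⟩)
  have hxE : x ∈ E := by
    by_contra hxE
    exact hf E (fun y hy h => hxE (h ▸ hy)) hE
  exact hf.sup_edge hr D (fun y hy h => hd y hy (h ▸ hxE)) hD

/-- Two non-adjacent vertices of the tree `G - x` are joined by a path off which there is an
edge. -/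
lemma IsForestOn.exists_adj_of_isPath [Finite V] (hs : G.CoreSaturated)
    (hf : G.IsForestOn {x}ᶜ) (c : (G.within {x}ᶜ).Walk u v) (hc : c.IsPath) (huv : u ≠ v)
    (hadj : ¬ G.Adj u v) (hu : u ≠ x) : ∃ y z, G.Adj y z ∧ y ≠ x ∧ z ≠ x ∧
      y ∉ c.support ∧ z ∉ c.support := by
  obtain ⟨D, E, hD, huD, hvD, hE, hd⟩ := hs.exists_cores huv hadj
  have hxE : x ∈ E := by
    by_contra hxE
    exact hf E (fun y hy h => hxE (h ▸ hy)) hE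
  have hxD : x ∉ D := fun h => hd x h hxE
  -- The new core contains the whole tree path from `u` to `v`: without a path vertex `r`, the new
  -- edge joins two components of a forest. The desired edge `yz` is then taken from `E`, next to
  -- `x`.
  have hsub : ∀ r ∈ c.support, r ∈ D := by
    intro r hr
    by_contra hrD
    refine (hf.subset (Set.sdiff_subset (t := {r}))).sup_edge (p := u) (q := v) ?_ D
      (fun y hy => ⟨fun h => hxD (h ▸ hy), fun h => hrD (h ▸ hy)⟩) hD
    classical
    rintro ⟨d⟩
    have hle : G.within ({x}ᶜ \ {r}) ≤ G.within {x}ᶜ := within_mono le_rfl Set.sdiff_subset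
    have hmem := mem_of_mem_support_within d.toPath.1 ⟨hu, fun h => hrD (h ▸ huD)⟩
    have heq := ((isForestOn_iff.1 hf).subsingleton_path u v).elim ⟨c, hc⟩
      ⟨d.toPath.1.mapLe hle, (Walk.isPath_mapLe hle).2 d.toPath.2⟩
    have h2 : c.support = (d.toPath.1.mapLe hle).support := by
      rw [Subtype.mk.injEq] at heq
      rw [heq]
    rw [Walk.support_mapLe_eq_support] at h2
    exact (hmem r (h2 ▸ hr)).2 rfl
  obtain ⟨y, hy, -, hxy⟩ := hE.exists_adj_ne hxE x
  obtain ⟨z, hz, hzx, hyz⟩ := hE.exists_adj_ne hy x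
  exact ⟨y, z, hyz, hxy.ne.symm, hzx, fun h => hd y (hsub y h) hy, fun h => hd z (hsub z h) hz⟩

/-- Take a longest path in the tree off `x`. Joining its ends shows that some edge `yz` of the tree
avoids it, so a branch of depth two hangs from some path vertex `w`. By maximality `w` is at
distance at least two from both ends. Five path vertices, `y`, `z` and `x` make eight. -/
lemma IsForestOn.eight_le_card [Finite V] (hs : G.CoreSaturated) (hV : 4 ≤ Nat.card V)
    (hf : G.IsForestOn {x}ᶜ) : 8 ≤ Nat.card V := by
  classical
  have := Fintype.ofFinite V
  have hT := hf.connOn_of_coreSaturated hs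
  have hTc : ({x}ᶜ : Set V).ncard + 1 = Nat.card V := by
    have := Set.ncard_add_ncard_compl ({x} : Set V)
    rw [Set.ncard_singleton] at this
    omega
  have : Nonempty V := ⟨x⟩
  obtain ⟨u, v, c, hc, hmax⟩ :=
    Walk.exists_isPath_forall_isPath_length_le_length (G.within {x}ᶜ)
  obtain ⟨r, hr, r', hr', hrr⟩ : ∃ r ∈ ({x}ᶜ : Set V), ∃ r' ∈ ({x}ᶜ : Set V), r ≠ r' :=
    (Set.one_lt_ncard (Set.toFinite _)).1 (by omega)
  have hlen : 1 ≤ c.length := by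
    obtain ⟨z, hz, hrz⟩ := hT.exists_adj hr hr' hrr
    have e : (G.within {x}ᶜ).Adj r z := ⟨hrz, hr, hz⟩
    have := hmax r z (.cons e .nil) (by simp [hrz.ne])
    simpa using this
  have hu : u ∈ ({x}ᶜ : Set V) := by
    cases c with
    | nil => simp at hlen
    | cons h _ => exact h.2.1
  have hmem := mem_of_mem_support_within c hu
  have hv := hmem v c.end_mem_support
  have hext : ∀ y ∉ c.support, y ∈ ({x}ᶜ : Set V) → ∀ w ∈ c.support, G.Adj y w →
      w ≠ u ∧ w ≠ v := by
    intro y hy hyx w hw hyw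
    refine ⟨?_, ?_⟩
    · rintro rfl
      have e : (G.within {x}ᶜ).Adj y w := ⟨hyw, hyx, hu⟩
      have := hmax _ _ (.cons e c)
        (by simp [Walk.cons_isPath_iff, hc, hy])
      simp at this
    · rintro rfl
      have e : (G.within {x}ᶜ).Adj y w := ⟨hyw, hyx, hv⟩
      have := hmax _ _ (.cons e c.reverse)
        (by simp [Walk.cons_isPath_iff, hc, hy])
      simp at this
  have huv : u ≠ v := by
    rintro rfl
    rw [Walk.isPath_iff_nil, ← Walk.length_eq_zero_iff] at hc
    omega
  have hsuppc : {a | a ∈ c.support}.ncard = c.length + 1 := by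
    have : {a | a ∈ c.support} = (c.support.toFinset : Set V) := by ext; simp
    rw [this, Set.ncard_coe_finset, List.toFinset_card_of_nodup hc.support_nodup,
      Walk.length_support]
  have hsub : {a | a ∈ c.support} ⊆ ({x}ᶜ : Set V) := hmem
  -- If the ends were adjacent, the longest path would be a single edge, and any further tree vertex
  -- would extend it.
  have hadj : ¬ G.Adj u v := by
    intro hadj
    have e : (G.within {x}ᶜ).Adj u v := ⟨hadj, hu, hv⟩
    have h1 := ((isForestOn_iff.1 hf).subsingleton_path u v).elim ⟨c, hc⟩
      ⟨.cons e .nil, by simp [huv]⟩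
    rw [Subtype.mk.injEq] at h1
    have hsupp : ∀ w ∈ c.support, w = u ∨ w = v := by
      rw [h1]
      simp
    have hl : c.length = 1 := by rw [h1]; rfl
    obtain ⟨z, hz, hzc⟩ : ∃ z ∈ ({x}ᶜ : Set V), z ∉ {a | a ∈ c.support} :=
      Set.exists_mem_notMem_of_ncard_lt_ncard (by omega)
    obtain ⟨y, hy, z', hz', hyz⟩ := hT.exists_adj_of_subset hsub c.start_mem_support hz hzc
    have := hext z' hz'.2 hz'.1 y hy hyz.symm
    rcases hsupp y hy with h | h
    exacts [this.1 h, this.2 h]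
  obtain ⟨y, z, hyz, hy, hz, hyc, hzc⟩ := hf.exists_adj_of_isPath hs c hc huv hadj hu
  have hcard : c.length + 3 ≤ ({x}ᶜ : Set V).ncard := by
    have h1 : insert y (insert z {a | a ∈ c.support}) ⊆ ({x}ᶜ : Set V) :=
      Set.insert_subset hy (Set.insert_subset hz hsub)
    have h2 := Set.ncard_le_ncard h1
    rw [Set.ncard_insert_of_notMem (by simp [hyz.ne, hyc]),
      Set.ncard_insert_of_notMem (by simp [hzc]), hsuppc] at h2
    exact h2
  suffices 4 ≤ c.length by omega
  set R : Set V := {x}ᶜ \ {a | a ∈ c.support} with hR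
  have hyR : y ∈ R := ⟨hy, hyc⟩
  have hzR : z ∈ R := ⟨hz, hzc⟩
  have hzK : z ∈ G.comp R y := mem_comp_of_adj self_mem_comp hyR hzR hyz
  obtain ⟨y₁, hy₁, w, hw, hyw⟩ := hT.exists_adj_of_subset
    ((comp_subset hyR).trans Set.sdiff_subset) (self_mem_comp (p := y)) hu
    fun h => (comp_subset hyR h).2 c.start_mem_support
  have hwc : w ∈ c.support := by
    by_contra hwc
    exact hw.2 (mem_comp_of_adj hy₁ hyR ⟨hw.1, hwc⟩ hyw)
  obtain ⟨y₂, hy₂, h12⟩ : ∃ y₂ ∈ G.comp R y, G.Adj y₁ y₂ := by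
    by_cases h : y₁ = y
    · exact connOn_comp.exists_adj hy₁ hzK (h ▸ hyz.ne)
    · exact connOn_comp.exists_adj hy₁ self_mem_comp h
  have hR₁ := comp_subset hyR hy₁
  have hR₂ := comp_subset hyR hy₂
  have e1 : (G.within {x}ᶜ).Adj y₁ w := ⟨hyw, hR₁.1, hw.1⟩
  have e2 : (G.within {x}ᶜ).Adj y₂ y₁ := ⟨h12.symm, hR₂.1, hR₁.1⟩
  have l1 := hmax _ _ (.cons e2 (.cons e1 (c.dropUntil w hwc))) (by
    have hn : ∀ r ∈ (c.dropUntil w hwc).support, r ∈ c.support := fun r hr =>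
      c.support_dropUntil_subset_support hwc hr
    simp only [Walk.cons_isPath_iff, Walk.support_cons, List.mem_cons, not_or]
    exact ⟨⟨hc.dropUntil hwc, fun h => hR₁.2 (hn _ h)⟩, h12.ne.symm, fun h => hR₂.2 (hn _ h)⟩)
  have l2 := hmax _ _ (.cons e2 (.cons e1 (c.takeUntil w hwc).reverse)) (by
    have hn : ∀ r ∈ (c.takeUntil w hwc).reverse.support, r ∈ c.support := fun r hr =>
      c.support_takeUntil_subset_support hwc (by simpa using hr)
    simp only [Walk.cons_isPath_iff, Walk.support_cons, List.mem_cons, not_or]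
    exact ⟨⟨(hc.takeUntil hwc).reverse, fun h => hR₁.2 (hn _ h)⟩, h12.ne.symm,
      fun h => hR₂.2 (hn _ h)⟩)
  have l3 := congrArg Walk.length (c.take_spec hwc)
  rw [Walk.length_append] at l3
  simp only [Walk.length_cons, Walk.length_reverse] at l1 l2
  omega

/-- The edge count of a saturated graph which a single vertex turns into a forest. -/
lemma IsForestOn.ncard_edgeSet_of_coreSaturated [Finite V] (hs : G.CoreSaturated)
    (hV : 4 ≤ Nat.card V) (hf : G.IsForestOn {x}ᶜ) :
    8 ≤ Nat.card V ∧ G.edgeSet.ncard + 3 = 2 * Nat.card V := by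
  refine ⟨hf.eight_le_card hs hV, ?_⟩
  have h1 := Set.ncard_add_ncard_compl ({x} : Set V)
  rw [Set.ncard_singleton] at h1
  have h2 := hf.edgeCount_add_one_eq ((Set.ncard_pos (Set.toFinite _)).1 (by omega))
    (hf.connOn_of_coreSaturated hs)
  have h3 : G.neighborSet x = {x}ᶜ := by
    ext v
    exact ⟨fun h => Adj.ne' h, fun h => hf.adj_of_coreSaturated hs h⟩
  rw [ncard_edgeSet_eq_compl_singleton x, h3]
  omega

/-- `C` is a cycle contained in every core that avoids `x`, and it meets every core. -/
structure IsRim (G : SimpleGraph V) (x : V) (C : Set V) : Prop where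
  core : G.IsCore C
  notMem : x ∉ C
  minimal : ∀ D, G.IsCore D → x ∉ D → C ⊆ D
  compl : G.IsForestOn Cᶜ

/-- Take a smallest core off `x`. Any other core off `x` shares a core with it, by
`exists_core_inter`, and minimality makes this shared core the whole of `C`. -/
lemma IsAlmostForest.exists_isRim [Finite V] (h : G.IsAlmostForest x w p)
    (hno : G.NoDisjointCores Set.univ) (hf : ¬ G.IsForestOn {x}ᶜ) : ∃ C, G.IsRim x C := by
  obtain ⟨D₀, hD₀, hc₀⟩ := not_isForestOn.1 hf
  obtain ⟨C, ⟨hC, hCx⟩, hmin⟩ := Set.exists_min_image {D | G.IsCore D ∧ D ⊆ {x}ᶜ} Set.ncard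
    (Set.toFinite _) ⟨D₀, hc₀, hD₀⟩
  refine ⟨C, hC, fun h => hCx h rfl, fun D hD hxD => ?_,
    hno.isForestOn (Set.subset_univ _) hC (Set.subset_univ _) disjoint_compl_right⟩
  obtain ⟨D', hD', hc'⟩ := exists_core_inter h hCx (D₂ := D) (fun y hy h => hxD (h ▸ hy)) hC hD
  have hCD : D' ⊆ C := hD'.trans Set.inter_subset_left
  rw [← Set.eq_of_subset_of_ncard_le hCD (hmin D' ⟨hc', hCD.trans hCx⟩)]
  exact hD'.trans Set.inter_subset_right

lemma IsRim.eq_of_subset (h : G.IsRim x C) (hD : G.IsCore D) (hDC : D ⊆ C) : D = C :=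
  hDC.antisymm (h.minimal D hD fun hx => h.notMem (hDC hx))

/-- A cycle minus a vertex is a path. Here `t` has two neighbours in one component of `C \ {t}`, and
that component together with `t` contains a core, which can only be `C`. -/
lemma IsRim.connOn_sdiff [Finite V] (h : G.IsRim x C) (ht : t ∈ C) : G.ConnOn (C \ {t}) := by
  have hf : G.IsForestOn (C \ {t}) := fun D hD hc =>
    (hD ((h.eq_of_subset hc (hD.trans Set.sdiff_subset)).symm ▸ ht)).2 rfl
  obtain ⟨p, hp, q, hq, hpq, h1, h2, hr⟩ := h.core.exists_reachable hf
  have hpC : p ∈ C \ {t} := ⟨hp, h1.ne.symm⟩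
  have hsub := comp_subset (G := G) hpC
  obtain ⟨D, hD, hc⟩ := exists_core_insert_of_connOn (connOn_comp (G := G)) hpq h1 h2
    self_mem_comp hr fun ht' => (hsub ht').2 rfl
  have hDC := h.eq_of_subset hc (hD.trans (Set.insert_subset ht (hsub.trans Set.sdiff_subset)))
  have : C \ {t} = G.comp (C \ {t}) p := by
    refine Set.Subset.antisymm (fun y hy => ?_) hsub
    rcases hD (hDC.symm ▸ hy.1) with h' | h'
    exacts [absurd h' hy.2, h']
  rw [this]
  exact connOn_comp

lemma IsRim.reachable_within [Finite V] (h : G.IsRim x C) (hp : p ∈ C) (hq : q ∈ C) :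
    (G.within C).Reachable p q := by
  obtain ⟨t, ht, htn⟩ : ∃ t ∈ C, t ∉ ({p, q} : Set V) := by
    refine Set.exists_mem_notMem_of_ncard_lt_ncard ?_
    have h1 := Set.ncard_insert_le p ({q} : Set V)
    have h2 := h.core.two_lt_ncard
    rw [Set.ncard_singleton] at h1
    omega
  simp only [Set.mem_insert_iff, Set.mem_singleton_iff, not_or] at htn
  exact (h.connOn_sdiff ht p ⟨hp, Ne.symm htn.1⟩ q ⟨hq, Ne.symm htn.2⟩).mono
    (within_mono le_rfl Set.sdiff_subset)

lemma IsRim.adj (h : G.IsRim x C) (hs : G.CoreSaturated) (hc : c ∈ C) : G.Adj x c := by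
  by_contra hadj
  obtain ⟨D, E, hD, hx, hcD, hE, hd⟩ := hs.exists_cores (fun e : x = c => h.notMem (e ▸ hc)) hadj
  exact hd c hcD (h.minimal E hE (hd x hx) hc)

/-- Join a rim vertex `c` to another component off `x`. The core `E` misses `c`, so it contains `x`
and `D` does not. Off `x` the new graph is still a forest up to one edge, so `D` and `C` share a
core, which must be `C`; then `C` and `E` are disjoint. -/
lemma IsRim.connOn_compl [Finite V] (h : G.IsRim x C) (hs : G.CoreSaturated)
    (ha : G.IsAlmostForest x w p) : G.ConnOn {x}ᶜ := by
  obtain ⟨c, hc⟩ := h.core.1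
  have hCx : C ⊆ {x}ᶜ := fun y hy e => h.notMem (e ▸ hy)
  have key : ∀ q ∈ ({x}ᶜ : Set V), (G.within {x}ᶜ).Reachable c q := by
    intro q hq
    by_contra hr
    have hqC : q ∉ C := fun hqC => hr ((h.reachable_within hc hqC).mono (within_mono le_rfl hCx))
    obtain ⟨D, E, hD, hcD, -, hE, hd⟩ := hs.exists_cores (fun e : c = q => hqC (e ▸ hc)) fun h' =>
      hr (Adj.reachable ⟨h', hCx hc, hq⟩)
    have hxE : x ∈ E := by
      by_contra hxE
      exact hd c hcD (h.minimal E hE hxE hc)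
    have hf : ((G.deleteEdges {s(w, p)}) ⊔ edge c q).IsForestOn {x}ᶜ :=
      IsForestOn.sup_edge ha fun h' => hr (h'.mono (within_mono (deleteEdges_le _) le_rfl))
    have hf' : ((G ⊔ edge c q).deleteEdges {s(w, p)}).IsForestOn {x}ᶜ := by
      refine hf.anti (fun y z hyz => ?_) le_rfl
      rw [deleteEdges_adj] at hyz
      rcases hyz.1 with h' | h'
      · exact Or.inl (deleteEdges_adj.2 ⟨h', hyz.2⟩)
      · exact Or.inr h'
    obtain ⟨D', hD', hc'⟩ := exists_core_inter hf' (fun y hy e => hd x (e ▸ hy) hxE) hCx hD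
      (h.core.mono le_sup_left)
    have hDC := h.eq_of_subset
      (isCore_of_sup_edge hc' (Or.inr fun h' => hqC (hD' h').2)) fun y hy => (hD' hy).2
    exact hs.1.false_of_disjoint h.core hE (Set.subset_univ _) (Set.subset_univ _) fun y hy =>
      hd y (hD' (hDC.symm ▸ hy)).1
  exact fun p hp q hq => (key p hp).symm.trans (key q hq)

/-- Off `x`, deleting the rim edge `wp` leaves a tree with `Nat.card V - 2` edges; then `wp` and the
edges at `x` are added back. -/
lemma IsRim.ncard_edgeSet [Finite V] (h : G.IsRim x C) (hs : G.CoreSaturated)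
    (ha : G.IsAlmostForest x w p) :
    G.edgeSet.ncard + 1 = Nat.card V + (G.neighborSet x).ncard := by
  have hCx : C ⊆ {x}ᶜ := fun y hy e => h.notMem (e ▸ hy)
  have hwp := (h.core.reachable_deleteEdges (IsForestOn.subset ha hCx)).mono
    (within_mono le_rfl hCx)
  have hadj : G.Adj w p ∧ w ∈ ({x}ᶜ : Set V) ∧ p ∈ ({x}ᶜ : Set V) := by
    by_contra hcon
    refine ha C hCx ⟨h.core.1, fun y hy => ?_⟩
    obtain ⟨s, hs, t, ht, hst, h1, h2⟩ := h.core.2 y hy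
    have : ∀ r ∈ C, G.Adj y r → (G.deleteEdges {s(w, p)}).Adj y r := by
      intro r hr hyr
      refine deleteEdges_adj.2 ⟨hyr, fun he => hcon ?_⟩
      rcases Sym2.eq_iff.1 he with ⟨rfl, rfl⟩ | ⟨rfl, rfl⟩
      exacts [⟨hyr, hCx hy, hCx hr⟩, ⟨hyr.symm, hCx hr, hCx hy⟩]
    exact ⟨s, hs, t, ht, hst, this s hs h1, this t ht h2⟩
  have hconn : (G.deleteEdges {s(w, p)}).ConnOn {x}ᶜ := by
    intro y hy z hz
    refine reachable_of_adj_imp id (fun y z hyz => ?_) (h.connOn_compl hs ha y hy z hz)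
    by_cases he : s(y, z) = s(w, p)
    · rcases Sym2.eq_iff.1 he with ⟨rfl, rfl⟩ | ⟨rfl, rfl⟩
      exacts [hwp, hwp.symm]
    · exact Adj.reachable ⟨deleteEdges_adj.2 ⟨hyz.1, he⟩, hyz.2⟩
  have h1 := IsForestOn.edgeCount_add_one_eq ha (h.core.1.mono hCx) hconn
  have h2 := edgeCount_sup_edge (G := G.deleteEdges {s(w, p)}) hadj.2.1 hadj.2.2 hadj.1.ne
    (by simp [deleteEdges_adj])
  have h3 : G.deleteEdges {s(w, p)} ⊔ edge w p = G := by
    refine le_antisymm (sup_le (deleteEdges_le _) ?_) (le_deleteEdges_sup_edge G w p)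
    rw [edge_le_iff]
    exact Or.inr hadj.1
  rw [h3] at h2
  have h4 := Set.ncard_add_ncard_compl ({x} : Set V)
  rw [Set.ncard_singleton] at h4
  have := ncard_edgeSet_eq_compl_singleton (G := G) x
  omega

/-- The complement of the rim is connected: after joining `x` to another component there, the core
missing `x` contains the rim, and the other core lies in a forest. -/
lemma IsRim.exists_adj_comp [Finite V] (h : G.IsRim x C) (hs : G.CoreSaturated)
    (hz : z ∈ Cᶜ \ {x}) : ∃ y ∈ G.comp (Cᶜ \ {x}) z, G.Adj x y := by
  have key : ∀ z ∈ Cᶜ, (G.within Cᶜ).Reachable x z := by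
    intro z hz
    by_contra hr
    have hxz : x ≠ z := fun e => hr (e ▸ Reachable.refl _)
    obtain ⟨D, E, hD, hx, -, hE, hd⟩ := hs.exists_cores hxz fun h' =>
      hr (Adj.reachable ⟨h', h.notMem, hz⟩)
    have hCE := h.minimal E hE (hd x hx)
    exact h.compl.sup_edge hr D (fun y hy hyC => hd y hy (hCE hyC)) hD
  exact ConnOn.exists_adj_comp (fun p hp q hq => (key p hp).symm.trans (key q hq)) h.notMem hz

lemma IsRim.isTwiceCovered (h : G.IsRim x C) (hs : c ∈ C) (ht : t ∈ C) (hct : c ≠ t)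
    (hN : ∀ v ∈ C, v ≠ c → v ≠ t → ∀ y, G.Adj v y → y = x ∨ y = c ∨ y = t) :
    G.IsTwiceCovered x c t := by
  have hx : ∀ r ∈ C, G.IsForestOn {x, r}ᶜ := fun r hr D hD hc =>
    hD (h.minimal D hc (fun hx => hD hx (Or.inl rfl)) hr) (Or.inr rfl)
  refine ⟨fun e => h.notMem (e ▸ hs), fun e => h.notMem (e ▸ ht), hct, hx c hs, hx t ht,
    fun D hD hc => ?_⟩
  refine h.compl D (fun v hv hvC => ?_) hc
  have hv' := hD hv
  simp only [Set.mem_compl_iff, Set.mem_insert_iff, Set.mem_singleton_iff, not_or] at hv'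
  refine hc.notMem_of_unique (w := x) (fun y hy hvy => ?_) hv
  rcases hN v hvC hv'.1 hv'.2 y hvy with e | rfl | rfl
  · exact e
  · exact absurd hy fun hy => hD hy (Or.inl rfl)
  · exact absurd hy fun hy => hD hy (Or.inr rfl)

/-- The vertices of a rim with a neighbour off the rim and the hub inject into the neighbours of
the hub off the rim. -/
lemma IsRim.ncard_le [Finite V] (h : G.IsRim x C) (hs : G.CoreSaturated) :
    (C ∩ {v | ∃ z ∈ Cᶜ \ {x}, G.Adj v z}).ncard ≤ (G.neighborSet x \ C).ncard := by
  have hex : ∀ v ∈ C ∩ {v | ∃ z ∈ Cᶜ \ {x}, G.Adj v z}, ∃ y ∈ G.neighborSet x \ C,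
      ∃ z ∈ Cᶜ \ {x}, G.Adj v z ∧ y ∈ G.comp (Cᶜ \ {x}) z := by
    rintro v ⟨-, z, hz, hvz⟩
    obtain ⟨y, hy, hxy⟩ := h.exists_adj_comp hs hz
    exact ⟨y, ⟨hxy, (comp_subset hz hy).1⟩, z, hz, hvz, hy⟩
  have : Nonempty V := ⟨x⟩
  choose! f hf g hg hadj hmem using hex
  refine Set.ncard_le_ncard_of_injOn f hf (fun v hv v' hv' he => ?_)
  -- Two rim vertices with the same image are joined by an off-rim path and by a rim arc missing
  -- some third vertex `t`. This closes a core that avoids `x` and does not contain the rim.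
  by_contra hne
  obtain ⟨t, ht, htn⟩ : ∃ t ∈ C, t ∉ ({v, v'} : Set V) := by
    refine Set.exists_mem_notMem_of_ncard_lt_ncard ?_
    rw [Set.ncard_pair hne]
    exact h.core.two_lt_ncard
  simp only [Set.mem_insert_iff, Set.mem_singleton_iff, not_or] at htn
  set F₀ : Set V := Cᶜ \ {x} with hF₀
  have hsub := comp_subset (G := G) (hg v hv)
  have h1 : (G.within F₀).Reachable (g v) (g v') := (hmem v hv).trans (by
    rw [he]
    exact (hmem v' hv').symm)
  refine not_isForestOn_of_reachable (u := v) (w := g v) (S := F₀ ∪ C \ {t}) (hadj v hv)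
    (Or.inr ⟨hv.1, Ne.symm htn.1⟩) (Or.inl (hg v hv)) ?_ fun D hD hc => ?_
  · have hvF : v ∉ F₀ := fun h' => h'.1 hv.1
    have hgC : g v ∉ C := (hg v hv).1
    have r1 : ((G.deleteEdges {s(v, g v)}).within (F₀ ∪ C \ {t})).Reachable v v' := by
      refine reachable_of_adj_imp id (fun y z hyz => ?_) (h.connOn_sdiff ht v
        ⟨hv.1, Ne.symm htn.1⟩ v' ⟨hv'.1, Ne.symm htn.2⟩)
      refine Adj.reachable ⟨deleteEdges_adj.2 ⟨hyz.1, fun e => ?_⟩, Or.inr hyz.2.1, Or.inr hyz.2.2⟩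
      rcases Sym2.eq_iff.1 e with ⟨-, e⟩ | ⟨e, -⟩
      · exact hgC (e ▸ hyz.2.2.1)
      · exact hgC (e ▸ hyz.2.1.1)
    have r2 : ((G.deleteEdges {s(v, g v)}).within (F₀ ∪ C \ {t})).Reachable (g v) (g v') := by
      refine reachable_of_adj_imp id (fun y z hyz => ?_) h1
      refine Adj.reachable ⟨deleteEdges_adj.2 ⟨hyz.1, fun e => ?_⟩, Or.inl hyz.2.1, Or.inl hyz.2.2⟩
      rcases Sym2.eq_iff.1 e with ⟨e, -⟩ | ⟨-, e⟩
      · exact hvF (e ▸ hyz.2.1)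
      · exact hvF (e ▸ hyz.2.2)
    refine r1.trans (Reachable.trans (Adj.reachable ⟨deleteEdges_adj.2 ⟨hadj v' hv', fun e => ?_⟩,
      Or.inr ⟨hv'.1, Ne.symm htn.2⟩, Or.inl (hg v' hv')⟩) r2.symm)
    rcases Sym2.eq_iff.1 e with ⟨e, -⟩ | ⟨e, -⟩
    · exact hne e.symm
    · exact hgC (e ▸ hv'.1)
  · have hxD : x ∉ D := by
      intro hx
      rcases hD hx with h' | h'
      exacts [h'.2 rfl, h.notMem h'.1]
    rcases hD (h.minimal D hc hxD ht) with h' | h'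
    exacts [h'.1 ht, h'.2 rfl]

/-- All of `C` and at least one further vertex are neighbours of `x`, so `C` has at most four
vertices, and by `IsRim.ncard_le` few of them have neighbours beyond `C` and `x`. If `C` is a
triangle, at most two do, and `c`, `t` are the vertices other than one that does not. If `C` has
four vertices, at most one does; it is taken as `c`, with `t` opposite. -/
lemma IsRim.exists_isTwiceCovered [Finite V] (h : G.IsRim x C) (hs : G.CoreSaturated)
    (hdeg : (G.neighborSet x).ncard ≤ 5) (hne : (Cᶜ \ {x}).Nonempty) :
    ∃ c t, G.IsTwiceCovered x c t := by
  have hsub : C ⊆ G.neighborSet x := fun c hc => h.adj hs hc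
  have h1 := Set.ncard_sdiff_add_ncard_of_subset hsub
  have h2 : 0 < (G.neighborSet x \ C).ncard := by
    obtain ⟨z, hz⟩ := hne
    obtain ⟨y, hy, hxy⟩ := h.exists_adj_comp hs hz
    exact (Set.ncard_pos (Set.toFinite _)).2 ⟨y, hxy, (comp_subset hz hy).1⟩
  have h3 := h.core.two_lt_ncard
  have h4 := h.ncard_le hs
  set H : Set V := {v | ∃ z ∈ Cᶜ \ {x}, G.Adj v z} with hH
  have hN : ∀ v ∉ H, ∀ y, G.Adj v y → y = x ∨ y ∈ C := by
    intro v hv y hvy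
    by_contra hcon
    rw [not_or] at hcon
    exact hv (Set.mem_ofPred.2 ⟨y, ⟨hcon.2, hcon.1⟩, hvy⟩)
  obtain h3 | h3 : C.ncard = 3 ∨ C.ncard = 4 := by omega
  · obtain ⟨b, hb, hbH⟩ : ∃ b ∈ C, b ∉ C ∩ H := Set.exists_mem_notMem_of_ncard_lt_ncard (by omega)
    have h5 := Set.ncard_sdiff_singleton_of_mem hb
    obtain ⟨c, t, hct, heq⟩ := Set.ncard_eq_two.1 (show (C \ {b}).ncard = 2 by omega)
    have hmem : ∀ v, v ∈ C \ {b} ↔ v = c ∨ v = t := fun v => by rw [heq]; rfl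
    refine ⟨c, t, h.isTwiceCovered ((hmem c).2 (Or.inl rfl)).1 ((hmem t).2 (Or.inr rfl)).1 hct
      fun v hv hvc hvt y hvy => ?_⟩
    have hvb : v = b := by
      by_contra hvb
      rcases (hmem v).1 ⟨hv, hvb⟩ with e | e
      exacts [hvc e, hvt e]
    subst hvb
    rcases hN v (fun h' => hbH ⟨hv, h'⟩) y hvy with e | hy
    · exact Or.inl e
    · exact Or.inr ((hmem y).1 ⟨hy, hvy.ne.symm⟩)
  · obtain ⟨c, hc, hcH⟩ : ∃ c ∈ C, ∀ v ∈ C, v ∈ H → v = c := by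
      by_cases hem : (C ∩ H).Nonempty
      · obtain ⟨c, hc⟩ := hem
        refine ⟨c, hc.1, fun v hv hvH => ?_⟩
        exact (Set.ncard_le_one (Set.toFinite (C ∩ H))).1 (by omega) v ⟨hv, hvH⟩ c hc
      · obtain ⟨c, hc⟩ := h.core.1
        exact ⟨c, hc, fun v hv hvH => absurd ⟨v, hv, hvH⟩ hem⟩
    obtain ⟨r, hr, s, hs', hrs, hcr, hcs⟩ := h.core.2 c hc
    have hnrs : ¬ G.Adj r s := by
      intro hrs'
      have h6 := h.eq_of_subset (isCore_triple hcr hrs' hcs) (by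
        rintro y (rfl | rfl | rfl) <;> assumption)
      have h7 : ({c, r, s} : Set V).ncard ≤ 3 := by
        have e1 := Set.ncard_insert_le c ({r, s} : Set V)
        rw [Set.ncard_pair hrs] at e1
        omega
      rw [h6] at h7
      omega
    have h8 : ({c, r, s} : Set V).ncard = 3 := by
      rw [Set.ncard_insert_of_notMem (by simp [hcr.ne, hcs.ne]), Set.ncard_pair hrs]
    have h9 := Set.ncard_sdiff_add_ncard_of_subset (s := ({c, r, s} : Set V)) (t := C) (by
      rintro y (rfl | rfl | rfl) <;> assumption)
    obtain ⟨t, heq⟩ := Set.ncard_eq_one.1 (show (C \ {c, r, s}).ncard = 1 by omega)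
    have hmem : ∀ v, v ∈ C \ {c, r, s} ↔ v = t := fun v => by rw [heq]; rfl
    have ht := (hmem t).2 rfl
    refine ⟨c, t, h.isTwiceCovered hc ht.1 (fun e => ht.2 (Or.inl e.symm))
      fun v hv hvc hvt y hvy => ?_⟩
    rcases hN v (fun h' => hvc (hcH v hv h')) y hvy with e | hy
    · exact Or.inl e
    refine Or.inr ?_
    by_contra hcon
    rw [not_or] at hcon
    have hrs₂ : ∀ z ∈ C, z ≠ c → z ≠ t → z = r ∨ z = s := by
      intro z hz hzc hzt
      by_contra hcon
      rw [not_or] at hcon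
      exact hzt ((hmem z).1 ⟨hz, by simp [hzc, hcon.1, hcon.2]⟩)
    rcases hrs₂ v hv hvc hvt with rfl | rfl <;> rcases hrs₂ y hy hcon.1 hcon.2 with rfl | rfl
    exacts [hvy.ne rfl, hnrs hvy, hnrs hvy.symm, hvy.ne rfl]

lemma ncard_neighborSet_add_one_le [Finite V] (x : V) :
    (G.neighborSet x).ncard + 1 ≤ Nat.card V := by
  have h1 := Set.ncard_add_ncard_compl ({x} : Set V)
  rw [Set.ncard_singleton] at h1
  have h2 : (G.neighborSet x).ncard ≤ ({x}ᶜ : Set V).ncard :=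
    Set.ncard_le_ncard fun v h => Adj.ne' h
  omega

/-- The possible sizes of a saturated graph on at least six vertices. -/
theorem CoreSaturated.ncard_edgeSet [Finite V] (hs : G.CoreSaturated) (hV : 6 ≤ Nat.card V) :
    (∃ k, 3 ≤ k ∧ k + 3 ≤ Nat.card V ∧ G.edgeSet.ncard = Nat.card V + 2 * k) ∨
      G.edgeSet.ncard = Nat.card V + 5 ∨
      (G.edgeSet.ncard + 2 ≤ 2 * Nat.card V ∧ Nat.card V + 4 ≤ G.edgeSet.ncard ∧
        (7 ≤ Nat.card V → Nat.card V + 5 ≤ G.edgeSet.ncard)) := by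
  by_cases hcov : ∀ u w, ¬ G.IsForestOn (Set.univ \ {u, w})
  · have : Nonempty V := (Nat.card_pos_iff.1 (by omega)).1
    have := edgeCount_of_forall_not_isForestOn Set.univ_nonempty hs.connOn_univ hs.1 hcov
    rw [edgeCount_univ, Set.ncard_univ] at this
    exact Or.inr (Or.inl this)
  obtain ⟨u, w, hF⟩ : ∃ u w, G.IsForestOn {u, w}ᶜ := by
    push Not at hcov
    simpa only [← Set.compl_eq_univ_sdiff] using hcov
  have hor : (∃ a b c, G.IsTwiceCovered a b c) ∨ ∃ x w p, G.IsAlmostForest x w p := by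
    by_cases huw : u = w
    · subst huw
      rw [Set.pair_eq_singleton] at hF
      exact Or.inr ⟨u, u, u, hF.isAlmostForest u u⟩
    · exact isTwiceCovered_or_isAlmostForest hs.1 huw hF
  obtain ⟨a, b, c, h⟩ | ⟨x, w, p, h⟩ := hor
  · exact Or.inl (h.exists_ncard_edgeSet hs (by omega))
  by_cases hf : G.IsForestOn {x}ᶜ
  · have := hf.ncard_edgeSet_of_coreSaturated hs (by omega)
    omega
  obtain ⟨C, hC⟩ := h.exists_isRim hs.1 hf
  have h1 := hC.ncard_edgeSet hs h
  have h2 := ncard_neighborSet_add_one_le (G := G) x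
  by_cases hne : (Cᶜ \ {x}).Nonempty
  · by_cases hdeg : (G.neighborSet x).ncard ≤ 5
    · obtain ⟨c, t, h'⟩ := hC.exists_isTwiceCovered hs hdeg hne
      exact Or.inl (h'.exists_ncard_edgeSet hs (by omega))
    · omega
  -- Here everything except `x` is on the rim, and the size is `2 * Nat.card V - 2`. For six
  -- vertices this is the single value below `Nat.card V + 5`.
  · have h3 : ({x}ᶜ : Set V).ncard ≤ (G.neighborSet x).ncard := by
      refine Set.ncard_le_ncard fun v hv => hC.adj hs ?_
      by_contra hvC
      exact hne ⟨v, hvC, hv⟩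
    have h4 := Set.ncard_add_ncard_compl ({x} : Set V)
    rw [Set.ncard_singleton] at h4
    omega

/-! ### Constructions -/

lemma IsTwiceCovered.noDisjointCores (h : G.IsTwiceCovered a b c) :
    G.NoDisjointCores Set.univ := by
  intro D _ E _ hD hE hdis
  have hd : ∀ x ∈ D, x ∉ E := fun x hx => Set.disjoint_left.1 hdis hx
  by_cases ha : a ∈ D
  · have h1 := h.rotate.mem_both hE (hd a ha)
    exact hd b (h.rotate.mem_left hD fun hc => hd c hc h1.2) h1.1
  · have h1 := h.rotate.mem_both hD ha
    exact hd b h1.1 (h.rotate.mem_left hE (hd c h1.2))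

/-- Of two disjoint cores one avoids `x`, hence contains `C`, and leaves the other inside a forest.
-/
lemma IsRim.noDisjointCores (h : G.IsRim x C) : G.NoDisjointCores Set.univ := by
  have key : ∀ D E, G.IsCore D → G.IsCore E → x ∉ D → ¬ Disjoint D E := fun D E hD hE hx hdis =>
    h.compl E (fun y hy hyC => Set.disjoint_left.1 hdis (h.minimal D hD hx hyC) hy) hE
  intro D _ E _ hD hE hdis
  by_cases hx : x ∈ D
  · exact key E D hE hD (Set.disjoint_left.1 hdis hx) hdis.symm
  · exact key D E hD hE hx hdis

lemma coreSaturated_of_lt [LinearOrder V] (h : G.NoDisjointCores Set.univ)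
    (hs : ∀ u v, u < v → ¬ G.Adj u v → ∃ D E, (G ⊔ edge u v).IsCore D ∧ G.IsCore E ∧
      ∀ x ∈ D, x ∉ E) : G.CoreSaturated := by
  refine ⟨h, fun u v huv hadj hno => ?_⟩
  wlog hlt : u < v generalizing u v
  · exact this v u huv.symm (fun h' => hadj h'.symm) (edge_comm u v ▸ hno)
      (lt_of_le_of_ne (not_lt.1 hlt) huv.symm)
  obtain ⟨D, E, hD, hE, hd⟩ := hs u v hlt hadj
  exact hno.false_of_disjoint hD (hE.mono le_sup_left) (Set.subset_univ _) (Set.subset_univ _) hd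

/-- The join of a triangle with `t` independent vertices, with pendant vertices at one of the
latter. -/
def triangleJoin (n t : ℕ) : SimpleGraph (Fin n) :=
  fromRel fun i j => i.1 < j.1 ∧ (i.1 ≤ 2 ∧ j.1 ≤ t + 2 ∨ i.1 = 3 ∧ t + 3 ≤ j.1)

lemma triangleJoin_adj {n t : ℕ} {i j : Fin n} : (triangleJoin n t).Adj i j ↔
    (i.1 < j.1 ∧ (i.1 ≤ 2 ∧ j.1 ≤ t + 2 ∨ i.1 = 3 ∧ t + 3 ≤ j.1)) ∨
      (j.1 < i.1 ∧ (j.1 ≤ 2 ∧ i.1 ≤ t + 2 ∨ j.1 = 3 ∧ t + 3 ≤ i.1)) := by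
  rw [triangleJoin, fromRel_adj, Ne, Fin.ext_iff]
  omega

/-- The pendant vertices are in no core. Of what remains off `a` and `b`, only a star centred at `c`
is left. -/
lemma isForestOn_triangleJoin {n t : ℕ} {a b c : Fin n} (ht : 1 ≤ t) (ha : a.1 ≤ 2) (hb : b.1 ≤ 2)
    (hc : c.1 ≤ 2) (hab : a ≠ b) (hac : a ≠ c) (hbc : b ≠ c) :
    (triangleJoin n t).IsForestOn {a, b}ᶜ := by
  intro D hD hcore
  rw [Ne, Fin.ext_iff] at hab hac hbc
  have hnot : ∀ y ∈ D, y.1 ≠ a.1 ∧ y.1 ≠ b.1 := fun y hy =>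
    ⟨fun h => hD hy (Or.inl (Fin.ext h)), fun h => hD hy (Or.inr (Fin.ext h))⟩
  have h1 : ∀ x ∈ D, x.1 ≤ t + 2 := by
    intro x hx
    by_contra hlt
    have h3 : 3 < n := by omega
    refine hcore.notMem_of_unique (x := x) (w := ⟨3, h3⟩) (fun y hy h => ?_) hx
    rw [triangleJoin_adj] at h
    exact Fin.ext (by simp only; omega)
  have h2 : ∀ x ∈ D, x = c := by
    intro x hx
    by_contra hxc
    rw [Fin.ext_iff] at hxc
    refine hcore.notMem_of_unique (x := x) (w := c) (fun y hy h => ?_) hx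
    have := h1 y hy
    have := h1 x hx
    have := hnot x hx
    have := hnot y hy
    rw [triangleJoin_adj] at h
    exact Fin.ext (by omega)
  obtain ⟨x, hx⟩ := hcore.1
  obtain ⟨y, hy, z, hz, hyz, -⟩ := hcore.2 x hx
  exact hyz ((h2 y hy).trans (h2 z hz).symm)

lemma isTwiceCovered_triangleJoin {n t : ℕ} (ht : 1 ≤ t) (hn : 3 ≤ n) :
    (triangleJoin n t).IsTwiceCovered ⟨0, by omega⟩ ⟨1, by omega⟩ ⟨2, by omega⟩ := by
  have h01 : (⟨0, by omega⟩ : Fin n) ≠ ⟨1, by omega⟩ := by simp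
  have h02 : (⟨0, by omega⟩ : Fin n) ≠ ⟨2, by omega⟩ := by simp
  have h12 : (⟨1, by omega⟩ : Fin n) ≠ ⟨2, by omega⟩ := by simp
  exact ⟨h01, h02, h12,
    isForestOn_triangleJoin ht (by simp) (by simp) (c := ⟨2, by omega⟩) (by simp) h01 h02 h12,
    isForestOn_triangleJoin ht (by simp) (by simp) (c := ⟨1, by omega⟩) (by simp) h02 h01 h12.symm,
    isForestOn_triangleJoin ht (by simp) (by simp) (c := ⟨0, by omega⟩) (by simp) h12 h01.symm
      h02.symm⟩

/-- The new edge closes a triangle or a 4-cycle that uses at most one of `0, 1, 2`; the other two,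
with an unused independent vertex `s`, form a disjoint triangle. For two pendant vertices the
triangle `0, 1, 2` itself is free. The bound `3 ≤ t` ensures that `s` exists. -/
lemma coreSaturated_triangleJoin {n t : ℕ} (ht : 3 ≤ t) (hn : t + 3 ≤ n) :
    (triangleJoin n t).CoreSaturated := by
  refine coreSaturated_of_lt (isTwiceCovered_triangleJoin (by omega) (by omega)).noDisjointCores
    fun u v huv hadj => ?_
  rw [triangleJoin_adj] at hadj
  have huv' : u.1 < v.1 := huv
  have hle : ∀ i j : Fin n, (i.1 < j.1 ∧ (i.1 ≤ 2 ∧ j.1 ≤ t + 2 ∨ i.1 = 3 ∧ t + 3 ≤ j.1)) ∨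
      (j.1 < i.1 ∧ (j.1 ≤ 2 ∧ i.1 ≤ t + 2 ∨ j.1 = 3 ∧ t + 3 ≤ i.1)) →
      (triangleJoin n t).Adj i j := fun i j => triangleJoin_adj.2
  have hnew : (triangleJoin n t ⊔ edge u v).Adj u v :=
    Or.inr ((edge_adj ..).2 ⟨Or.inl ⟨rfl, rfl⟩, huv.ne⟩)
  have key : ∀ b c s : Fin n, b.1 ≤ 2 → c.1 ≤ 2 → b.1 ≠ c.1 → 3 ≤ s.1 → s.1 ≤ t + 2 →
      (triangleJoin n t).IsCore {b, c, s} := fun b c s hb hc hbc hs hs' =>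
    isCore_triple (hle _ _ (by omega)) (hle _ _ (by omega)) (hle _ _ (by omega))
  have h0 : 0 < n := by omega
  have h1 : 1 < n := by omega
  have h2 : 2 < n := by omega
  have h3 : 3 < n := by omega
  have h4 : 4 < n := by omega
  have h5 : 5 < n := by omega
  by_cases hu : u.1 ≤ 2
  · obtain ⟨b, c, hb, hc, hbc, hbu, hcu⟩ : ∃ b c : Fin n, b.1 ≤ 2 ∧ c.1 ≤ 2 ∧ b.1 ≠ c.1 ∧
        b.1 ≠ u.1 ∧ c.1 ≠ u.1 := by
      obtain h | h | h : u.1 = 0 ∨ u.1 = 1 ∨ u.1 = 2 := by omega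
      exacts [⟨⟨1, h1⟩, ⟨2, h2⟩, by simp [h]⟩,
        ⟨⟨0, h0⟩, ⟨2, h2⟩, by simp [h]⟩, ⟨⟨0, h0⟩, ⟨1, h1⟩, by simp [h]⟩]
    refine ⟨{u, v, ⟨3, h3⟩}, {b, c, ⟨4, h4⟩}, isCore_triple hnew
      (Or.inl (hle _ _ (by simp only [true_and]; omega)))
      (Or.inl (hle _ _ (by simp only [true_and]; omega))),
      key _ _ _ hb hc hbc (by simp) (by simp only; omega), ?_⟩
    simp only [Set.mem_insert_iff, Set.mem_singleton_iff, Fin.ext_iff]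
    omega
  by_cases hu' : u.1 ≤ t + 2
  · by_cases hv : v.1 ≤ t + 2
    · obtain ⟨s, hs, hs', hsu, hsv⟩ : ∃ s : Fin n, 3 ≤ s.1 ∧ s.1 ≤ t + 2 ∧ s.1 ≠ u.1 ∧
          s.1 ≠ v.1 := by
        obtain h | h | h : (3 ≠ u.1 ∧ 3 ≠ v.1) ∨ (4 ≠ u.1 ∧ 4 ≠ v.1) ∨ (5 ≠ u.1 ∧ 5 ≠ v.1) := by
          omega
        exacts [⟨⟨3, h3⟩, by simp only; omega⟩, ⟨⟨4, h4⟩, by simp only; omega⟩,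
          ⟨⟨5, h5⟩, by simp only; omega⟩]
      refine ⟨{u, v, ⟨0, h0⟩}, {⟨1, h1⟩, ⟨2, h2⟩, s}, isCore_triple hnew
        (Or.inl (hle _ _ (by simp only; omega))) (Or.inl (hle _ _ (by simp only; omega))),
        key _ _ _ (by simp) (by simp) (by simp) hs hs', ?_⟩
      simp only [Set.mem_insert_iff, Set.mem_singleton_iff, Fin.ext_iff]
      omega
    · obtain ⟨s, hs, hs', hsu⟩ : ∃ s : Fin n, 4 ≤ s.1 ∧ s.1 ≤ t + 2 ∧ s.1 ≠ u.1 := by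
        obtain h | h : 4 ≠ u.1 ∨ 5 ≠ u.1 := by omega
        exacts [⟨⟨4, h4⟩, by simp only; omega⟩, ⟨⟨5, h5⟩, by simp only; omega⟩]
      refine ⟨{u, v, ⟨3, h3⟩, ⟨0, h0⟩}, {⟨1, h1⟩, ⟨2, h2⟩, s},
        isCore_quadruple hnew (Or.inl (hle _ _ (by simp only [true_and]; omega)))
          (Or.inl (hle _ _ (by simp only; omega))) (Or.inl (hle _ _ (by simp only; omega)))
          (by rw [Ne, Fin.ext_iff]; simp only; omega) (by rw [Ne, Fin.ext_iff]; simp only; omega),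
        key _ _ _ (by simp) (by simp) (by simp) (by omega) hs', ?_⟩
      simp only [Set.mem_insert_iff, Set.mem_singleton_iff, Fin.ext_iff]
      omega
  · refine ⟨{u, v, ⟨3, h3⟩}, {⟨0, h0⟩, ⟨1, h1⟩, ⟨2, h2⟩},
      isCore_triple hnew (Or.inl (hle _ _ (by simp only [true_and]; omega)))
        (Or.inl (hle _ _ (by simp only [true_and]; omega))),
      isCore_triple (hle _ _ (by simp only; omega)) (hle _ _ (by simp only; omega))
        (hle _ _ (by simp only; omega)), ?_⟩
    simp only [Set.mem_insert_iff, Set.mem_singleton_iff, Fin.ext_iff]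
    omega

lemma ncard_edgeSet_triangleJoin {n t : ℕ} (ht : 3 ≤ t) (hn : t + 3 ≤ n) :
    (triangleJoin n t).edgeSet.ncard = n + 2 * t := by
  have h := ((isTwiceCovered_triangleJoin (t := t) (by omega) (by omega)).ncard_edgeSet
    (coreSaturated_triangleJoin ht hn)).1
  rw [Nat.card_fin] at h
  rw [h]
  congr 2
  have : Set.ncard (Fin.val '' ((triangleJoin n t).neighborSet ⟨0, by omega⟩ ∩
      {⟨0, by omega⟩, ⟨1, by omega⟩, ⟨2, by omega⟩}ᶜ)) = t := by
    have he : (Finset.Ico 3 (t + 3) : Set ℕ) = Fin.val '' ((triangleJoin n t).neighborSet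
        ⟨0, by omega⟩ ∩ {⟨0, by omega⟩, ⟨1, by omega⟩, ⟨2, by omega⟩}ᶜ) := by
      ext k
      simp only [Finset.coe_Ico, Set.mem_Ico, Set.mem_image, Set.mem_inter_iff, mem_neighborSet,
        triangleJoin_adj, Set.mem_compl_iff, Set.mem_insert_iff, Set.mem_singleton_iff,
        Fin.ext_iff]
      constructor
      · intro hk
        exact ⟨⟨k, by omega⟩, by simp only; omega, rfl⟩
      · rintro ⟨i, hi, rfl⟩
        omega
    rw [← he, Set.ncard_coe_finset, Nat.card_Ico]
    omega
  rwa [Set.ncard_image_of_injective _ Fin.val_injective] at this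

/-- The wheel with rim `0, …, r - 1` and hub `r`, with a triangle `0, r, r + 1` at a spoke and
pendant vertices at `r + 1`. -/
def wheelTail (n r : ℕ) : SimpleGraph (Fin n) :=
  fromRel fun i j => i.1 < j.1 ∧ (j.1 = r ∨ j.1 < r ∧ (j.1 = i.1 + 1 ∨ i.1 = 0 ∧ j.1 + 1 = r) ∨
    j.1 = r + 1 ∧ (i.1 = 0 ∨ i.1 = r) ∨ i.1 = r + 1)

lemma wheelTail_adj {n r : ℕ} {i j : Fin n} : (wheelTail n r).Adj i j ↔
    (i.1 < j.1 ∧ (j.1 = r ∨ j.1 < r ∧ (j.1 = i.1 + 1 ∨ i.1 = 0 ∧ j.1 + 1 = r) ∨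
      j.1 = r + 1 ∧ (i.1 = 0 ∨ i.1 = r) ∨ i.1 = r + 1)) ∨
    (j.1 < i.1 ∧ (i.1 = r ∨ i.1 < r ∧ (i.1 = j.1 + 1 ∨ j.1 = 0 ∧ i.1 + 1 = r) ∨
      i.1 = r + 1 ∧ (j.1 = 0 ∨ j.1 = r) ∨ j.1 = r + 1)) := by
  rw [wheelTail, fromRel_adj, Ne, Fin.ext_iff]
  omega

/-- Describes a core by arithmetic: `f` and `g` name the two neighbours of each vertex on a cycle,
which reduces the verification to `omega`. -/
lemma isCore_of_forall_exists {n : ℕ} {G : SimpleGraph (Fin n)} (P : ℕ → Prop) {i₀ : ℕ}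
    (hi₀ : i₀ < n) (h₀ : P i₀) (f g : ℕ → ℕ)
    (h : ∀ i : Fin n, P i → ∃ (hf : f i < n) (hg : g i < n), P (f i) ∧ P (g i) ∧ f i ≠ g i ∧
      G.Adj i ⟨f i, hf⟩ ∧ G.Adj i ⟨g i, hg⟩) : G.IsCore {i | P i.1} := by
  refine ⟨⟨⟨i₀, hi₀⟩, h₀⟩, fun i hi => ?_⟩
  obtain ⟨hf, hg, h1, h2, hne, h3, h4⟩ := h i hi
  exact ⟨_, h1, _, h2, fun he => hne (Fin.ext_iff.1 he), h3, h4⟩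

lemma isCore_rim {n r : ℕ} (hr : 5 ≤ r) (hn : r + 1 ≤ n) :
    (wheelTail n r).IsCore {i | i.1 < r} := by
  refine isCore_of_forall_exists (fun i => i < r) (i₀ := 0) (by omega) (by omega)
    (fun i => if i + 1 = r then 0 else i + 1) (fun i => if i = 0 then r - 1 else i - 1)
    fun i hi => ?_
  simp only [wheelTail_adj]
  refine ⟨?_, ?_, ?_, ?_, ?_, ?_, ?_⟩ <;> split_ifs <;> omega

/-- Without the hub, first the pendant vertices and then `r + 1` drop out of any core; what is left
lives on the rim cycle and must be all of it. Without the rim, only a star around `r + 1` remains.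
-/
lemma isRim_wheelTail {n r : ℕ} (hr : 5 ≤ r) (hn : r + 1 ≤ n) :
    (wheelTail n r).IsRim ⟨r, hn⟩ {i | i.1 < r} := by
  refine ⟨isCore_rim hr hn, lt_irrefl r, fun D hD hrD => ?_, fun D hD hc => ?_⟩
  · have hne : ∀ y ∈ D, y.1 ≠ r := fun y hy e => hrD (by convert hy using 1; exact Fin.ext e.symm)
    have h1 : ∀ y ∈ D, y.1 < r + 2 := by
      intro y hy
      by_contra hlt
      have h2 : r + 1 < n := by omega
      refine hD.notMem_of_unique (x := y) (w := ⟨r + 1, h2⟩) (fun z hz h => ?_) hy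
      rw [wheelTail_adj] at h
      have := hne z hz
      exact Fin.ext (by simp only; omega)
    have h2 : ∀ y ∈ D, y.1 < r := by
      intro y hy
      by_contra hlt
      have h0 : 0 < n := by omega
      refine hD.notMem_of_unique (x := y) (w := ⟨0, h0⟩) (fun z hz h => ?_) hy
      rw [wheelTail_adj] at h
      have := hne z hz
      have := hne y hy
      have := h1 y hy
      have := h1 z hz
      exact Fin.ext (by simp only; omega)
    have h0 : (⟨0, by omega⟩ : Fin n) ∈ D := by
      obtain ⟨m, hm, hmin⟩ := Set.exists_min_image D Fin.val (Set.toFinite _) hD.1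
      by_contra h0
      have hm0 : m.1 ≠ 0 := fun e => h0 (by convert hm using 1; exact Fin.ext e.symm)
      refine hD.notMem_of_unique (x := m) (w := ⟨m.1 + 1, by have := h2 m hm; omega⟩)
        (fun z hz h => ?_) hm
      have := hmin z hz
      have := h2 z hz
      have := h2 m hm
      have hz0 : z.1 ≠ 0 := by omega
      rw [wheelTail_adj] at h
      exact Fin.ext (by simp only; omega)
    have key : ∀ k, ∀ hk : k < n, k < r → (⟨k, hk⟩ : Fin n) ∈ D := by
      intro k
      induction k with
      | zero => exact fun _ _ => h0
      | succ k ih =>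
        intro hk hkr
        -- A core neighbour of `k` other than its predecessor on the rim, which is `r - 1` for `k =
        -- 0`, can only be `k + 1`.
        obtain ⟨z, hz, hzne, hadj⟩ := hD.exists_adj_ne (ih (by omega) (by omega))
          ⟨if k = 0 then r - 1 else k - 1, by split_ifs <;> omega⟩
        rw [Ne, Fin.ext_iff] at hzne
        rw [wheelTail_adj] at hadj
        have := h2 z hz
        convert hz using 1
        refine Fin.ext ?_
        simp only at hzne hadj ⊢
        split_ifs at hzne <;> omega
    exact fun i hi => key i.1 i.2 hi
  · have h0 : ∀ y ∈ D, r ≤ y.1 := fun y hy => not_lt.1 (hD hy)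
    have h1 : ∀ y ∈ D, y.1 = r + 1 := by
      intro y hy
      by_contra hne
      have hrn : r + 1 < n := by
        obtain ⟨z, hz, hzy, -⟩ := hc.exists_adj_ne hy y
        rw [Ne, Fin.ext_iff] at hzy
        have := h0 z hz
        have := h0 y hy
        omega
      refine hc.notMem_of_unique (x := y) (w := ⟨r + 1, hrn⟩) (fun z hz h => ?_) hy
      have := h0 z hz
      have := h0 y hy
      rw [wheelTail_adj] at h
      exact Fin.ext (by simp only; omega)
    obtain ⟨y, hy⟩ := hc.1
    obtain ⟨z, hz, hzy, -⟩ := hc.exists_adj_ne hy y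
    exact hzy (Fin.ext ((h1 z hz).trans (h1 y hy).symm))

/-- A core off the hub contains the whole rim, but without the edge `0 1` the vertex `1` keeps only
the neighbour `2` there. -/
lemma isAlmostForest_wheelTail {n r : ℕ} (hr : 5 ≤ r) (hn : r + 1 ≤ n) :
    (wheelTail n r).IsAlmostForest ⟨r, hn⟩ ⟨0, by omega⟩ ⟨1, by omega⟩ := by
  intro D hD hc
  have hrD : (⟨r, hn⟩ : Fin n) ∉ D := fun h => hD h rfl
  have h0 := (isRim_wheelTail hr hn).minimal D (hc.mono (deleteEdges_le _)) hrD
  have h1 : (⟨1, by omega⟩ : Fin n) ∈ D := h0 (show 1 < r by omega)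
  refine hc.notMem_of_unique (w := ⟨2, by omega⟩) (fun z hz h => ?_) h1
  rw [deleteEdges_adj, wheelTail_adj] at h
  have hz0 : z.1 ≠ 0 := fun e => h.2 (Sym2.eq_iff.2 (Or.inr ⟨rfl, Fin.ext e⟩))
  have hzr : z.1 ≠ r := fun e => hrD (by convert hz using 1; exact Fin.ext e.symm)
  have h2 := h.1
  simp only at h2
  exact Fin.ext (by simp only; omega)

lemma wheelTail_sup_edge_adj {n r : ℕ} {u v i j : Fin n} (huv : u < v)
    (h : (wheelTail n r).Adj i j ∨ (i.1 = u.1 ∧ j.1 = v.1) ∨ (i.1 = v.1 ∧ j.1 = u.1)) :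
    (wheelTail n r ⊔ edge u v).Adj i j := by
  rcases h with h | ⟨h1, h2⟩ | ⟨h1, h2⟩
  · exact Or.inl h
  · rw [Fin.ext h1, Fin.ext h2]
    exact Or.inr ((edge_adj ..).2 ⟨Or.inl ⟨rfl, rfl⟩, huv.ne⟩)
  · rw [Fin.ext h1, Fin.ext h2]
    exact Or.inr ((edge_adj ..).2 ⟨Or.inr ⟨rfl, rfl⟩, huv.ne'⟩)

lemma isCore_spoke_triangle {n r : ℕ} (hn : r < n) {i j : Fin n} (hi : i.1 < r) (hj : j.1 < r)
    (hij : j.1 = i.1 + 1 ∨ i.1 = 0 ∧ j.1 + 1 = r) (h2 : i.1 ≠ j.1) :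
    (wheelTail n r).IsCore {⟨r, hn⟩, i, j} := by
  refine isCore_triple (wheelTail_adj.2 ?_) (wheelTail_adj.2 ?_) (wheelTail_adj.2 ?_) <;>
    (try simp only [true_or, or_true, and_true]) <;> omega

/-- Adding a chord of the rim. -/
lemma exists_cores_wheelTail_chord {n r : ℕ} (hr : 5 ≤ r) (hn : r + 1 ≤ n) {u v : Fin n}
    (huv : u.1 + 2 ≤ v.1) (hv : v.1 < r) (hw : ¬ (u.1 = 0 ∧ v.1 + 1 = r)) :
    ∃ D E, (wheelTail n r ⊔ edge u v).IsCore D ∧ (wheelTail n r).IsCore E ∧ ∀ x ∈ D, x ∉ E := by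
  have hlt : u < v := show u.1 < v.1 by omega
  have hu1 : u.1 + 1 < n := by omega
  have h0 : 0 < n := by omega
  have h1 : 1 < n := by omega
  -- A long chord closes the outer arc and leaves `u + 1`, `u + 2` for a triangle with the hub. A
  -- chord with `v = u + 2` closes a triangle with `u + 1`, and as `5 ≤ r` two consecutive rim
  -- vertices remain for the hub.
  by_cases h3 : u.1 + 3 ≤ v.1
  · have hu2 : u.1 + 2 < n := by omega
    refine ⟨_, _, isCore_of_forall_exists (fun i => i < r ∧ (i ≤ u.1 ∨ v.1 ≤ i)) (i₀ := u.1) u.2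
      (by omega) (fun i => if i = u.1 then v.1 else if i + 1 = r then 0 else i + 1)
      (fun i => if i = v.1 then u.1 else if i = 0 then r - 1 else i - 1) fun i hi => ?_,
      isCore_spoke_triangle (i := ⟨u.1 + 1, hu1⟩) (j := ⟨u.1 + 2, hu2⟩) hn (by simp only; omega)
        (by simp only; omega) (Or.inl rfl) (by simp), ?_⟩
    · refine ⟨?_, ?_, ?_, ?_, ?_, wheelTail_sup_edge_adj hlt ?_, wheelTail_sup_edge_adj hlt ?_⟩ <;>
        (try simp only [wheelTail_adj]) <;> split_ifs <;> omega
    · simp only [Set.mem_ofPred, Set.mem_insert_iff, Set.mem_singleton_iff, Fin.ext_iff]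
      omega
  · have hD : (wheelTail n r ⊔ edge u v).IsCore {u, v, ⟨u.1 + 1, hu1⟩} := by
      refine isCore_triple (wheelTail_sup_edge_adj hlt ?_) (wheelTail_sup_edge_adj hlt ?_)
        (wheelTail_sup_edge_adj hlt ?_) <;> simp only [wheelTail_adj, true_or, or_true, true_and, and_true] <;> omega
    obtain ⟨i, j, hi, hj, hij, hne, hiu, hju⟩ : ∃ i j : Fin n, i.1 < r ∧ j.1 < r ∧
        (j.1 = i.1 + 1 ∨ i.1 = 0 ∧ j.1 + 1 = r) ∧ i.1 ≠ j.1 ∧ (i.1 < u.1 ∨ u.1 + 2 < i.1) ∧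
        (j.1 < u.1 ∨ u.1 + 2 < j.1) := by
      by_cases hv2 : v.1 + 2 < r
      · exact ⟨⟨v.1 + 1, by omega⟩, ⟨v.1 + 2, by omega⟩, by simp only [true_or, true_and]; omega⟩
      by_cases hv3 : v.1 + 1 < r
      · exact ⟨⟨0, by omega⟩, ⟨r - 1, by omega⟩, by simp only [true_and]; omega⟩
      · exact ⟨⟨0, by omega⟩, ⟨1, by omega⟩, by simp only [zero_add, true_or, true_and]; omega⟩
    refine ⟨_, _, hD, isCore_spoke_triangle hn hi hj hij hne, ?_⟩
    simp only [Set.mem_insert_iff, Set.mem_singleton_iff, Fin.ext_iff]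
    omega

/-- Adding an edge between the rim and the tail. -/
lemma exists_cores_wheelTail_tail {n r : ℕ} (hr : 5 ≤ r) {u v : Fin n} (hu : u.1 < r)
    (hv : r + 1 ≤ v.1) (hw : ¬ (u.1 = 0 ∧ v.1 = r + 1)) :
    ∃ D E, (wheelTail n r ⊔ edge u v).IsCore D ∧ (wheelTail n r).IsCore E ∧ ∀ x ∈ D, x ∉ E := by
  have hlt : u < v := show u.1 < v.1 by omega
  have hn : r < n := by omega
  have hu1 : u.1 + 1 < n := by omega
  have hu2 : u.1 + 2 < n := by omega
  have h1 : 1 < n := by omega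
  have h2 : 2 < n := by omega
  -- The new cycle runs from `u` along the rim to `0`, then through `r + 1` and `v`. It takes the
  -- arc downwards if `u + 1`, `u + 2` are free for a hub triangle, otherwise the arc upwards,
  -- leaving `1`, `2`. The nested `if`s cover the case `v = r + 1`.
  by_cases h3 : u.1 + 3 ≤ r
  · refine ⟨_, _, isCore_of_forall_exists (fun i => i ≤ u.1 ∨ i = r + 1 ∨ i = v.1) (i₀ := u.1)
      u.2 (by omega)
      (fun i => if i = v.1 then u.1 else if i = u.1 then v.1 else if i = r + 1 then 0 else i + 1)
      (fun i => if i = v.1 then (if v.1 = r + 1 then 0 else r + 1) else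
        if i = r + 1 then v.1 else if i = 0 then r + 1 else i - 1) fun i hi => ?_,
      isCore_spoke_triangle (i := ⟨u.1 + 1, hu1⟩) (j := ⟨u.1 + 2, hu2⟩) hn (by simp only; omega)
        (by simp only; omega) (Or.inl rfl) (by simp), ?_⟩
    · refine ⟨?_, ?_, ?_, ?_, ?_, wheelTail_sup_edge_adj hlt ?_, wheelTail_sup_edge_adj hlt ?_⟩ <;>
        (try simp only [wheelTail_adj]) <;> split_ifs <;> omega
    · simp only [Set.mem_ofPred, Set.mem_insert_iff, Set.mem_singleton_iff, Fin.ext_iff]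
      omega
  · refine ⟨_, _, isCore_of_forall_exists
      (fun i => i = 0 ∨ (u.1 ≤ i ∧ i < r) ∨ i = r + 1 ∨ i = v.1) (i₀ := u.1) u.2 (by omega)
      (fun i => if i = v.1 then u.1 else if i = r + 1 then 0 else if i = 0 then r + 1 else
        if i = u.1 then v.1 else i - 1)
      (fun i => if i = v.1 then (if v.1 = r + 1 then 0 else r + 1) else
        if i = r + 1 then v.1 else if i = 0 then r - 1 else if i + 1 = r then 0 else i + 1)
      fun i hi => ?_,
      isCore_spoke_triangle (i := ⟨1, h1⟩) (j := ⟨2, h2⟩) hn (by simp only; omega)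
        (by simp only; omega) (Or.inl rfl) (by simp), ?_⟩
    · refine ⟨?_, ?_, ?_, ?_, ?_, wheelTail_sup_edge_adj hlt ?_, wheelTail_sup_edge_adj hlt ?_⟩ <;>
        (try simp only [wheelTail_adj]) <;> split_ifs <;> omega
    · simp only [Set.mem_ofPred, Set.mem_insert_iff, Set.mem_singleton_iff, Fin.ext_iff]
      omega

lemma coreSaturated_wheelTail {n r : ℕ} (hr : 5 ≤ r) (hn : r + 1 ≤ n) :
    (wheelTail n r).CoreSaturated := by
  refine coreSaturated_of_lt (isRim_wheelTail hr hn).noDisjointCores fun u v huv hadj => ?_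
  have hlt : u.1 < v.1 := huv
  rw [wheelTail_adj] at hadj
  by_cases hv : v.1 < r
  · exact exists_cores_wheelTail_chord hr hn (by omega) hv (by omega)
  by_cases hu : u.1 < r
  · exact exists_cores_wheelTail_tail hr hu (by omega) (by omega)
  have h0 : 0 < n := by omega
  have h1 : 1 < n := by omega
  have hr1 : r + 1 < n := by omega
  -- Only pairs of hub and pendant vertex, or of two pendant vertices, are left; both close a
  -- triangle with `r + 1`.
  have hD : (wheelTail n r ⊔ edge u v).IsCore {u, v, ⟨r + 1, hr1⟩} := by
    refine isCore_triple (wheelTail_sup_edge_adj huv ?_) (wheelTail_sup_edge_adj huv ?_)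
      (wheelTail_sup_edge_adj huv ?_) <;> simp only [wheelTail_adj, true_or, or_true, true_and, and_true] <;> omega
  by_cases hur : u.1 = r
  · refine ⟨_, _, hD, isCore_rim hr hn, ?_⟩
    simp only [Set.mem_insert_iff, Set.mem_singleton_iff, Fin.ext_iff, Set.mem_ofPred]
    omega
  · refine ⟨_, _, hD, isCore_spoke_triangle (i := ⟨0, h0⟩) (j := ⟨1, h1⟩) hn
      (by simp only; omega) (by simp only; omega) (Or.inl rfl) (by simp), ?_⟩
    simp only [Set.mem_insert_iff, Set.mem_singleton_iff, Fin.ext_iff]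
    omega

/-- The hub has degree `r + 1`, its neighbours being the rim and the vertex `r + 1`; the size
follows from `IsRim.ncard_edgeSet`. -/
lemma ncard_edgeSet_wheelTail {n r : ℕ} (hr : 5 ≤ r) (hn : r + 2 ≤ n) :
    (wheelTail n r).edgeSet.ncard = n + r := by
  have hn' : r < n := by omega
  have h := (isRim_wheelTail hr hn').ncard_edgeSet (coreSaturated_wheelTail hr hn')
    (isAlmostForest_wheelTail hr hn')
  have he : ((insert (r + 1) (Finset.range r) : Finset ℕ) : Set ℕ) =
      Fin.val '' ((wheelTail n r).neighborSet ⟨r, hn'⟩) := by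
    ext k
    simp only [Finset.coe_insert, Finset.coe_range, Set.mem_insert_iff, Set.mem_Iio, Set.mem_image,
      mem_neighborSet, wheelTail_adj]
    constructor
    · intro hk
      exact ⟨⟨k, by omega⟩, by simp only [true_or, or_true, and_true]; omega, rfl⟩
    · rintro ⟨i, hi, rfl⟩
      omega
  have h2 := Set.ncard_image_of_injective ((wheelTail n r).neighborSet ⟨r, hn'⟩) Fin.val_injective
  rw [← he, Set.ncard_coe_finset, Finset.card_insert_of_notMem (by simp), Finset.card_range] at h2
  rw [← h2, Nat.card_fin] at h
  omega

lemma ncard_edgeSet_wheelTail_self {r : ℕ} (hr : 5 ≤ r) :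
    (wheelTail (r + 1) r).edgeSet.ncard = 2 * r := by
  have h := (isRim_wheelTail hr le_rfl).ncard_edgeSet (coreSaturated_wheelTail hr le_rfl)
    (isAlmostForest_wheelTail hr le_rfl)
  have he : ((Finset.range r : Finset ℕ) : Set ℕ) =
      Fin.val '' ((wheelTail (r + 1) r).neighborSet ⟨r, Nat.lt_succ_self r⟩) := by
    ext k
    simp only [Finset.coe_range, Set.mem_Iio, Set.mem_image, mem_neighborSet, wheelTail_adj]
    constructor
    · intro hk
      exact ⟨⟨k, by omega⟩, by simp only [true_or, or_true, and_true]; omega, rfl⟩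
    · rintro ⟨i, hi, rfl⟩
      omega
  have h2 := Set.ncard_image_of_injective
    ((wheelTail (r + 1) r).neighborSet ⟨r, Nat.lt_succ_self r⟩) Fin.val_injective
  rw [← he, Set.ncard_coe_finset, Finset.card_range] at h2
  rw [← h2, Nat.card_fin] at h
  omega

/-- The complete graph on `0, …, 4` with the pendant edge `0 5`. -/
def completePendant : SimpleGraph (Fin 6) :=
  fromRel fun i j => i.1 < j.1 ∧ (j.1 = 5 → i.1 = 0)

instance : DecidableRel completePendant.Adj := fun i j =>
  inferInstanceAs (Decidable (i ≠ j ∧ (i.1 < j.1 ∧ (j.1 = 5 → i.1 = 0) ∨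
    j.1 < i.1 ∧ (i.1 = 5 → j.1 = 0))))

set_option maxRecDepth 10000 in
lemma ncard_edgeSet_completePendant : completePendant.edgeSet.ncard = 11 := by
  rw [Set.ncard_eq_toFinset_card']
  decide

/-- No core contains the pendant vertex, and two disjoint cores do not fit into five vertices. A new
edge at the pendant vertex closes a triangle with `0`, and the other three vertices form the second
triangle. -/
lemma coreSaturated_completePendant : completePendant.CoreSaturated := by
  refine coreSaturated_of_lt (fun D _ E _ hD hE hdis => ?_) fun u v huv hadj => ?_
  · have key : ∀ D, completePendant.IsCore D → D ⊆ {5}ᶜ := by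
      rintro D hD x hx rfl
      have h5 : ∀ y, completePendant.Adj 5 y → y = 0 := by decide
      exact hD.notMem_of_unique (fun y _ => h5 y) hx
    have h1 := Set.ncard_le_ncard (Set.union_subset (key D hD) (key E hE))
    rw [Set.ncard_union_eq hdis, Set.ncard_compl, Set.ncard_singleton, Nat.card_fin] at h1
    have := hD.two_lt_ncard
    have := hE.two_lt_ncard
    omega
  · have hnew : (completePendant ⊔ edge u v).Adj u v :=
      Or.inr ((edge_adj ..).2 ⟨Or.inl ⟨rfl, rfl⟩, huv.ne⟩)
    have hex : ∀ u v : Fin 6, u < v → ¬ completePendant.Adj u v → completePendant.Adj v 0 ∧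
        completePendant.Adj u 0 ∧ ∃ a b c, completePendant.Adj a b ∧ completePendant.Adj b c ∧
          completePendant.Adj a c ∧ a ≠ u ∧ a ≠ v ∧ a ≠ 0 ∧ b ≠ u ∧ b ≠ v ∧ b ≠ 0 ∧ c ≠ u ∧
          c ≠ v ∧ c ≠ 0 := by
      decide
    obtain ⟨h1, h2, a, b, c, h3, h4, h5, h6⟩ := hex u v huv hadj
    refine ⟨{u, v, 0}, {a, b, c}, isCore_triple hnew (Or.inl h1) (Or.inl h2),
      isCore_triple h3 h4 h5, ?_⟩
    rintro x (rfl | rfl | rfl) (h | h | h) <;> simp_all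

end SimpleGraph

/-! ### The spectrum -/

open SimpleGraph in
lemma exists_of_mem_satSpectrum {n m : ℕ} (h : m ∈ satSpectrum n (disjointCycles 2))
    (hn : 6 ≤ n) : (∃ t ∈ Set.Icc 3 (n - 3), m = n + 2 * t) ∨ m = n + 5 ∨
      (m ≤ 2 * n - 2 ∧ n + 4 ≤ m ∧ (7 ≤ n → n + 5 ≤ m)) := by
  obtain ⟨G, hG, rfl⟩ := h
  have := (isSaturated_disjointCycles_iff.1 hG).ncard_edgeSet (by rwa [Nat.card_fin])
  rw [Nat.card_fin] at this
  obtain ⟨k, h1, h2, h3⟩ | h | h := this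
  · exact Or.inl ⟨k, ⟨h1, by omega⟩, h3⟩
  · exact Or.inr (Or.inl h)
  · exact Or.inr (Or.inr ⟨by omega, h.2⟩)

open SimpleGraph in
lemma add_two_mul_mem_satSpectrum {n t : ℕ} (ht : t ∈ Set.Icc 3 (n - 3)) :
    n + 2 * t ∈ satSpectrum n (disjointCycles 2) := by
  have h1 := ht.1
  have h2 := ht.2
  exact ⟨triangleJoin n t,
    isSaturated_disjointCycles_iff.2 (coreSaturated_triangleJoin h1 (by omega)),
    ncard_edgeSet_triangleJoin h1 (by omega)⟩

open SimpleGraph in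
lemma mem_satSpectrum_of_mem_Icc {n m : ℕ} (hm : m ∈ Set.Icc (n + 5) (2 * n - 2)) :
    m ∈ satSpectrum n (disjointCycles 2) := by
  have h1 := hm.1
  have h2 := hm.2
  refine ⟨wheelTail n (m - n),
    isSaturated_disjointCycles_iff.2 (coreSaturated_wheelTail (by omega) (by omega)), ?_⟩
  rw [ncard_edgeSet_wheelTail (by omega) (by omega)]
  omega

lemma satSpectrum_disjointCycles {n : ℕ} (hn : 7 ≤ n) : satSpectrum n (disjointCycles 2) =
    Set.Icc (n + 5) (2 * n - 2) ∪ {m | ∃ t ∈ Set.Icc 3 (n - 3), m = n + 2 * t} := by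
  ext m
  constructor
  · intro h
    obtain h | h | h := exists_of_mem_satSpectrum h (by omega)
    · exact Or.inr h
    · exact Or.inl ⟨by omega, by omega⟩
    · exact Or.inl ⟨h.2.2 hn, h.1⟩
  · rintro (h | ⟨t, ht, rfl⟩)
    · exact mem_satSpectrum_of_mem_Icc h
    · exact add_two_mul_mem_satSpectrum ht

open SimpleGraph in
lemma satSpectrum_six_disjointCycles : satSpectrum 6 (disjointCycles 2) = Set.Icc 10 12 := by
  ext m
  constructor
  · intro h
    obtain ⟨t, ht, rfl⟩ | h | h := exists_of_mem_satSpectrum h le_rfl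
    · have h1 := ht.1
      have h2 := ht.2
      exact ⟨by omega, by omega⟩
    · exact ⟨by omega, by omega⟩
    · exact ⟨by omega, by omega⟩
  · rintro ⟨h1, h2⟩
    obtain rfl | rfl | rfl : m = 10 ∨ m = 11 ∨ m = 12 := by omega
    · exact ⟨wheelTail 6 5,
        isSaturated_disjointCycles_iff.2 (coreSaturated_wheelTail le_rfl le_rfl),
        ncard_edgeSet_wheelTail_self le_rfl⟩
    · exact ⟨completePendant, isSaturated_disjointCycles_iff.2 coreSaturated_completePendant,
        ncard_edgeSet_completePendant⟩
    · exact add_two_mul_mem_satSpectrum (n := 6) (t := 3) ⟨le_rfl, le_rfl⟩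

theorem mainTheorem2 :
    (satSpectrum 6 (disjointCycles 2) =
        Set.Icc (satNumber 6 (disjointCycles 2)) (turanNumber 6 (disjointCycles 2)) ∧
      satNumber 6 (disjointCycles 2) = 10 ∧
      turanNumber 6 (disjointCycles 2) = 12 ∧
      satSpectrum 6 (disjointCycles 2) = Set.Icc 10 12) ∧
    (∀ n : ℕ, 7 ≤ n →
      (∀ m ∈ Set.Icc (n + 5) (3 * n - 6),
        (∃ G : SimpleGraph (Fin n), IsSaturated (disjointCycles 2) G ∧ G.edgeSet.ncard = m) ↔
          (m ∈ Set.Icc (n + 5) (2 * n - 2) ∨ Even (m - n))) ∧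
      satSpectrum n (disjointCycles 2) =
        Set.Icc (n + 5) (2 * n - 2) ∪ {m | ∃ t ∈ Set.Icc 3 (n - 3), m = n + 2 * t} ∧
      (∀ m : ℕ, 2 * n - 1 ≤ m →
        ((∃ G : SimpleGraph (Fin n), IsSaturated (disjointCycles 2) G ∧ G.edgeSet.ncard = m) ↔
          (Even (m - n) ∧ m ≤ 3 * n - 6)))) := by
  have hsat : satNumber 6 (disjointCycles 2) = 10 := by
    rw [satNumber, satSpectrum_six_disjointCycles, csInf_Icc (by norm_num)]
  have htur : turanNumber 6 (disjointCycles 2) = 12 := by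
    rw [turanNumber, satSpectrum_six_disjointCycles, csSup_Icc (by norm_num)]
  refine ⟨⟨?_, hsat, htur, satSpectrum_six_disjointCycles⟩, fun n hn => ?_⟩
  · rw [hsat, htur, satSpectrum_six_disjointCycles]
  have key : ∀ m, (∃ G : SimpleGraph (Fin n), IsSaturated (disjointCycles 2) G ∧
      G.edgeSet.ncard = m) ↔ (m ∈ Set.Icc (n + 5) (2 * n - 2) ∨
        ∃ t ∈ Set.Icc 3 (n - 3), m = n + 2 * t) := fun m =>
    Set.ext_iff.1 (satSpectrum_disjointCycles hn) m
  -- The bound `n + 5 ≤ m` makes `m - n` a true difference and, for even `m - n`, forces `3 ≤ t`.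
  have heven : ∀ m, n + 5 ≤ m → ((∃ t ∈ Set.Icc 3 (n - 3), m = n + 2 * t) ↔
      (Even (m - n) ∧ m ≤ 3 * n - 6)) := by
    intro m hm
    constructor
    · rintro ⟨t, ⟨h1, h2⟩, rfl⟩
      exact ⟨⟨t, by omega⟩, by omega⟩
    · rintro ⟨⟨t, ht⟩, h⟩
      exact ⟨t, ⟨by omega, by omega⟩, by omega⟩
  refine ⟨fun m hm => ?_, satSpectrum_disjointCycles hn, fun m hm => ?_⟩
  · rw [key, heven m hm.1, and_iff_left hm.2]
  · rw [key, ← heven m (by omega), or_iff_right]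
    exact fun h => absurd h.2 (by omega)
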